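/- All manifolds are smooth, Hausdorff and without boundary. A Sasakian manifold $(S,\eta,g)$ is a connected manifold of dimension $2n+1$ ($n\ge 0$) with a contact form $\eta$, its Reeb vector field $\xi$ (so $\eta(\xi)=1$ and $i_\xi d\eta=0$), a Riemannian metric $g$ and the $(1,1)$-tensor $\phi$ determined by $d\eta(X,Y)=2g(X,\phi Y)$ (where $d\eta(X,Y)=X\eta(Y)-Y\eta(X)-\eta([X,Y])$), such that $\phi^2X=-X+\eta(X)\xi$, $g(\phi X,\phi Y)=g(X,Y)-\eta(X)\eta(Y)$ and $$\phi^2[X,Y]+[\phi X,\phi Y]-\phi[\phi X,Y]-\phi[X,\phi Y]=-d\eta(X,Y)\,\xi$$ for all vector fields $X,Y$. It is regular if every point lies in a chart $U\to\mathbb R\times\mathbb R^{2n}$, foliated for the Reeb foliation $\mathcal F$ (the foliation by the integral curves of $\xi$), such that every leaf of $\mathcal F$ meets at most one plaque of $U$; the plaques are the connected components of the preimages of the lines $\mathbb R\times\{y\}$. A Sasakian immersion $\varphi:(S,\eta,g)\to(S',\eta',g')$ is a smooth immersion with $\varphi^*g'=g$, $\varphi^*\eta'=\eta$, $\varphi_*\xi=\xi'$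 and $\varphi_*\circ\phi=\phi'\circ\varphi_*$. A Kähler immersion is a holomorphic isometric immersion of Kähler manifolds, not necessarily injective. A Boothby–Wang submersion of $S$ is a smooth surjective Riemannian submersion $\pi:S\to M$ onto a Kähler manifold $M$ with complex structure $J$, whose fibres are the leaves of $\mathcal F$ and which satisfies $J\circ\pi_*=\pi_*\circ\phi$; so $M$ is the leaf space $S/\mathcal F$, and $M$ with its Kähler structure is determined by $S$ up to isomorphism. **Proposition 2.3.** Let $\varphi:S\to S'$ be a Sasakian immersion between compact Sasakian manifolds, with $S'$ regular. Then $S$ is regular, and $S$ and $S'$ both have Boothby–Wang submersions. Moreover, for all Boothby–Wang submersions $\pi:S\to M$ and $\pi':S'\to M'$ there is a Kähler immersion $i(\varphi):M\to M'$ such that $i(\varphi)\circ\pi=\pi'\circ\varphi$. -/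

import Mathlib

open scoped Manifold ContDiff Bundle

/-! Manifolds are smooth real manifolds without boundary, modelled on `EuclideanSpace ℝ (Fin k)`. -/

section Calculus

variable {k : ℕ} {M : Type*} [TopologicalSpace M] [ChartedSpace (EuclideanSpace ℝ (Fin k)) M]
  [IsManifold (𝓡 k) ∞ M]

/-- The vector field `X`, defined on all of `M`, is smooth near the point `x`. -/
def SmoothFieldAt (X : ∀ y : M, TangentSpace (𝓡 k) y) (x : M) : Prop :=
  ContMDiffAt (𝓡 k) (𝓡 k).tangent ∞ (fun y => (⟨y, X y⟩ : TangentBundle (𝓡 k) M)) x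

/-- The directional derivative `X(h)` of a real function `h` at `x`. -/
noncomputable def fieldDeriv (X : ∀ y : M, TangentSpace (𝓡 k) y) (h : M → ℝ) (x : M) : ℝ :=
  mfderiv (𝓡 k) 𝓘(ℝ, ℝ) h x (X x)

/-- The exterior derivative of a 1-form, evaluated on two vector fields:
`dη(X, Y) = X(η(Y)) - Y(η(X)) - η([X, Y])`. -/
noncomputable def extDerivOne (η : ∀ y : M, TangentSpace (𝓡 k) y →L[ℝ] ℝ)
    (X Y : ∀ y : M, TangentSpace (𝓡 k) y) (x : M) : ℝ :=
  fieldDeriv X (fun y => η y (Y y)) x - fieldDeriv Y (fun y => η y (X y)) x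
    - η x (VectorField.mlieBracket (𝓡 k) X Y x)

/-- The exterior derivative of a 2-form `Ω`, evaluated on three vector fields. -/
noncomputable def extDerivTwo
    (Ω : ∀ y : M, TangentSpace (𝓡 k) y → TangentSpace (𝓡 k) y → ℝ)
    (X Y Z : ∀ y : M, TangentSpace (𝓡 k) y) (x : M) : ℝ :=
  fieldDeriv X (fun y => Ω y (Y y) (Z y)) x
    + fieldDeriv Y (fun y => Ω y (Z y) (X y)) x
    + fieldDeriv Z (fun y => Ω y (X y) (Y y)) x
    - Ω x (VectorField.mlieBracket (𝓡 k) X Y x) (Z x)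
    - Ω x (VectorField.mlieBracket (𝓡 k) Y Z x) (X x)
    - Ω x (VectorField.mlieBracket (𝓡 k) Z X x) (Y x)

/-- The Nijenhuis torsion of a field of endomorphisms `A`:
`[A, A](X, Y) = A²[X, Y] + [AX, AY] - A[AX, Y] - A[X, AY]`. -/
noncomputable def nijenhuis (A : ∀ y : M, TangentSpace (𝓡 k) y →L[ℝ] TangentSpace (𝓡 k) y)
    (X Y : ∀ y : M, TangentSpace (𝓡 k) y) (x : M) : TangentSpace (𝓡 k) x :=
  A x (A x (VectorField.mlieBracket (𝓡 k) X Y x))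
    + VectorField.mlieBracket (𝓡 k) (fun y => A y (X y)) (fun y => A y (Y y)) x
    - A x (VectorField.mlieBracket (𝓡 k) (fun y => A y (X y)) Y x)
    - A x (VectorField.mlieBracket (𝓡 k) X (fun y => A y (Y y)) x)

end Calculus

section Structures

/-- A Sasakian structure on a `(2n+1)`-manifold `S`: a contact form `η` with Reeb field `ξ`, a
Riemannian metric `g` and the endomorphism field `φ` determined by `dη(X, Y) = 2 g(X, φ Y)`,
subject to the contact metric identities and to normality. The contact condition
`η ∧ (dη)^n ≠ 0` holds automatically: by `φ_sq` and `dη_eq`, the form `dη` is nondegenerate on the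
hyperplane `ker η`. The differential identities are tensorial, so they are stated at each point
for vector fields smooth near that point. -/
structure SasakianStructure (n : ℕ) (S : Type*) [TopologicalSpace S]
    [ChartedSpace (EuclideanSpace ℝ (Fin (2 * n + 1))) S] [IsManifold (𝓡 (2 * n + 1)) ∞ S] where
  /-- the contact form -/
  η : ∀ x : S, TangentSpace (𝓡 (2 * n + 1)) x →L[ℝ] ℝ
  /-- the Reeb vector field -/
  ξ : ∀ x : S, TangentSpace (𝓡 (2 * n + 1)) x
  /-- the endomorphism field -/
  φ : ∀ x : S, TangentSpace (𝓡 (2 * n + 1)) x →L[ℝ] TangentSpace (𝓡 (2 * n + 1)) x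
  /-- the Riemannian metric -/
  g : Bundle.ContMDiffRiemannianMetric (𝓡 (2 * n + 1)) ∞ (EuclideanSpace ℝ (Fin (2 * n + 1)))
    (fun x : S => TangentSpace (𝓡 (2 * n + 1)) x)
  η_smooth : ContMDiff (𝓡 (2 * n + 1))
    ((𝓡 (2 * n + 1)).prod 𝓘(ℝ, EuclideanSpace ℝ (Fin (2 * n + 1)) →L[ℝ] ℝ)) ∞
    (fun x : S => Bundle.TotalSpace.mk' (EuclideanSpace ℝ (Fin (2 * n + 1)) →L[ℝ] ℝ)
      (E := fun x : S => TangentSpace (𝓡 (2 * n + 1)) x →L[ℝ] Bundle.Trivial S ℝ x) x (η x))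
  ξ_smooth : ∀ x, SmoothFieldAt ξ x
  φ_smooth : ContMDiff (𝓡 (2 * n + 1))
    ((𝓡 (2 * n + 1)).prod 𝓘(ℝ, EuclideanSpace ℝ (Fin (2 * n + 1)) →L[ℝ]
      EuclideanSpace ℝ (Fin (2 * n + 1)))) ∞
    (fun x : S => Bundle.TotalSpace.mk'
      (EuclideanSpace ℝ (Fin (2 * n + 1)) →L[ℝ] EuclideanSpace ℝ (Fin (2 * n + 1)))
      (E := fun x : S => TangentSpace (𝓡 (2 * n + 1)) x →L[ℝ] TangentSpace (𝓡 (2 * n + 1)) x)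
      x (φ x))
  η_ξ : ∀ x, η x (ξ x) = 1
  dη_ξ : ∀ (x : S) (X : ∀ y : S, TangentSpace (𝓡 (2 * n + 1)) y), SmoothFieldAt X x →
    extDerivOne η ξ X x = 0
  dη_eq : ∀ (x : S) (X Y : ∀ y : S, TangentSpace (𝓡 (2 * n + 1)) y),
    SmoothFieldAt X x → SmoothFieldAt Y x →
    extDerivOne η X Y x = 2 * g.inner x (X x) (φ x (Y x))
  φ_sq : ∀ (x : S) (v : TangentSpace (𝓡 (2 * n + 1)) x), φ x (φ x v) = -v + η x v • ξ x
  g_φ : ∀ (x : S) (v w : TangentSpace (𝓡 (2 * n + 1)) x),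
    g.inner x (φ x v) (φ x w) = g.inner x v w - η x v * η x w
  normal : ∀ (x : S) (X Y : ∀ y : S, TangentSpace (𝓡 (2 * n + 1)) y),
    SmoothFieldAt X x → SmoothFieldAt Y x →
    nijenhuis φ X Y x = -(extDerivOne η X Y x • ξ x)

/-- A Kähler structure on a `2n`-manifold `M`: an integrable almost complex structure `J` (its
Nijenhuis torsion vanishes) and a `J`-Hermitian Riemannian metric `g` whose fundamental 2-form
`Ω(X, Y) = g(X, J Y)` is closed. -/
structure KahlerStructure (n : ℕ) (M : Type*) [TopologicalSpace M]
    [ChartedSpace (EuclideanSpace ℝ (Fin (2 * n))) M] [IsManifold (𝓡 (2 * n)) ∞ M] where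
  /-- the complex structure -/
  J : ∀ x : M, TangentSpace (𝓡 (2 * n)) x →L[ℝ] TangentSpace (𝓡 (2 * n)) x
  /-- the Riemannian metric -/
  g : Bundle.ContMDiffRiemannianMetric (𝓡 (2 * n)) ∞ (EuclideanSpace ℝ (Fin (2 * n)))
    (fun x : M => TangentSpace (𝓡 (2 * n)) x)
  J_smooth : ContMDiff (𝓡 (2 * n))
    ((𝓡 (2 * n)).prod 𝓘(ℝ, EuclideanSpace ℝ (Fin (2 * n)) →L[ℝ]
      EuclideanSpace ℝ (Fin (2 * n)))) ∞
    (fun x : M => Bundle.TotalSpace.mk'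
      (EuclideanSpace ℝ (Fin (2 * n)) →L[ℝ] EuclideanSpace ℝ (Fin (2 * n)))
      (E := fun x : M => TangentSpace (𝓡 (2 * n)) x →L[ℝ] TangentSpace (𝓡 (2 * n)) x)
      x (J x))
  J_sq : ∀ (x : M) (v : TangentSpace (𝓡 (2 * n)) x), J x (J x v) = -v
  g_J : ∀ (x : M) (v w : TangentSpace (𝓡 (2 * n)) x),
    g.inner x (J x v) (J x w) = g.inner x v w
  integrable : ∀ (x : M) (X Y : ∀ y : M, TangentSpace (𝓡 (2 * n)) y),
    SmoothFieldAt X x → SmoothFieldAt Y x → nijenhuis J X Y x = 0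
  closed : ∀ (x : M) (X Y Z : ∀ y : M, TangentSpace (𝓡 (2 * n)) y),
    SmoothFieldAt X x → SmoothFieldAt Y x → SmoothFieldAt Z x →
    extDerivTwo (fun y v w => g.inner y v (J y w)) X Y Z x = 0

end Structures

section Regularity

variable {n : ℕ} {S : Type*} [TopologicalSpace S]
  [ChartedSpace (EuclideanSpace ℝ (Fin (2 * n + 1))) S] [IsManifold (𝓡 (2 * n + 1)) ∞ S]

/-- `x` and `y` lie on the same leaf of the Reeb foliation: they are joined by an integral curve
of the Reeb field. (The segment may be traversed in either direction, or be a single point.) -/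
def SasakianStructure.SameLeaf (σ : SasakianStructure n S) (x y : S) : Prop :=
  ∃ (γ : ℝ → S) (a b : ℝ), IsMIntegralCurveOn γ σ.ξ (Set.uIcc a b) ∧ γ a = x ∧ γ b = y

/-- A chart `ψ : U → ℝ × ℝ²ⁿ` of the smooth structure, the factor `ℝ` being the coordinate of index
`0`, is foliated when the Reeb field is everywhere tangent to the lines `ℝ × {y}`. -/
def SasakianStructure.IsFoliatedChart (σ : SasakianStructure n S)
    (ψ : OpenPartialHomeomorph S (EuclideanSpace ℝ (Fin (2 * n + 1)))) : Prop :=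
  ψ ∈ IsManifold.maximalAtlas (𝓡 (2 * n + 1)) ∞ S ∧
  ∀ x ∈ ψ.source, ∀ j : Fin (2 * n), fieldDeriv σ.ξ (fun q => ψ q j.succ) x = 0

/-- The plaque through `p` of the chart `ψ : U → ℝ × ℝ²ⁿ`: the connected component containing `p`
of `ψ⁻¹(ℝ × {y})`, where `y` is the `ℝ²ⁿ`-coordinate of `p`. -/
def plaque (ψ : OpenPartialHomeomorph S (EuclideanSpace ℝ (Fin (2 * n + 1)))) (p : S) : Set S :=
  connectedComponentIn {q | q ∈ ψ.source ∧ ∀ j : Fin (2 * n), ψ q j.succ = ψ p j.succ} p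

/-- Regularity of the Reeb foliation: each point lies in a foliated chart of which every leaf meets
at most one plaque. -/
def SasakianStructure.IsRegular (σ : SasakianStructure n S) : Prop :=
  ∀ x : S, ∃ ψ : OpenPartialHomeomorph S (EuclideanSpace ℝ (Fin (2 * n + 1))),
    σ.IsFoliatedChart ψ ∧ x ∈ ψ.source ∧
    ∀ p ∈ ψ.source, ∀ q ∈ ψ.source, σ.SameLeaf p q → plaque ψ p = plaque ψ q

end Regularity

section Maps

/-- A Sasakian immersion: an isometric immersion that preserves the contact forms, the Reeb fields
and the endomorphism fields. -/
structure IsSasakianImmersion {n n' : ℕ} {S S' : Type*}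
    [TopologicalSpace S] [ChartedSpace (EuclideanSpace ℝ (Fin (2 * n + 1))) S]
    [IsManifold (𝓡 (2 * n + 1)) ∞ S]
    [TopologicalSpace S'] [ChartedSpace (EuclideanSpace ℝ (Fin (2 * n' + 1))) S']
    [IsManifold (𝓡 (2 * n' + 1)) ∞ S']
    (σ : SasakianStructure n S) (σ' : SasakianStructure n' S') (f : S → S') : Prop where
  smooth : ContMDiff (𝓡 (2 * n + 1)) (𝓡 (2 * n' + 1)) ∞ f
  immersion : ∀ x, Function.Injective (mfderiv (𝓡 (2 * n + 1)) (𝓡 (2 * n' + 1)) f x)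
  isometric : ∀ (x : S) (v w : TangentSpace (𝓡 (2 * n + 1)) x),
    σ'.g.inner (f x) (mfderiv (𝓡 (2 * n + 1)) (𝓡 (2 * n' + 1)) f x v)
      (mfderiv (𝓡 (2 * n + 1)) (𝓡 (2 * n' + 1)) f x w) = σ.g.inner x v w
  map_η : ∀ (x : S) (v : TangentSpace (𝓡 (2 * n + 1)) x),
    σ'.η (f x) (mfderiv (𝓡 (2 * n + 1)) (𝓡 (2 * n' + 1)) f x v) = σ.η x v
  map_ξ : ∀ x : S, mfderiv (𝓡 (2 * n + 1)) (𝓡 (2 * n' + 1)) f x (σ.ξ x) = σ'.ξ (f x)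
  map_φ : ∀ (x : S) (v : TangentSpace (𝓡 (2 * n + 1)) x),
    mfderiv (𝓡 (2 * n + 1)) (𝓡 (2 * n' + 1)) f x (σ.φ x v) =
      σ'.φ (f x) (mfderiv (𝓡 (2 * n + 1)) (𝓡 (2 * n' + 1)) f x v)

/-- A Kähler immersion: a holomorphic isometric immersion (not necessarily injective). -/
structure IsKahlerImmersion {n n' : ℕ} {M M' : Type*}
    [TopologicalSpace M] [ChartedSpace (EuclideanSpace ℝ (Fin (2 * n))) M]
    [IsManifold (𝓡 (2 * n)) ∞ M]
    [TopologicalSpace M'] [ChartedSpace (EuclideanSpace ℝ (Fin (2 * n'))) M']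
    [IsManifold (𝓡 (2 * n')) ∞ M']
    (κ : KahlerStructure n M) (κ' : KahlerStructure n' M') (i : M → M') : Prop where
  smooth : ContMDiff (𝓡 (2 * n)) (𝓡 (2 * n')) ∞ i
  immersion : ∀ x, Function.Injective (mfderiv (𝓡 (2 * n)) (𝓡 (2 * n')) i x)
  isometric : ∀ (x : M) (v w : TangentSpace (𝓡 (2 * n)) x),
    κ'.g.inner (i x) (mfderiv (𝓡 (2 * n)) (𝓡 (2 * n')) i x v)
      (mfderiv (𝓡 (2 * n)) (𝓡 (2 * n')) i x w) = κ.g.inner x v w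
  holomorphic : ∀ (x : M) (v : TangentSpace (𝓡 (2 * n)) x),
    mfderiv (𝓡 (2 * n)) (𝓡 (2 * n')) i x (κ.J x v) =
      κ'.J (i x) (mfderiv (𝓡 (2 * n)) (𝓡 (2 * n')) i x v)

/-- `p : S → M` is the Boothby–Wang submersion of the Sasakian manifold `S` onto the Kähler manifold
`M`: a surjective smooth submersion whose fibres are the leaves of the Reeb foliation (so that `M`
is the leaf space), which is a Riemannian submersion, and which carries `φ` to the complex
structure. These conditions determine the Kähler manifold `M` up to a unique isomorphism over `S`,
and they imply `2 p^*Ω = dη`. -/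
structure IsBoothbyWang {n : ℕ} {S M : Type*}
    [TopologicalSpace S] [ChartedSpace (EuclideanSpace ℝ (Fin (2 * n + 1))) S]
    [IsManifold (𝓡 (2 * n + 1)) ∞ S]
    [TopologicalSpace M] [ChartedSpace (EuclideanSpace ℝ (Fin (2 * n))) M]
    [IsManifold (𝓡 (2 * n)) ∞ M]
    (σ : SasakianStructure n S) (κ : KahlerStructure n M) (p : S → M) : Prop where
  smooth : ContMDiff (𝓡 (2 * n + 1)) (𝓡 (2 * n)) ∞ p
  surjective : Function.Surjective p
  submersion : ∀ x, Function.Surjective (mfderiv (𝓡 (2 * n + 1)) (𝓡 (2 * n)) p x)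
  fibre : ∀ x y, p x = p y ↔ σ.SameLeaf x y
  riemannian : ∀ (x : S) (v w : TangentSpace (𝓡 (2 * n + 1)) x),
    (∀ u, mfderiv (𝓡 (2 * n + 1)) (𝓡 (2 * n)) p x u = 0 → σ.g.inner x v u = 0) →
    (∀ u, mfderiv (𝓡 (2 * n + 1)) (𝓡 (2 * n)) p x u = 0 → σ.g.inner x w u = 0) →
    κ.g.inner (p x) (mfderiv (𝓡 (2 * n + 1)) (𝓡 (2 * n)) p x v)
      (mfderiv (𝓡 (2 * n + 1)) (𝓡 (2 * n)) p x w) = σ.g.inner x v w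
  map_φ : ∀ (x : S) (v : TangentSpace (𝓡 (2 * n + 1)) x),
    mfderiv (𝓡 (2 * n + 1)) (𝓡 (2 * n)) p x (σ.φ x v) =
      κ.J (p x) (mfderiv (𝓡 (2 * n + 1)) (𝓡 (2 * n)) p x v)

/-- `S` has a Boothby–Wang base: a Hausdorff Kähler manifold `M` with a Boothby–Wang submersion
`S → M`. (If `S` is compact, so is `M`.) -/
def SasakianStructure.HasBoothbyWangBase.{u} {n : ℕ} {S : Type u}
    [TopologicalSpace S] [ChartedSpace (EuclideanSpace ℝ (Fin (2 * n + 1))) S]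
    [IsManifold (𝓡 (2 * n + 1)) ∞ S] (σ : SasakianStructure n S) : Prop :=
  ∃ (M : Type u) (_ : TopologicalSpace M) (_ : T2Space M)
    (_ : ChartedSpace (EuclideanSpace ℝ (Fin (2 * n))) M) (_ : IsManifold (𝓡 (2 * n)) ∞ M)
    (κ : KahlerStructure n M) (p : S → M), IsBoothbyWang σ κ p

end Maps

/-!
Let `ξ` be the Reeb field. The proof turns on maps `Y : S → ℝᵈ` transverse to the Reeb foliation
(`IsTransverseAt`): smooth, constant along `ξ`, and with the kernel of the differential spanned by
`ξ`. By the inverse function theorem, such a map, if it takes equal values at points of the same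
leaf, can be completed to a chart in which the leaves are exactly the lines parallel to the first
axis (`IsLeafChart`, `IsTransverseAt.exists_isLeafChart`). Leaf charts exist if and
only if `S` is regular (`IsRegular.hasLeafCharts`, `HasLeafCharts.isRegular`). If `Y` is transverse
on `S'`, then `Y ∘ f` is transverse on `S` for every Sasakian immersion `f : S → S'`, because `f` is
an immersion that preserves the Reeb fields; hence regularity passes from `S'` to `S`
(`IsSasakianImmersion.hasLeafCharts`).

Translations in leaf charts, composed along a leaf, move a neighbourhood of any point of the leaf to
a neighbourhood of any other one (`HasLeafCharts.isLeafShift`). So the projection to the leaf space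
is open, and the last `2n` coordinates of the leaf charts are an atlas for which it is a submersion
(`IsLeafQuotient.isLeafSubmersion`). If `S` is compact, the relation of lying on the same leaf is
closed, and the leaf space is Hausdorff (`HasLeafCharts.eventually_not_sameLeaf`).

Normality, applied to `ξ` and a second field, shows that `ξ` preserves `φ`; since
`dη = 2 g(·, φ ·)` is closed and annihilated by `ξ`, the field `ξ` preserves the metric on the image
of `φ` as well. Both therefore descend to the leaf space
(`IsLeafSubmersion.transverse_invariance`), where they give the complex structure `J` and the
metric. Lifting vector fields, one sees that the Nijenhuis torsion of `J` is the projection of the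
vanishing horizontal part of that of `φ`, and that the fundamental form pulls back to `dη / 2`,
hence is closed (`IsLeafSubmersion.exists_isBoothbyWang`).

A Sasakian immersion maps leaves to leaves, so it induces a map `i` of the leaf spaces, which is
smooth because Boothby–Wang submersions have local sections. As the metric and the complex
structure of the bases are determined by `g` and `φ`, the map `i` is isometric and holomorphic
(`IsSasakianImmersion.exists_isKahlerImmersion`).
-/

/-! ### Derivatives, Lie brackets and tangent maps -/

section VectorDerivative

open VectorField Set Filter Topology

variable {k : ℕ} {M : Type*} [TopologicalSpace M] [ChartedSpace (EuclideanSpace ℝ (Fin k)) M]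
  {F : Type*} [NormedAddCommGroup F] [NormedSpace ℝ F]

/-- The derivative of a vector-valued function on a manifold, with values in the vector space
itself instead of its tangent space. -/
noncomputable def vderiv (h : M → F) (y : M) : TangentSpace (𝓡 k) y →L[ℝ] F :=
  mfderiv (𝓡 k) 𝓘(ℝ, F) h y

theorem fieldDeriv_eq_vderiv [IsManifold (𝓡 k) ∞ M] (X : ∀ y : M, TangentSpace (𝓡 k) y)
    (h : M → ℝ) (x : M) : fieldDeriv X h x = vderiv h x (X x) := rfl

/-- The vector field `X`, read in the preferred chart at `x`. -/
noncomputable def chartField (X : ∀ y : M, TangentSpace (𝓡 k) y) (x : M)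
    (u : EuclideanSpace ℝ (Fin k)) : EuclideanSpace ℝ (Fin k) :=
  vderiv (extChartAt (𝓡 k) x) ((extChartAt (𝓡 k) x).symm u) (X ((extChartAt (𝓡 k) x).symm u))

theorem vderiv_extChartAt_apply (X : ∀ y : M, TangentSpace (𝓡 k) y) {x y : M}
    (hy : y ∈ (extChartAt (𝓡 k) x).source) :
    vderiv (extChartAt (𝓡 k) x) y (X y) = chartField X x (extChartAt (𝓡 k) x y) :=
  congrArg (fun z => vderiv (extChartAt (𝓡 k) x) z (X z)) ((extChartAt (𝓡 k) x).left_inv hy).symm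

variable [IsManifold (𝓡 k) ∞ M]

theorem mdifferentiableAt_extChartAt_symm {x y : M} (hy : y ∈ (extChartAt (𝓡 k) x).source) :
    MDifferentiableAt 𝓘(ℝ, EuclideanSpace ℝ (Fin k)) (𝓡 k) (extChartAt (𝓡 k) x).symm
      (extChartAt (𝓡 k) x y) := by
  have := mdifferentiableWithinAt_extChartAt_symm ((extChartAt (𝓡 k) x).map_source hy)
  rwa [ModelWithCorners.range_eq_univ, mdifferentiableWithinAt_univ] at this

/-- The derivative of a function, computed in the preferred chart at `x`. -/
theorem vderiv_eq_fderiv {h : M → F} {x y : M} (hy : y ∈ (extChartAt (𝓡 k) x).source)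
    (hh : MDifferentiableAt (𝓡 k) 𝓘(ℝ, F) h y) (v : TangentSpace (𝓡 k) y) :
    vderiv h y v = fderiv ℝ (h ∘ (extChartAt (𝓡 k) x).symm) (extChartAt (𝓡 k) x y)
      (vderiv (extChartAt (𝓡 k) x) y v) := by
  have hy' : y ∈ (chartAt (EuclideanSpace ℝ (Fin k)) x).source := by
    rwa [← extChartAt_source (I := 𝓡 k)]
  have hc : MDifferentiableAt 𝓘(ℝ, EuclideanSpace ℝ (Fin k)) 𝓘(ℝ, F)
      (h ∘ (extChartAt (𝓡 k) x).symm) (extChartAt (𝓡 k) x y) := by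
    refine MDifferentiableAt.comp _ (I' := 𝓡 k) ?_ (mdifferentiableAt_extChartAt_symm hy)
    rwa [(extChartAt (𝓡 k) x).left_inv hy]
  have heq : h =ᶠ[𝓝 y] (h ∘ (extChartAt (𝓡 k) x).symm) ∘ (extChartAt (𝓡 k) x) := by
    filter_upwards [extChartAt_source_mem_nhds' hy] with z hz
    exact congrArg h ((extChartAt (𝓡 k) x).left_inv hz).symm
  have h1 := mfderiv_comp y hc (mdifferentiableAt_extChartAt (I := 𝓡 k) hy')
  rw [vderiv, heq.mfderiv_eq, h1, mfderiv_eq_fderiv]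
  rfl

/-- `chartField` is the pullback of the vector field in terms of which `mlieBracket` is defined. -/
theorem mpullbackWithin_extChartAt_symm_eq (X : ∀ y : M, TangentSpace (𝓡 k) y) {x : M}
    {u : EuclideanSpace ℝ (Fin k)} (hu : u ∈ (extChartAt (𝓡 k) x).target) :
    mpullbackWithin 𝓘(ℝ, EuclideanSpace ℝ (Fin k)) (𝓡 k) (extChartAt (𝓡 k) x).symm X
      (range (𝓡 k)) u = chartField X x u := by
  have h := ContinuousLinearMap.inverse_eq
    (mfderivWithin_extChartAt_symm_comp_mfderiv_extChartAt (I := 𝓡 k) hu)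
    (mfderiv_extChartAt_comp_mfderivWithin_extChartAt_symm (I := 𝓡 k) hu)
  rw [mpullbackWithin_apply, h]
  rfl

theorem differentiableAt_chartField {X : ∀ y : M, TangentSpace (𝓡 k) y} {x : M}
    (hX : MDifferentiableAt (𝓡 k) (𝓡 k).tangent (fun y => (⟨y, X y⟩ : TangentBundle (𝓡 k) M)) x) :
    DifferentiableAt ℝ (chartField X x) (extChartAt (𝓡 k) x x) := by
  rw [← mdifferentiableWithinAt_univ] at hX
  have h := hX.differentiableWithinAt_mpullbackWithin_vectorField
  rw [preimage_univ, univ_inter, ModelWithCorners.range_eq_univ] at h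
  refine (differentiableWithinAt_univ.1 h).congr_of_eventuallyEq ?_
  filter_upwards [extChartAt_target_mem_nhds (I := 𝓡 k) x] with u hu
  have := mpullbackWithin_extChartAt_symm_eq X hu
  rw [ModelWithCorners.range_eq_univ] at this
  exact this.symm

theorem vderiv_extChartAt_mlieBracket (X Y : ∀ y : M, TangentSpace (𝓡 k) y) (x : M) :
    vderiv (extChartAt (𝓡 k) x) x (mlieBracket (𝓡 k) X Y x) =
      lieBracket ℝ (chartField X x) (chartField Y x) (extChartAt (𝓡 k) x x) := by
  have hinv := isInvertible_mfderiv_extChartAt (I := 𝓡 k) (mem_extChartAt_source (I := 𝓡 k) x)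
  rw [← mlieBracketWithin_univ, mlieBracketWithin_apply]
  refine (hinv.self_apply_inverse _).trans ?_
  rw [preimage_univ, univ_inter, ModelWithCorners.range_eq_univ]
  have hev : ∀ X : ∀ y : M, TangentSpace (𝓡 k) y,
      mpullbackWithin 𝓘(ℝ, EuclideanSpace ℝ (Fin k)) (𝓡 k) (extChartAt (𝓡 k) x).symm X
      univ =ᶠ[𝓝 (extChartAt (𝓡 k) x x)] chartField X x := by
    intro X
    filter_upwards [extChartAt_target_mem_nhds (I := 𝓡 k) x] with u hu
    have := mpullbackWithin_extChartAt_symm_eq X hu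
    rwa [ModelWithCorners.range_eq_univ] at this
  have hu : ∀ V W : EuclideanSpace ℝ (Fin k) → EuclideanSpace ℝ (Fin k),
      lieBracketWithin ℝ V W univ = lieBracket ℝ V W := fun V W => lieBracketWithin_univ
  have hl : ∀ {V V' W W' : EuclideanSpace ℝ (Fin k) → EuclideanSpace ℝ (Fin k)}
      {u : EuclideanSpace ℝ (Fin k)}, V =ᶠ[𝓝 u] V' → W =ᶠ[𝓝 u] W' →
      lieBracket ℝ V W u = lieBracket ℝ V' W' u := fun h h' => h.lieBracket_vectorField_eq h'
  exact (congrFun (hu _ _) _).trans (hl (hev X) (hev Y))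

/-- Differentiation along `[X, Y]` is the commutator of the differentiations along `X` and `Y`. -/
theorem vderiv_mlieBracket {h : M → F} {X Y : ∀ y : M, TangentSpace (𝓡 k) y} {x : M}
    (hh : ContMDiffAt (𝓡 k) 𝓘(ℝ, F) 2 h x)
    (hX : MDifferentiableAt (𝓡 k) (𝓡 k).tangent (fun y => (⟨y, X y⟩ : TangentBundle (𝓡 k) M)) x)
    (hY : MDifferentiableAt (𝓡 k) (𝓡 k).tangent (fun y => (⟨y, Y y⟩ : TangentBundle (𝓡 k) M)) x) :
    vderiv h x (mlieBracket (𝓡 k) X Y x) =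
      vderiv (fun y => vderiv h y (Y y)) x (X x) - vderiv (fun y => vderiv h y (X y)) x (Y x) := by
  have hx := mem_extChartAt_source (I := 𝓡 k) x
  set e := extChartAt (𝓡 k) x with he
  set H : EuclideanSpace ℝ (Fin k) → F := h ∘ e.symm with hH
  have hHd : ContDiffAt ℝ 2 H (e x) := by
    have h1 : ContMDiffAt 𝓘(ℝ, EuclideanSpace ℝ (Fin k)) (𝓡 k) 2 e.symm (e x) := by
      have := contMDiffWithinAt_extChartAt_symm_range_self (I := 𝓡 k) (n := 2) x
      rwa [ModelWithCorners.range_eq_univ, contMDiffWithinAt_univ] at this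
    rw [← contMDiffAt_iff_contDiffAt]
    refine ContMDiffAt.comp _ (I' := 𝓡 k) ?_ h1
    rwa [e.left_inv hx]
  have hev : ∀ᶠ y in 𝓝 x, MDifferentiableAt (𝓡 k) 𝓘(ℝ, F) h y := by
    filter_upwards [(contMDiffAt_iff_contMDiffAt_nhds (by simp)).1 hh] with y hy
    exact hy.mdifferentiableAt (by simp)
  have key : ∀ (X : ∀ y : M, TangentSpace (𝓡 k) y)
      (hX : MDifferentiableAt (𝓡 k) (𝓡 k).tangent
        (fun y => (⟨y, X y⟩ : TangentBundle (𝓡 k) M)) x) (v : TangentSpace (𝓡 k) x),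
      vderiv (fun y => vderiv h y (X y)) x v =
        fderiv ℝ (fun u => fderiv ℝ H u (chartField X x u)) (e x) (vderiv e x v) := by
    intro X hX v
    have hd : DifferentiableAt ℝ (fun u => fderiv ℝ H u (chartField X x u)) (e x) :=
      ((hHd.fderiv_right (m := 1) (by norm_num)).differentiableAt one_ne_zero).clm_apply
        (differentiableAt_chartField hX)
    have heq : (fun y => vderiv h y (X y)) =ᶠ[𝓝 x]
        (fun u => fderiv ℝ H u (chartField X x u)) ∘ e := by
      filter_upwards [hev, extChartAt_source_mem_nhds (I := 𝓡 k) x] with y hy hye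
      rw [vderiv_eq_fderiv hye hy, vderiv_extChartAt_apply X hye]
      rfl
    have h1 := mfderiv_comp x hd.mdifferentiableAt (mdifferentiableAt_extChartAt (I := 𝓡 k)
      (mem_chart_source _ x))
    rw [vderiv, heq.mfderiv_eq, h1, mfderiv_eq_fderiv]
    rfl
  rw [key X hX, key Y hY, vderiv_eq_fderiv hx hev.self_of_nhds, vderiv_extChartAt_mlieBracket,
    vderiv_extChartAt_apply X hx, vderiv_extChartAt_apply Y hx]
  exact fderiv_apply_lieBracket hHd (by simp) (differentiableAt_chartField hY)
    (differentiableAt_chartField hX)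

end VectorDerivative

section TangentMaps

open Filter Topology

variable {E₁ H₁ E₂ H₂ E₃ H₃ : Type*}
  [NormedAddCommGroup E₁] [NormedSpace ℝ E₁] [TopologicalSpace H₁]
  [NormedAddCommGroup E₂] [NormedSpace ℝ E₂] [TopologicalSpace H₂]
  [NormedAddCommGroup E₃] [NormedSpace ℝ E₃] [TopologicalSpace H₃]
  {I₁ : ModelWithCorners ℝ E₁ H₁} {I₂ : ModelWithCorners ℝ E₂ H₂} {I₃ : ModelWithCorners ℝ E₃ H₃}
  {N : Type*} [TopologicalSpace N] [ChartedSpace H₁ N]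
  {M : Type*} [TopologicalSpace M] [ChartedSpace H₂ M]
  {M' : Type*} [TopologicalSpace M'] [ChartedSpace H₃ M']

/-- If `f y : M → M'` depends smoothly on the parameter `y`, then its derivative, applied to
tangent vectors of `M` that depend smoothly on `y`, is smooth in `y`. -/
theorem contMDiffAt_mfderiv_apply [IsManifold I₁ ∞ N] [IsManifold I₂ ∞ M] [IsManifold I₃ ∞ M']
    {m n : WithTop ℕ∞} (_ : n ≤ ∞)
    (f : N → M → M') {g : N → M} {v : ∀ y : N, TangentSpace I₂ (g y)} {x : N}
    (hf : ContMDiffAt (I₁.prod I₂) I₃ n (Function.uncurry f) (x, g x))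
    (hv : ContMDiffAt I₁ I₂.tangent m (fun y => (⟨g y, v y⟩ : TangentBundle I₂ M)) x)
    (hmn : m + 1 ≤ n) :
    ContMDiffAt I₁ I₃.tangent m
      (fun y => (⟨f y (g y), mfderiv I₂ I₃ (f y) (g y) (v y)⟩ : TangentBundle I₃ M')) x := by
  have := IsManifold.of_le (I := I₁) (M := N) ‹n ≤ ∞›
  have := IsManifold.of_le (I := I₂) (M := M) ‹n ≤ ∞›
  have := IsManifold.of_le (I := I₃) (M := M') ‹n ≤ ∞›
  have : IsManifold I₂ 1 M := IsManifold.of_le (n := ∞) (by simp)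
  have : IsManifold I₃ 1 M' := IsManifold.of_le (n := ∞) (by simp)
  have hg : ContMDiffAt I₁ I₂ m g x := (Bundle.contMDiffAt_totalSpace.1 hv).1
  have hm : m ≤ n := le_trans le_self_add hmn
  refine ContMDiffAt.clm_apply_of_inCoordinates (b₁ := g) (b₂ := fun y => f y (g y))
    (ϕ := fun y => mfderiv I₂ I₃ (f y) (g y)) (v := v) (hf.mfderiv f g hg hmn) hv ?_
  exact ContMDiffAt.comp x (hf.of_le hm) (contMDiffAt_id.prodMk hg)

end TangentMaps

section VectorDerivative

open VectorField Set Filter Topology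

variable {k : ℕ} {M : Type*} [TopologicalSpace M] [ChartedSpace (EuclideanSpace ℝ (Fin k)) M]
  {F : Type*} [NormedAddCommGroup F] [NormedSpace ℝ F] [IsManifold (𝓡 k) ∞ M]

theorem contMDiffAt_vderiv_apply {m n : WithTop ℕ∞} (hn : n ≤ ∞) {h : M → F}
    {X : ∀ y : M, TangentSpace (𝓡 k) y} {x : M}
    (hh : ContMDiffAt (𝓡 k) 𝓘(ℝ, F) n h x)
    (hX : ContMDiffAt (𝓡 k) (𝓡 k).tangent m (fun y => (⟨y, X y⟩ : TangentBundle (𝓡 k) M)) x)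
    (hmn : m + 1 ≤ n) :
    ContMDiffAt (𝓡 k) 𝓘(ℝ, F) m (fun y => vderiv h y (X y)) x := by
  have h1 := contMDiffAt_mfderiv_apply (I₁ := 𝓡 k) (I₂ := 𝓡 k) (I₃ := 𝓘(ℝ, F)) hn
    (fun _ : M => h) (g := id) (v := X) (x := x) (hh.comp _ contMDiffAt_snd) hX hmn
  exact (contMDiff_snd_tangentBundle_modelSpace F 𝓘(ℝ, F)).contMDiffAt.comp x h1

end VectorDerivative

section Related

section

variable {k l : ℕ} {M : Type*} [TopologicalSpace M] [ChartedSpace (EuclideanSpace ℝ (Fin k)) M]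
  {N : Type*} [TopologicalSpace N] [ChartedSpace (EuclideanSpace ℝ (Fin l)) N]
  {F : Type*} [NormedAddCommGroup F] [NormedSpace ℝ F]

theorem vderiv_comp {h : N → F} {p : M → N} {x : M}
    (hh : MDifferentiableAt (𝓡 l) 𝓘(ℝ, F) h (p x)) (hp : MDifferentiableAt (𝓡 k) (𝓡 l) p x)
    (v : TangentSpace (𝓡 k) x) :
    vderiv (h ∘ p) x v = vderiv h (p x) (mfderiv (𝓡 k) (𝓡 l) p x v) := by
  rw [vderiv, mfderiv_comp x hh hp]
  rfl

theorem vderiv_congr {h h' : M → F} {x : M} (hh : h =ᶠ[nhds x] h') :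
    (vderiv h x : TangentSpace (𝓡 k) x →L[ℝ] F) = vderiv h' x := by
  rw [vderiv, vderiv, hh.mfderiv_eq]

end

open VectorField Set Filter Topology

variable {k l : ℕ} {M : Type*} [TopologicalSpace M] [ChartedSpace (EuclideanSpace ℝ (Fin k)) M]
  [IsManifold (𝓡 k) ∞ M]
  {N : Type*} [TopologicalSpace N] [ChartedSpace (EuclideanSpace ℝ (Fin l)) N]
  [IsManifold (𝓡 l) ∞ N]

/-- If `X` and `Y` are projected by `p` to `X'` and `Y'`, then `[X, Y]` is projected to
`[X', Y']`. -/
theorem mfderiv_mlieBracket_of_related {p : M → N} {x : M} {X Y : ∀ y : M, TangentSpace (𝓡 k) y}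
    {X' Y' : ∀ y : N, TangentSpace (𝓡 l) y} (hp : ContMDiffAt (𝓡 k) (𝓡 l) 2 p x)
    (hX : MDifferentiableAt (𝓡 k) (𝓡 k).tangent (fun y => (⟨y, X y⟩ : TangentBundle (𝓡 k) M)) x)
    (hY : MDifferentiableAt (𝓡 k) (𝓡 k).tangent (fun y => (⟨y, Y y⟩ : TangentBundle (𝓡 k) M)) x)
    (hX' : ContMDiffAt (𝓡 l) (𝓡 l).tangent 1
      (fun y => (⟨y, X' y⟩ : TangentBundle (𝓡 l) N)) (p x))
    (hY' : ContMDiffAt (𝓡 l) (𝓡 l).tangent 1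
      (fun y => (⟨y, Y' y⟩ : TangentBundle (𝓡 l) N)) (p x))
    (hXX' : ∀ᶠ y in 𝓝 x, mfderiv (𝓡 k) (𝓡 l) p y (X y) = X' (p y))
    (hYY' : ∀ᶠ y in 𝓝 x, mfderiv (𝓡 k) (𝓡 l) p y (Y y) = Y' (p y)) :
    mfderiv (𝓡 k) (𝓡 l) p x (mlieBracket (𝓡 k) X Y x) = mlieBracket (𝓡 l) X' Y' (p x) := by
  set e := extChartAt (𝓡 l) (p x) with he
  have hinj : Function.Injective (vderiv e (p x)) :=
    (isInvertible_mfderiv_extChartAt (I := 𝓡 l) (mem_extChartAt_source (I := 𝓡 l) (p x))).injective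
  have hed : ContMDiffAt (𝓡 l) 𝓘(ℝ, EuclideanSpace ℝ (Fin l)) 2 e (p x) := contMDiffAt_extChartAt
  have hed' := hed.mdifferentiableAt two_ne_zero
  have hpd : MDifferentiableAt (𝓡 k) (𝓡 l) p x := hp.mdifferentiableAt (by simp)
  have hev : ∀ᶠ y in 𝓝 x, MDifferentiableAt (𝓡 k) (𝓡 l) p y ∧
      MDifferentiableAt (𝓡 l) 𝓘(ℝ, EuclideanSpace ℝ (Fin l)) e (p y) := by
    filter_upwards [(contMDiffAt_iff_contMDiffAt_nhds (by simp)).1 hp,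
      hp.continuousAt.eventually ((contMDiffAt_iff_contMDiffAt_nhds (by simp)).1 hed)] with y h1 h2
    exact ⟨h1.mdifferentiableAt (by simp), h2.mdifferentiableAt (by simp)⟩
  have key : ∀ (Y : ∀ y : M, TangentSpace (𝓡 k) y) (Y' : ∀ y : N, TangentSpace (𝓡 l) y)
      (X : TangentSpace (𝓡 k) x), ContMDiffAt (𝓡 l) (𝓡 l).tangent 1
      (fun y => (⟨y, Y' y⟩ : TangentBundle (𝓡 l) N)) (p x) →
      (∀ᶠ y in 𝓝 x, mfderiv (𝓡 k) (𝓡 l) p y (Y y) = Y' (p y)) →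
      vderiv (fun y => vderiv (e ∘ p) y (Y y)) x X =
        vderiv (fun z => vderiv e z (Y' z)) (p x) (mfderiv (𝓡 k) (𝓡 l) p x X) := by
    intro Y Y' X hY' hYY'
    have heq : (fun y => vderiv (e ∘ p) y (Y y)) =ᶠ[𝓝 x]
        (fun z => vderiv e z (Y' z)) ∘ p := by
      filter_upwards [hev, hYY'] with y hy hy'
      rw [vderiv_comp hy.2 hy.1, hy']
      rfl
    have hd := (contMDiffAt_vderiv_apply (m := 1) (n := 2) ENat.LEInfty.out hed hY'
      (by norm_num)).mdifferentiableAt one_ne_zero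
    rw [vderiv_congr heq, vderiv_comp hd hpd]
  apply hinj
  rw [← vderiv_comp hed' hpd,
    vderiv_mlieBracket (hed.comp x hp) hX hY, key Y Y' _ hY' hYY', key X X' _ hX' hXX',
    hXX'.self_of_nhds, hYY'.self_of_nhds,
    vderiv_mlieBracket hed (hX'.mdifferentiableAt one_ne_zero) (hY'.mdifferentiableAt one_ne_zero)]

end Related

/-! ### Integral curves -/

section IntegralCurves

open Set Filter Topology

variable {E H M : Type*} [NormedAddCommGroup E] [NormedSpace ℝ E] [TopologicalSpace H]
  {I : ModelWithCorners ℝ E H} [TopologicalSpace M] [ChartedSpace H M]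
  {v : ∀ x : M, TangentSpace I x}

/-- Two integral curves that meet at the common endpoint of their domains can be concatenated. -/
theorem IsMIntegralCurveOn.concat {γ₁ γ₂ : ℝ → M} {s₁ s₂ : Set ℝ} {c : ℝ}
    (h₁ : IsMIntegralCurveOn γ₁ v s₁) (h₂ : IsMIntegralCurveOn γ₂ v s₂)
    (hs₁ : s₁ ⊆ Iic c) (hs₂ : s₂ ⊆ Ici c) (hc₁ : c ∈ s₁) (hc₂ : c ∈ s₂) (hc : γ₁ c = γ₂ c) :
    IsMIntegralCurveOn (fun t => if t ≤ c then γ₁ t else γ₂ t) v (s₁ ∪ s₂) := by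
  set γ : ℝ → M := fun t => if t ≤ c then γ₁ t else γ₂ t with hγ
  have e₁ : EqOn γ γ₁ s₁ := fun t ht => if_pos (hs₁ ht)
  have e₂ : EqOn γ γ₂ s₂ := by
    intro t ht
    rcases (show c ≤ t from hs₂ ht).eq_or_lt with h | h
    · rw [← h]; exact (if_pos le_rfl).trans hc
    · exact if_neg (not_le.2 h)
  have d₁ : ∀ t ∈ s₁, HasMFDerivWithinAt 𝓘(ℝ, ℝ) I γ s₁ t
      ((1 : ℝ →L[ℝ] ℝ).smulRight (v (γ t))) := by
    intro t ht
    have h := (h₁ t ht).congr_of_eventuallyEq (f₁ := γ)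
      (eventually_of_mem self_mem_nhdsWithin e₁) (e₁ ht)
    rwa [← e₁ ht] at h
  have d₂ : ∀ t ∈ s₂, HasMFDerivWithinAt 𝓘(ℝ, ℝ) I γ s₂ t
      ((1 : ℝ →L[ℝ] ℝ).smulRight (v (γ t))) := by
    intro t ht
    have h := (h₂ t ht).congr_of_eventuallyEq (f₁ := γ)
      (eventually_of_mem self_mem_nhdsWithin e₂) (e₂ ht)
    rwa [← e₂ ht] at h
  intro t ht
  rcases lt_trichotomy t c with h | h | h
  · have ht₁ : t ∈ s₁ := ht.resolve_right fun h' => absurd (hs₂ h') (not_le.2 h)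
    refine (d₁ t ht₁).mono_of_mem_nhdsWithin ?_
    filter_upwards [self_mem_nhdsWithin, nhdsWithin_le_nhds (Iio_mem_nhds h)] with u hu hu'
    exact hu.resolve_right fun h' => absurd (show c ≤ u from hs₂ h') (not_le.2 hu')
  · subst h
    exact (d₁ t hc₁).union (d₂ t hc₂)
  · have ht₂ : t ∈ s₂ := ht.resolve_left fun h' => absurd (hs₁ h') (not_le.2 h)
    refine (d₂ t ht₂).mono_of_mem_nhdsWithin ?_
    filter_upwards [self_mem_nhdsWithin, nhdsWithin_le_nhds (Ioi_mem_nhds h)] with u hu hu'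
    exact hu.resolve_left fun h' => absurd (show u ≤ c from hs₁ h') (not_le.2 hu')

variable [IsManifold I 1 M] [CompleteSpace E] [BoundarylessManifold I M]

/-- An integral curve on a closed interval extends to an open interval. -/
theorem IsMIntegralCurveOn.exists_extend_Ioo
    (hv : ContMDiff I I.tangent 1 (fun x => (⟨x, v x⟩ : TangentBundle I M)))
    {γ : ℝ → M} {a b : ℝ} (hab : a ≤ b) (h : IsMIntegralCurveOn γ v (Icc a b)) :
    ∃ (γ' : ℝ → M) (a' b' : ℝ), a' < a ∧ b < b' ∧ IsMIntegralCurveOn γ' v (Ioo a' b') ∧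
      γ' a = γ a ∧ γ' b = γ b := by
  obtain ⟨β, hβ, hβ'⟩ := exists_isMIntegralCurveAt_of_contMDiffAt_boundaryless b
    (hv.contMDiffAt (x := γ b))
  obtain ⟨ε, hε, hβ'⟩ := isMIntegralCurveAt_iff'.1 hβ'
  obtain ⟨α, hα, hα'⟩ := exists_isMIntegralCurveAt_of_contMDiffAt_boundaryless a
    (hv.contMDiffAt (x := γ a))
  obtain ⟨δ, hδ, hα'⟩ := isMIntegralCurveAt_iff'.1 hα'
  rw [Real.ball_eq_Ioo] at hα' hβ'
  have h₁ := h.concat (hβ'.mono (s' := Ico b (b + ε)) fun t ht => ⟨by linarith [ht.1], ht.2⟩)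
    (fun t ht => ht.2) (fun t ht => ht.1) (right_mem_Icc.2 hab) ⟨le_rfl, by linarith⟩ hβ.symm
  have h₂ := (hα'.mono (s' := Ioc (a - δ) a) fun t ht => ⟨ht.1, by linarith [ht.2]⟩).concat h₁
    (fun t ht => ht.2) (fun t ht => ht.elim (fun h => h.1) fun h => hab.trans h.1)
    ⟨by linarith, le_rfl⟩ (Or.inl (left_mem_Icc.2 hab)) (by simp [hα, hab])
  refine ⟨_, a - δ, b + ε, by linarith, by linarith, h₂.mono ?_, ?_, ?_⟩
  · intro t ht
    rcases le_total t a with h | h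
    · exact Or.inl ⟨ht.1, h⟩
    · rcases le_or_gt t b with h' | h'
      · exact Or.inr (Or.inl ⟨h, h'⟩)
      · exact Or.inr (Or.inr ⟨h'.le, ht.2⟩)
  · simp [hα]
  · by_cases hba : b ≤ a
    · obtain rfl := le_antisymm hab hba
      simp [hα]
    · simp [hba]

end IntegralCurves

/-! ### Leaves of the Reeb foliation -/

section Leaves

open Set Filter Topology

variable {n : ℕ} {S : Type*} [TopologicalSpace S]
  [ChartedSpace (EuclideanSpace ℝ (Fin (2 * n + 1))) S] [IsManifold (𝓡 (2 * n + 1)) ∞ S]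
  {σ : SasakianStructure n S}

namespace SasakianStructure

theorem contMDiff_ξ (σ : SasakianStructure n S) : ContMDiff (𝓡 (2 * n + 1))
    (𝓡 (2 * n + 1)).tangent ∞
    (fun x => (⟨x, σ.ξ x⟩ : TangentBundle (𝓡 (2 * n + 1)) S)) := fun x => σ.ξ_smooth x

theorem SameLeaf.refl (σ : SasakianStructure n S) (x : S) : σ.SameLeaf x x := by
  obtain ⟨γ, h, h'⟩ := exists_isMIntegralCurveAt_of_contMDiffAt_boundaryless 0
    ((σ.contMDiff_ξ.of_le (m := 1) (by simp)).contMDiffAt (x := x))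
  obtain ⟨ε, hε, h'⟩ := isMIntegralCurveAt_iff'.1 h'
  exact ⟨γ, 0, 0, h'.mono (by simpa using hε), h, h⟩

theorem SameLeaf.symm {x y : S} (h : σ.SameLeaf x y) : σ.SameLeaf y x := by
  obtain ⟨γ, a, b, h, ha, hb⟩ := h
  exact ⟨γ, b, a, by rwa [uIcc_comm], hb, ha⟩

/-- Two points lie on the same leaf if and only if an integral curve on an open interval passes
through both of them. The uniqueness theorem applies to integral curves on open intervals. -/
theorem sameLeaf_iff_exists_Ioo {x y : S} : σ.SameLeaf x y ↔
    ∃ (γ : ℝ → S) (a b s t : ℝ), IsMIntegralCurveOn γ σ.ξ (Ioo a b) ∧ s ∈ Ioo a b ∧ t ∈ Ioo a b ∧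
      γ s = x ∧ γ t = y := by
  constructor
  · have key : ∀ (x y : S) (γ : ℝ → S) (a b : ℝ), a ≤ b → IsMIntegralCurveOn γ σ.ξ (Icc a b) →
        γ a = x → γ b = y → ∃ (γ : ℝ → S) (a b s t : ℝ), IsMIntegralCurveOn γ σ.ξ (Ioo a b) ∧
          s ∈ Ioo a b ∧ t ∈ Ioo a b ∧ γ s = x ∧ γ t = y := by
      intro x y γ a b hab h hx hy
      obtain ⟨γ', a', b', ha, hb, h', e₁, e₂⟩ :=
        h.exists_extend_Ioo (σ.contMDiff_ξ.of_le (by simp)) hab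
      exact ⟨γ', a', b', a, b, h', ⟨ha, by linarith⟩, ⟨by linarith, hb⟩, e₁.trans hx, e₂.trans hy⟩
    rintro ⟨γ, a, b, h, ha, hb⟩
    rcases le_total a b with hab | hab
    · rw [uIcc_of_le hab] at h
      exact key x y γ a b hab h ha hb
    · rw [uIcc_of_ge hab] at h
      obtain ⟨γ', a', b', s, t, h', hs, ht, e₁, e₂⟩ := key y x γ b a hab h hb ha
      exact ⟨γ', a', b', t, s, h', ht, hs, e₂, e₁⟩
  · rintro ⟨γ, a, b, s, t, h, hs, ht, e₁, e₂⟩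
    exact ⟨γ, s, t, h.mono (ordConnected_Ioo.uIcc_subset hs ht), e₁, e₂⟩

/-- The two integral curves, shifted so that they agree at the common point, agree on the overlap of
their domains by uniqueness, and so combine to an integral curve on the union. -/
theorem SameLeaf.trans [T2Space S] {x y z : S} (h : σ.SameLeaf x y) (h' : σ.SameLeaf y z) :
    σ.SameLeaf x z := by
  rw [sameLeaf_iff_exists_Ioo] at h h'
  obtain ⟨γ, a, b, s, t, h, hs, ht, e₁, e₂⟩ := h
  obtain ⟨γ', a', b', s', t', h', hs', ht', e₁', e₂'⟩ := h'
  set dt := s' - t with hdt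
  have hc : IsMIntegralCurveOn (γ' ∘ (· + dt)) σ.ξ (Ioo (a' - dt) (b' - dt)) :=
    (h'.comp_add dt).mono fun u hu => ⟨by linarith [hu.1], by linarith [hu.2]⟩
  have hmem : t ∈ Ioo a b ∩ Ioo (a' - dt) (b' - dt) :=
    ⟨ht, by rw [hdt]; linarith [hs'.1], by rw [hdt]; linarith [hs'.2]⟩
  have hmeet : γ t = (γ' ∘ (· + dt)) t := by simp [hdt, e₂, e₁']
  have hv := σ.contMDiff_ξ.of_le (m := 1) (by simp)
  have hg := isMIntegralCurveOn_piecewise hv h hc hmem hmeet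
  have heq := eqOn_piecewise_of_isMIntegralCurveOn_Ioo hv h hc hmem hmeet
  have hord : (Ioo a b ∪ Ioo (a' - dt) (b' - dt)).OrdConnected :=
    (isPreconnected_Ioo.union t hmem.1 hmem.2 isPreconnected_Ioo).ordConnected
  have ht'' : t' - dt ∈ Ioo (a' - dt) (b' - dt) := ⟨by linarith [ht'.1], by linarith [ht'.2]⟩
  refine ⟨_, s, t' - dt, hg.mono (hord.uIcc_subset (Or.inl hs) (Or.inr ht'')), ?_, ?_⟩
  · rw [piecewise_eq_of_mem _ _ _ hs, e₁]
  · rw [heq ht'']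
    simp [e₂']

end SasakianStructure

end Leaves

/-! ### Exterior derivatives of 1-forms -/

section Forms

open VectorField Filter Topology Set

section

variable {k : ℕ} {M : Type*} [TopologicalSpace M] [ChartedSpace (EuclideanSpace ℝ (Fin k)) M]

theorem fieldDeriv_sub {X : ∀ y : M, TangentSpace (𝓡 k) y} {h h' : M → ℝ} {x : M}
    (hh : MDifferentiableAt (𝓡 k) 𝓘(ℝ, ℝ) h x) (hh' : MDifferentiableAt (𝓡 k) 𝓘(ℝ, ℝ) h' x) :
    fieldDeriv X (fun y => h y - h' y) x = fieldDeriv X h x - fieldDeriv X h' x := by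
  have h := (hh.hasMFDerivAt.sub hh'.hasMFDerivAt).mfderiv
  exact congrArg (fun T : TangentSpace (𝓡 k) x →L[ℝ] ℝ => T (X x)) h

theorem fieldDeriv_add {X : ∀ y : M, TangentSpace (𝓡 k) y} {h h' : M → ℝ} {x : M}
    (hh : MDifferentiableAt (𝓡 k) 𝓘(ℝ, ℝ) h x) (hh' : MDifferentiableAt (𝓡 k) 𝓘(ℝ, ℝ) h' x) :
    fieldDeriv X (fun y => h y + h' y) x = fieldDeriv X h x + fieldDeriv X h' x := by
  have h := (hh.hasMFDerivAt.add hh'.hasMFDerivAt).mfderiv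
  exact congrArg (fun T : TangentSpace (𝓡 k) x →L[ℝ] ℝ => T (X x)) h

theorem fieldDeriv_mul {X : ∀ y : M, TangentSpace (𝓡 k) y} {h h' : M → ℝ} {x : M}
    (hh : MDifferentiableAt (𝓡 k) 𝓘(ℝ, ℝ) h x) (hh' : MDifferentiableAt (𝓡 k) 𝓘(ℝ, ℝ) h' x) :
    fieldDeriv X (fun y => h y * h' y) x = fieldDeriv X h x * h' x + h x * fieldDeriv X h' x := by
  have h₁ := (hh.hasMFDerivAt.mul hh'.hasMFDerivAt).mfderiv
  have h₂ : fieldDeriv X (fun y => h y * h' y) x =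
      h x * fieldDeriv X h' x + h' x * fieldDeriv X h x :=
    congrArg (fun T : TangentSpace (𝓡 k) x →L[ℝ] ℝ => T (X x)) h₁
  rw [h₂]
  ring

theorem fieldDeriv_congr {X : ∀ y : M, TangentSpace (𝓡 k) y} {h h' : M → ℝ} {x : M}
    (hh : h =ᶠ[nhds x] h') : fieldDeriv X h x = fieldDeriv X h' x := by
  rw [fieldDeriv, fieldDeriv, hh.mfderiv_eq]
  rfl

theorem extDerivOne_swap (η : ∀ y : M, TangentSpace (𝓡 k) y →L[ℝ] ℝ)
    (X Y : ∀ y : M, TangentSpace (𝓡 k) y) (x : M) :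
    extDerivOne η X Y x = -extDerivOne η Y X x := by
  rw [extDerivOne, extDerivOne, mlieBracket_swap_apply, map_neg]
  ring

end

variable {k : ℕ} {M : Type*} [TopologicalSpace M] [ChartedSpace (EuclideanSpace ℝ (Fin k)) M]
  [IsManifold (𝓡 k) ∞ M]

/-- The vector field `X` is of class `C^m` at `x`. -/
def FieldAt (m : WithTop ℕ∞) (X : ∀ y : M, TangentSpace (𝓡 k) y) (x : M) : Prop :=
  ContMDiffAt (𝓡 k) (𝓡 k).tangent m (fun y => (⟨y, X y⟩ : TangentBundle (𝓡 k) M)) x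

theorem SmoothFieldAt.fieldAt {X : ∀ y : M, TangentSpace (𝓡 k) y} {x : M}
    (h : SmoothFieldAt X x) (m : WithTop ℕ∞) [ENat.LEInfty m] : FieldAt m X x :=
  ContMDiffAt.of_le h ENat.LEInfty.out

theorem FieldAt.mdifferentiableAt {X : ∀ y : M, TangentSpace (𝓡 k) y} {x : M}
    (h : FieldAt 1 X x) :
    MDifferentiableAt (𝓡 k) (𝓡 k).tangent (fun y => (⟨y, X y⟩ : TangentBundle (𝓡 k) M)) x :=
  ContMDiffAt.mdifferentiableAt h one_ne_zero

theorem FieldAt.of_le {X : ∀ y : M, TangentSpace (𝓡 k) y} {x : M} {m l : WithTop ℕ∞}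
    (h : FieldAt m X x) (hl : l ≤ m) : FieldAt l X x :=
  ContMDiffAt.of_le h hl

theorem FieldAt.eventually {X : ∀ y : M, TangentSpace (𝓡 k) y} {x : M} {m : ℕ}
    (h : FieldAt m X x) : ∀ᶠ y in 𝓝 x, FieldAt m X y := by
  have : IsManifold (𝓡 k) ((m : WithTop ℕ∞) + 1) M :=
    IsManifold.of_le (n := ∞) (mod_cast le_top)
  have : IsManifold (𝓡 k) m M := IsManifold.of_le (n := ∞) (mod_cast le_top)
  exact (contMDiffAt_iff_contMDiffAt_nhds (I := 𝓡 k) (I' := (𝓡 k).tangent)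
    (mod_cast WithTop.natCast_ne_top m)).1 h

theorem isManifold_minSmoothness (m : ℕ) : IsManifold (𝓡 k) (minSmoothness ℝ m) M := by
  rw [minSmoothness_of_isRCLikeNormedField]
  exact IsManifold.of_le (n := ∞) (mod_cast le_top)

theorem FieldAt.mlieBracket {X Y : ∀ y : M, TangentSpace (𝓡 k) y} {x : M}
    (hX : FieldAt 2 X x) (hY : FieldAt 2 Y x) : FieldAt 1 (mlieBracket (𝓡 k) X Y) x := by
  have : IsManifold (𝓡 k) (((2 : ℕ∞) : WithTop ℕ∞) + 1) M :=
    IsManifold.of_le (n := ∞) (mod_cast le_top)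
  have : IsManifold (𝓡 k) (minSmoothness ℝ 2) M := isManifold_minSmoothness 2
  exact ContMDiffAt.mlieBracket_vectorField (m := 1) (n := 2) hX hY (by norm_num)

/-- The values of a 1-form on a vector field. -/
theorem contMDiffAt_form_apply {m : WithTop ℕ∞} {η : ∀ y : M, TangentSpace (𝓡 k) y →L[ℝ] ℝ}
    {X : ∀ y : M, TangentSpace (𝓡 k) y} {x : M}
    (hη : ContMDiffAt (𝓡 k) ((𝓡 k).prod 𝓘(ℝ, EuclideanSpace ℝ (Fin k) →L[ℝ] ℝ)) m
      (fun x : M => Bundle.TotalSpace.mk' (EuclideanSpace ℝ (Fin k) →L[ℝ] ℝ)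
        (E := fun x : M => TangentSpace (𝓡 k) x →L[ℝ] Bundle.Trivial M ℝ x) x (η x)) x)
    (hX : FieldAt m X x) : ContMDiffAt (𝓡 k) 𝓘(ℝ, ℝ) m (fun y => η y (X y)) x := by
  have h := ContMDiffAt.clm_bundle_apply (E₁ := fun x : M => TangentSpace (𝓡 k) x)
    (E₂ := Bundle.Trivial M ℝ) (b := fun x : M => x) (ϕ := η) hη (v := X) hX
  exact (Bundle.contMDiffAt_totalSpace.1 h).2

theorem contMDiffAt_endo_apply {m : WithTop ℕ∞}
    {A : ∀ y : M, TangentSpace (𝓡 k) y →L[ℝ] TangentSpace (𝓡 k) y}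
    {X : ∀ y : M, TangentSpace (𝓡 k) y} {x : M}
    (hA : ContMDiffAt (𝓡 k) ((𝓡 k).prod 𝓘(ℝ, EuclideanSpace ℝ (Fin k) →L[ℝ]
        EuclideanSpace ℝ (Fin k))) m
      (fun x : M => Bundle.TotalSpace.mk'
        (EuclideanSpace ℝ (Fin k) →L[ℝ] EuclideanSpace ℝ (Fin k))
        (E := fun x : M => TangentSpace (𝓡 k) x →L[ℝ] TangentSpace (𝓡 k) x) x (A x)) x)
    (hX : FieldAt m X x) : FieldAt m (fun y => A y (X y)) x :=
  ContMDiffAt.clm_bundle_apply (E₁ := fun x : M => TangentSpace (𝓡 k) x)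
    (E₂ := fun x : M => TangentSpace (𝓡 k) x) (b := fun x : M => x) (ϕ := A) hA (v := X) hX

theorem mdifferentiableAt_form_apply {η : ∀ y : M, TangentSpace (𝓡 k) y →L[ℝ] ℝ}
    {X : ∀ y : M, TangentSpace (𝓡 k) y} {x : M}
    (hη : ContMDiffAt (𝓡 k) ((𝓡 k).prod 𝓘(ℝ, EuclideanSpace ℝ (Fin k) →L[ℝ] ℝ)) 1
      (fun x : M => Bundle.TotalSpace.mk' (EuclideanSpace ℝ (Fin k) →L[ℝ] ℝ)
        (E := fun x : M => TangentSpace (𝓡 k) x →L[ℝ] Bundle.Trivial M ℝ x) x (η x)) x)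
    (hX : MDifferentiableAt (𝓡 k) (𝓡 k).tangent
      (fun y => (⟨y, X y⟩ : TangentBundle (𝓡 k) M)) x) :
    MDifferentiableAt (𝓡 k) 𝓘(ℝ, ℝ) (fun y => η y (X y)) x := by
  have h := MDifferentiableAt.clm_bundle_apply (E₁ := fun x : M => TangentSpace (𝓡 k) x)
    (E₂ := Bundle.Trivial M ℝ) (b := fun x : M => x) (ϕ := η)
    (hη.mdifferentiableAt one_ne_zero) (v := X) hX
  exact ((mdifferentiableAt_totalSpace _ _).1 h).2

/-- `dη(X, Y)` is linear over functions in `X`, so that it depends on `X` only through its value at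
`x`. -/
theorem tensorialAt_extDerivOne {η : ∀ y : M, TangentSpace (𝓡 k) y →L[ℝ] ℝ}
    {Y : ∀ y : M, TangentSpace (𝓡 k) y} {x : M}
    (hη : ContMDiffAt (𝓡 k) ((𝓡 k).prod 𝓘(ℝ, EuclideanSpace ℝ (Fin k) →L[ℝ] ℝ)) 1
      (fun x : M => Bundle.TotalSpace.mk' (EuclideanSpace ℝ (Fin k) →L[ℝ] ℝ)
        (E := fun x : M => TangentSpace (𝓡 k) x →L[ℝ] Bundle.Trivial M ℝ x) x (η x)) x) :
    TensorialAt (𝓡 k) (EuclideanSpace ℝ (Fin k)) (V := fun x : M => TangentSpace (𝓡 k) x)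
      (fun X => extDerivOne η X Y x) x where
  smul := by
    intro f X hf hX
    have : IsManifold (𝓡 k) (minSmoothness ℝ 2) M := isManifold_minSmoothness 2
    have h₁ : fieldDeriv Y (fun y => η y ((f • X) y)) x =
        fieldDeriv Y f x * η x (X x) + f x * fieldDeriv Y (fun y => η y (X y)) x := by
      rw [← fieldDeriv_mul hf (mdifferentiableAt_form_apply hη hX)]
      congr 1
      ext y
      exact (η y).map_smul (f y) (X y)
    have h₂ : η x (mlieBracket (𝓡 k) (f • X) Y x) =
        -(fieldDeriv Y f x * η x (X x)) + f x * η x (mlieBracket (𝓡 k) X Y x) := by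
      rw [mlieBracket_smul_left hf hX, map_add, map_smul, map_smul]
      simp only [smul_eq_mul]
      rw [neg_mul]
      rfl
    have h₃ : fieldDeriv (f • X) (fun y => η y (Y y)) x =
        f x * fieldDeriv X (fun y => η y (Y y)) x :=
      (mfderiv (𝓡 k) 𝓘(ℝ, ℝ) (fun y => η y (Y y)) x).map_smul (f x) (X x)
    simp only [extDerivOne]
    rw [h₁, h₂, h₃, smul_eq_mul]
    ring
  add := by
    intro X X' hX hX'
    have : IsManifold (𝓡 k) (minSmoothness ℝ 2) M := isManifold_minSmoothness 2
    have h₁ : fieldDeriv Y (fun y => η y ((X + X') y)) x =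
        fieldDeriv Y (fun y => η y (X y)) x + fieldDeriv Y (fun y => η y (X' y)) x := by
      rw [← fieldDeriv_add (mdifferentiableAt_form_apply hη hX)
        (mdifferentiableAt_form_apply hη hX')]
      congr 1
      ext y
      exact (η y).map_add (X y) (X' y)
    have h₂ : η x (mlieBracket (𝓡 k) (X + X') Y x) =
        η x (mlieBracket (𝓡 k) X Y x) + η x (mlieBracket (𝓡 k) X' Y x) := by
      rw [mlieBracket_add_left hX hX', map_add]
    have h₃ : fieldDeriv (X + X') (fun y => η y (Y y)) x =
        fieldDeriv X (fun y => η y (Y y)) x + fieldDeriv X' (fun y => η y (Y y)) x :=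
      (mfderiv (𝓡 k) 𝓘(ℝ, ℝ) (fun y => η y (Y y)) x).map_add (X x) (X' x)
    simp only [extDerivOne]
    rw [h₁, h₂, h₃]
    ring

/-- The value of `dη(X, Y)` at `x` depends only on the values of `X` and `Y` at `x`. -/
theorem extDerivOne_eq_of_eq {η : ∀ y : M, TangentSpace (𝓡 k) y →L[ℝ] ℝ}
    {X X' Y Y' : ∀ y : M, TangentSpace (𝓡 k) y} {x : M}
    (hη : ContMDiffAt (𝓡 k) ((𝓡 k).prod 𝓘(ℝ, EuclideanSpace ℝ (Fin k) →L[ℝ] ℝ)) 1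
      (fun x : M => Bundle.TotalSpace.mk' (EuclideanSpace ℝ (Fin k) →L[ℝ] ℝ)
        (E := fun x : M => TangentSpace (𝓡 k) x →L[ℝ] Bundle.Trivial M ℝ x) x (η x)) x)
    (hX : FieldAt 1 X x) (hX' : FieldAt 1 X' x) (hY : FieldAt 1 Y x) (hY' : FieldAt 1 Y' x)
    (hXX' : X x = X' x) (hYY' : Y x = Y' x) :
    extDerivOne η X Y x = extDerivOne η X' Y' x := by
  have h₁ := (tensorialAt_extDerivOne (Y := Y) hη).pointwise hX.mdifferentiableAt
    hX'.mdifferentiableAt hXX'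
  have h₂ := (tensorialAt_extDerivOne (Y := X') hη).pointwise hY.mdifferentiableAt
    hY'.mdifferentiableAt hYY'
  rw [h₁, extDerivOne_swap, h₂, ← extDerivOne_swap]

/-- `d(dη) = 0`, expressed through the values of `dη` on vector fields. -/
theorem extDerivOne_closed {η : ∀ y : M, TangentSpace (𝓡 k) y →L[ℝ] ℝ}
    {X Y Z : ∀ y : M, TangentSpace (𝓡 k) y} {x : M}
    (hη : ContMDiffAt (𝓡 k) ((𝓡 k).prod 𝓘(ℝ, EuclideanSpace ℝ (Fin k) →L[ℝ] ℝ)) 2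
      (fun x : M => Bundle.TotalSpace.mk' (EuclideanSpace ℝ (Fin k) →L[ℝ] ℝ)
        (E := fun x : M => TangentSpace (𝓡 k) x →L[ℝ] Bundle.Trivial M ℝ x) x (η x)) x)
    (hX : FieldAt 2 X x) (hY : FieldAt 2 Y x) (hZ : FieldAt 2 Z x) :
    fieldDeriv X (extDerivOne η Y Z) x + fieldDeriv Y (extDerivOne η Z X) x
      + fieldDeriv Z (extDerivOne η X Y) x
      - extDerivOne η (mlieBracket (𝓡 k) X Y) Z x - extDerivOne η (mlieBracket (𝓡 k) Y Z) X x
      - extDerivOne η (mlieBracket (𝓡 k) Z X) Y x = 0 := by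
  have hle : (1 : WithTop ℕ∞) ≤ 2 := by norm_num
  have hη' := hη.of_le hle
  -- the derivatives of the functions `η(X)` are differentiable
  have hd : ∀ {X Y : ∀ y : M, TangentSpace (𝓡 k) y}, FieldAt 2 X x → FieldAt 2 Y x →
      MDifferentiableAt (𝓡 k) 𝓘(ℝ, ℝ) (fieldDeriv X (fun y => η y (Y y))) x := fun hX hY =>
    (contMDiffAt_vderiv_apply (n := 2) (m := 1) ENat.LEInfty.out (contMDiffAt_form_apply hη hY)
      (hX.of_le hle) (by norm_num)).mdifferentiableAt one_ne_zero
  have hb : ∀ {X Y : ∀ y : M, TangentSpace (𝓡 k) y}, FieldAt 2 X x → FieldAt 2 Y x →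
      MDifferentiableAt (𝓡 k) 𝓘(ℝ, ℝ) (fun y => η y (mlieBracket (𝓡 k) X Y y)) x := fun hX hY =>
    mdifferentiableAt_form_apply hη' (hX.mlieBracket hY).mdifferentiableAt
  have expand : ∀ {X Y : ∀ y : M, TangentSpace (𝓡 k) y} (Z : ∀ y : M, TangentSpace (𝓡 k) y),
      FieldAt 2 X x → FieldAt 2 Y x →
      fieldDeriv Z (extDerivOne η X Y) x = fieldDeriv Z (fieldDeriv X (fun y => η y (Y y))) x
        - fieldDeriv Z (fieldDeriv Y (fun y => η y (X y))) x
        - fieldDeriv Z (fun y => η y (mlieBracket (𝓡 k) X Y y)) x := by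
    intro X Y Z hX hY
    exact (fieldDeriv_sub ((hd hX hY).sub (hd hY hX)) (hb hX hY)).trans
      (congrArg (fun r => r - _) (fieldDeriv_sub (hd hX hY) (hd hY hX)))
  have comm : ∀ {X Y Z : ∀ y : M, TangentSpace (𝓡 k) y}, FieldAt 2 X x → FieldAt 2 Y x →
      FieldAt 2 Z x → fieldDeriv (mlieBracket (𝓡 k) X Y) (fun y => η y (Z y)) x =
        fieldDeriv X (fieldDeriv Y (fun y => η y (Z y))) x -
        fieldDeriv Y (fieldDeriv X (fun y => η y (Z y))) x := fun hX hY hZ =>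
    vderiv_mlieBracket (contMDiffAt_form_apply hη hZ) (hX.of_le hle).mdifferentiableAt
      (hY.of_le hle).mdifferentiableAt
  have jacobi : η x (mlieBracket (𝓡 k) (mlieBracket (𝓡 k) X Y) Z x)
      + η x (mlieBracket (𝓡 k) (mlieBracket (𝓡 k) Y Z) X x)
      + η x (mlieBracket (𝓡 k) (mlieBracket (𝓡 k) Z X) Y x) = 0 := by
    have : IsManifold (𝓡 k) (minSmoothness ℝ 3) M := isManifold_minSmoothness 3
    have h2 : minSmoothness ℝ 2 = 2 := minSmoothness_of_isRCLikeNormedField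
    have hJ := leibniz_identity_mlieBracket_apply (I := 𝓡 k) (U := X) (V := Y) (W := Z) (x := x)
      (by rw [h2]; exact hX) (by rw [h2]; exact hY) (by rw [h2]; exact hZ)
    have h3 : mlieBracket (𝓡 k) Y (mlieBracket (𝓡 k) X Z) x =
        mlieBracket (𝓡 k) (mlieBracket (𝓡 k) Z X) Y x := by
      rw [mlieBracket_swap_apply, mlieBracket_swap (V := X) (W := Z)]
      have := mlieBracket_const_smul_left (I := 𝓡 k) (c := (-1 : ℝ)) (W := Y)
        (hZ.mlieBracket hX).mdifferentiableAt
      rw [neg_one_smul, neg_one_smul] at this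
      rw [this, neg_neg]
    rw [h3, mlieBracket_swap_apply (V := X)] at hJ
    rw [← map_add, ← map_add]
    have : mlieBracket (𝓡 k) (mlieBracket (𝓡 k) X Y) Z x
      + mlieBracket (𝓡 k) (mlieBracket (𝓡 k) Y Z) X x
      + mlieBracket (𝓡 k) (mlieBracket (𝓡 k) Z X) Y x = 0 := by
      rw [add_right_comm, ← hJ]
      exact neg_add_cancel _
    rw [this, map_zero]
  rw [expand X hY hZ, expand Y hZ hX, expand Z hX hY]
  simp only [extDerivOne]
  rw [comm hX hY hZ, comm hY hZ hX, comm hZ hX hY]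
  linear_combination jacobi

end Forms

/-! ### The Reeb field preserves the transverse structure -/

section Transverse

open VectorField Filter Topology Set

namespace SasakianStructure

variable {n : ℕ} {S : Type*} [TopologicalSpace S]
  [ChartedSpace (EuclideanSpace ℝ (Fin (2 * n + 1))) S] [IsManifold (𝓡 (2 * n + 1)) ∞ S]
  (σ : SasakianStructure n S)

theorem ξ_ne_zero (x : S) : σ.ξ x ≠ 0 := fun h => by
  have := σ.η_ξ x
  rw [h, map_zero] at this
  exact zero_ne_one this

/-- `φ ξ` is a multiple of `ξ`, since `φ² ξ = 0`; the factor vanishes for the same reason. -/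
theorem φ_ξ (x : S) : σ.φ x (σ.ξ x) = 0 := by
  have h₁ : σ.φ x (σ.φ x (σ.ξ x)) = 0 := by
    rw [σ.φ_sq, σ.η_ξ, one_smul, neg_add_cancel]
  have h₂ : σ.φ x (σ.ξ x) = σ.η x (σ.φ x (σ.ξ x)) • σ.ξ x := by
    have := σ.φ_sq x (σ.φ x (σ.ξ x))
    rw [h₁, map_zero] at this
    exact (neg_add_eq_zero.1 this.symm)
  have h₃ : σ.η x (σ.φ x (σ.ξ x)) • σ.φ x (σ.ξ x) = 0 := by
    rw [← map_smul, ← h₂, h₁]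
  rcases smul_eq_zero.1 h₃ with h | h
  · rw [h, zero_smul] at h₂
    exact h₂
  · exact h

theorem η_φ (x : S) (v : TangentSpace (𝓡 (2 * n + 1)) x) : σ.η x (σ.φ x v) = 0 := by
  have h := congrArg (σ.φ x) (σ.φ_sq x v)
  rw [σ.φ_sq, map_add, map_smul, σ.φ_ξ, smul_zero, add_zero, map_neg] at h
  have h' : σ.η x (σ.φ x v) • σ.ξ x = 0 := by
    simpa using h
  exact (smul_eq_zero.1 h').resolve_right (σ.ξ_ne_zero x)

/-- `η` is the metric dual of `ξ`. -/
theorem g_ξ (x : S) (v : TangentSpace (𝓡 (2 * n + 1)) x) : σ.g.inner x v (σ.ξ x) = σ.η x v := by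
  have h := σ.g_φ x v (σ.ξ x)
  rw [σ.φ_ξ, map_zero, σ.η_ξ, mul_one] at h
  linarith

theorem eq_smul_ξ_of_φ_eq_zero {x : S} {v : TangentSpace (𝓡 (2 * n + 1)) x} (h : σ.φ x v = 0) :
    v = σ.η x v • σ.ξ x := by
  have h' := σ.φ_sq x v
  rw [h, map_zero] at h'
  exact neg_add_eq_zero.1 h'.symm

theorem φ_eq_of_sub_eq_smul {x : S} {v w : TangentSpace (𝓡 (2 * n + 1)) x} {c : ℝ}
    (h : v - w = c • σ.ξ x) : σ.φ x v = σ.φ x w := by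
  rw [← sub_eq_zero, ← map_sub, h, map_smul, σ.φ_ξ, smul_zero]

/-- The identity `dη(X, Y) = 2 g(X, φ Y)` for vector fields that are only of class `C^1`. -/
theorem extDerivOne_η_eq {x : S} {X Y : ∀ y : S, TangentSpace (𝓡 (2 * n + 1)) y}
    (hX : FieldAt 1 X x) (hY : FieldAt 1 Y x) :
    extDerivOne σ.η X Y x = 2 * σ.g.inner x (X x) (σ.φ x (Y x)) := by
  have hs : ∀ v : TangentSpace (𝓡 (2 * n + 1)) x,
      SmoothFieldAt (FiberBundle.extend (EuclideanSpace ℝ (Fin (2 * n + 1))) v) x :=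
    fun v => FiberBundle.contMDiffAt_extend (k := ∞) (𝓡 (2 * n + 1)) _ v
  rw [extDerivOne_eq_of_eq ((σ.η_smooth x).of_le ENat.LEInfty.out) hX ((hs (X x)).fieldAt 1) hY
    ((hs (Y x)).fieldAt 1) (by simp) (by simp), σ.dη_eq x _ _ (hs _) (hs _)]
  simp

/-- The 2-form `(X, Y) ↦ 2 g(X, φ Y)` is closed, being equal to `dη`. -/
theorem extDerivTwo_eq_zero {x : S} {X Y Z : ∀ y : S, TangentSpace (𝓡 (2 * n + 1)) y}
    (hX : FieldAt 2 X x) (hY : FieldAt 2 Y x) (hZ : FieldAt 2 Z x) :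
    extDerivTwo (fun y v w => 2 * σ.g.inner y v (σ.φ y w)) X Y Z x = 0 := by
  have hle : (1 : WithTop ℕ∞) ≤ 2 := by norm_num
  have hev : ∀ {X Y : ∀ y : S, TangentSpace (𝓡 (2 * n + 1)) y}, FieldAt 2 X x → FieldAt 2 Y x →
      (fun y => 2 * σ.g.inner y (X y) (σ.φ y (Y y))) =ᶠ[𝓝 x] extDerivOne σ.η X Y := by
    intro X Y hX hY
    filter_upwards [FieldAt.eventually (m := 1) (hX.of_le hle),
      FieldAt.eventually (m := 1) (hY.of_le hle)] with y h₁ h₂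
    exact (σ.extDerivOne_η_eq h₁ h₂).symm
  have h := extDerivOne_closed ((σ.η_smooth x).of_le ENat.LEInfty.out) hX hY hZ
  rw [σ.extDerivOne_η_eq (hX.mlieBracket hY) (hZ.of_le hle),
    σ.extDerivOne_η_eq (hY.mlieBracket hZ) (hX.of_le hle),
    σ.extDerivOne_η_eq (hZ.mlieBracket hX) (hY.of_le hle)] at h
  rw [extDerivTwo, fieldDeriv_congr (hev hY hZ), fieldDeriv_congr (hev hZ hX),
    fieldDeriv_congr (hev hX hY)]
  exact h

/-- The Reeb field preserves `dη`, since `dη` is closed and annihilated by the Reeb field. -/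
theorem fieldDeriv_ξ_eq_zero {x : S} {X Y : ∀ y : S, TangentSpace (𝓡 (2 * n + 1)) y}
    (hX : FieldAt 2 X x) (hY : FieldAt 2 Y x) {a b : ℝ}
    (hXξ : mlieBracket (𝓡 (2 * n + 1)) σ.ξ X x = a • σ.ξ x)
    (hYξ : mlieBracket (𝓡 (2 * n + 1)) σ.ξ Y x = b • σ.ξ x) :
    fieldDeriv σ.ξ (fun y => 2 * σ.g.inner y (X y) (σ.φ y (Y y))) x = 0 := by
  have h := σ.extDerivTwo_eq_zero ((σ.ξ_smooth x).fieldAt 2) hX hY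
  have h₁ : (fun y => 2 * σ.g.inner y (Y y) (σ.φ y (σ.ξ y))) = fun _ => (0 : ℝ) := by
    ext y
    rw [σ.φ_ξ, map_zero, mul_zero]
  have h₂ : ∀ X : ∀ y : S, TangentSpace (𝓡 (2 * n + 1)) y,
      (fun y => 2 * σ.g.inner y (σ.ξ y) (σ.φ y (X y))) = fun _ => (0 : ℝ) := by
    intro X
    ext y
    rw [σ.g.symm, σ.g_ξ, σ.η_φ, mul_zero]
  have h₃ : ∀ X : ∀ y : S, TangentSpace (𝓡 (2 * n + 1)) y,
      fieldDeriv X (fun _ => (0 : ℝ)) x = 0 := by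
    intro X
    rw [fieldDeriv, mfderiv_const]
    rfl
  have h₄ : ∀ (c : ℝ) (v : TangentSpace (𝓡 (2 * n + 1)) x),
      σ.g.inner x (c • σ.ξ x) (σ.φ x v) = 0 := by
    intro c v
    rw [σ.g.symm, map_smul, σ.g_ξ, σ.η_φ, smul_zero]
  rw [extDerivTwo, h₁, h₂, h₃, h₃, hXξ, mlieBracket_swap_apply (V := Y), hYξ, σ.φ_ξ, map_zero, h₄,
    ← neg_smul, h₄] at h
  simpa using h

/-- The Reeb field preserves `φ`: this is the normality condition, applied to the pair `(ξ, X)`. -/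
theorem mlieBracket_ξ_φ {x : S} {X : ∀ y : S, TangentSpace (𝓡 (2 * n + 1)) y}
    (hX : SmoothFieldAt X x) {a : ℝ} (hXξ : mlieBracket (𝓡 (2 * n + 1)) σ.ξ X x = a • σ.ξ x) :
    ∃ b : ℝ, mlieBracket (𝓡 (2 * n + 1)) σ.ξ (fun y => σ.φ y (X y)) x = b • σ.ξ x := by
  have h := σ.normal x σ.ξ X (σ.ξ_smooth x) hX
  have h₀ : (fun y => σ.φ y (σ.ξ y)) = (0 : ∀ y : S, TangentSpace (𝓡 (2 * n + 1)) y) := by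
    ext1 y
    exact σ.φ_ξ y
  rw [σ.dη_ξ x X hX, zero_smul, neg_zero, nijenhuis, h₀, mlieBracket_zero_left, hXξ, map_smul,
    σ.φ_ξ, mlieBracket_zero_left] at h
  refine ⟨_, σ.eq_smul_ξ_of_φ_eq_zero ?_⟩
  simpa using h

section FirstIntegral

variable {F : Type*} [NormedAddCommGroup F] [NormedSpace ℝ F]

/-- `Y : S → F` is transverse to the Reeb foliation near `x`: a smooth map, constant along the
Reeb field, whose differential at `x` vanishes only on multiples of the Reeb field. -/
structure IsTransverseAt (Y : S → F) (x : S) : Prop where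
  eventually_contMDiffAt : ∀ᶠ y in 𝓝 x, ContMDiffAt (𝓡 (2 * n + 1)) 𝓘(ℝ, F) ∞ Y y
  vderiv_ξ : ∀ᶠ y in 𝓝 x, vderiv Y y (σ.ξ y) = 0
  ker : ∀ v : TangentSpace (𝓡 (2 * n + 1)) x, vderiv Y x v = 0 → ∃ c : ℝ, v = c • σ.ξ x

variable {σ} {Y : S → F} {x : S}

/-- Since `dY(ξ) = 0`, the bracket `[ξ, X]` is sent by `dY` to the derivative of
`dY(X)` along `ξ`. -/
theorem IsTransverseAt.vderiv_mlieBracket_ξ (hY : σ.IsTransverseAt Y x)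
    {X : ∀ y : S, TangentSpace (𝓡 (2 * n + 1)) y} (hX : FieldAt 1 X x) :
    vderiv Y x (mlieBracket (𝓡 (2 * n + 1)) σ.ξ X x) =
      vderiv (fun y => vderiv Y y (X y)) x (σ.ξ x) := by
  have h₀ : (fun y => vderiv Y y (σ.ξ y)) =ᶠ[𝓝 x] fun _ => (0 : F) := hY.vderiv_ξ
  have h₁ : (vderiv (fun y => vderiv Y y (σ.ξ y)) x :
      TangentSpace (𝓡 (2 * n + 1)) x →L[ℝ] F) = 0 := by
    rw [vderiv_congr h₀, vderiv, mfderiv_const]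
    rfl
  rw [vderiv_mlieBracket (hY.eventually_contMDiffAt.self_of_nhds.of_le ENat.LEInfty.out)
    ((σ.ξ_smooth x).fieldAt 1).mdifferentiableAt hX.mdifferentiableAt, h₁]
  exact sub_zero _

/-- A vector field whose projection under `dY` is constant is preserved by the Reeb field, up to
multiples of the Reeb field. -/
theorem IsTransverseAt.mlieBracket_ξ (hY : σ.IsTransverseAt Y x)
    {X : ∀ y : S, TangentSpace (𝓡 (2 * n + 1)) y} (hX : FieldAt 1 X x) {c : F}
    (hc : ∀ᶠ y in 𝓝 x, vderiv Y y (X y) = c) :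
    ∃ a : ℝ, mlieBracket (𝓡 (2 * n + 1)) σ.ξ X x = a • σ.ξ x := by
  apply hY.ker
  have h₀ : (fun y => vderiv Y y (X y)) =ᶠ[𝓝 x] fun _ => c := hc
  rw [hY.vderiv_mlieBracket_ξ hX, vderiv_congr h₀, vderiv, mfderiv_const]
  rfl

/-- Infinitesimal transverse invariance of `φ`: if the projection of `X` under `dY` is constant,
then that of `φ X` is constant along the Reeb field. -/
theorem IsTransverseAt.vderiv_φ (hY : σ.IsTransverseAt Y x)
    {X : ∀ y : S, TangentSpace (𝓡 (2 * n + 1)) y} (hX : SmoothFieldAt X x) {c : F}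
    (hc : ∀ᶠ y in 𝓝 x, vderiv Y y (X y) = c) :
    vderiv (fun y => vderiv Y y (σ.φ y (X y))) x (σ.ξ x) = 0 := by
  obtain ⟨a, ha⟩ := hY.mlieBracket_ξ (hX.fieldAt 1) hc
  obtain ⟨b, hb⟩ := σ.mlieBracket_ξ_φ hX ha
  have hφ : SmoothFieldAt (fun y => σ.φ y (X y)) x := contMDiffAt_endo_apply (σ.φ_smooth x) hX
  rw [← hY.vderiv_mlieBracket_ξ (hφ.fieldAt 1), hb, map_smul, hY.vderiv_ξ.self_of_nhds, smul_zero]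

/-- Infinitesimal transverse invariance of the metric: if the projections of `X` and `X'` under `dY`
are constant, then `g(φ X, φ X')` is constant along the Reeb field. -/
theorem IsTransverseAt.fieldDeriv_g (hY : σ.IsTransverseAt Y x)
    {X X' : ∀ y : S, TangentSpace (𝓡 (2 * n + 1)) y} (hX : SmoothFieldAt X x)
    (hX' : SmoothFieldAt X' x) {c c' : F}
    (hc : ∀ᶠ y in 𝓝 x, vderiv Y y (X y) = c) (hc' : ∀ᶠ y in 𝓝 x, vderiv Y y (X' y) = c') :
    fieldDeriv σ.ξ (fun y => 2 * σ.g.inner y (σ.φ y (X y)) (σ.φ y (X' y))) x = 0 := by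
  obtain ⟨a, ha⟩ := hY.mlieBracket_ξ (hX.fieldAt 1) hc
  obtain ⟨a', ha'⟩ := hY.mlieBracket_ξ (hX'.fieldAt 1) hc'
  obtain ⟨b, hb⟩ := σ.mlieBracket_ξ_φ hX ha
  have hφ : SmoothFieldAt (fun y => σ.φ y (X y)) x := contMDiffAt_endo_apply (σ.φ_smooth x) hX
  exact σ.fieldDeriv_ξ_eq_zero (hφ.fieldAt 2) (hX'.fieldAt 2) hb ha'

end FirstIntegral

end SasakianStructure

end Transverse

/-! ### Functions along integral curves -/

section CurveDerivative

open Set Filter Topology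

variable {k : ℕ} {M : Type*} [TopologicalSpace M] [ChartedSpace (EuclideanSpace ℝ (Fin k)) M]
  {F : Type*} [NormedAddCommGroup F] [NormedSpace ℝ F]
  {v : ∀ x : M, TangentSpace (𝓡 k) x} {γ : ℝ → M} {s : Set ℝ}

theorem IsMIntegralCurveOn.hasDerivWithinAt_comp (hγ : IsMIntegralCurveOn γ v s) {t : ℝ}
    (ht : t ∈ s) {h : M → F} (hh : MDifferentiableAt (𝓡 k) 𝓘(ℝ, F) h (γ t)) :
    HasDerivWithinAt (h ∘ γ) (vderiv h (γ t) (v (γ t))) s t := by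
  have h₁ := hh.hasMFDerivAt.comp_hasMFDerivWithinAt t (hγ t ht)
  have h₂ : HasFDerivWithinAt (h ∘ γ)
      ((vderiv h (γ t)).comp ((1 : ℝ →L[ℝ] ℝ).smulRight (v (γ t))) : ℝ →L[ℝ] F) s t :=
    h₁.hasFDerivWithinAt
  have h₃ := h₂.hasDerivWithinAt
  have h₄ : ((vderiv h (γ t)).comp ((1 : ℝ →L[ℝ] ℝ).smulRight (v (γ t))) : ℝ →L[ℝ] F) 1 =
      vderiv h (γ t) (v (γ t)) := by
    rw [ContinuousLinearMap.comp_apply]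
    congr 1
    exact one_smul ℝ (v (γ t))
  rwa [h₄] at h₃

/-- A function annihilated by a vector field is constant along integral curves. -/
theorem IsMIntegralCurveOn.comp_eq_of_vderiv_eq_zero (hγ : IsMIntegralCurveOn γ v s)
    (hs : Convex ℝ s) {h : M → F} (hh : ∀ t ∈ s, MDifferentiableAt (𝓡 k) 𝓘(ℝ, F) h (γ t))
    (h₀ : ∀ t ∈ s, vderiv h (γ t) (v (γ t)) = 0) {a b : ℝ} (ha : a ∈ s) (hb : b ∈ s) :
    h (γ a) = h (γ b) := by
  have hd : ∀ t ∈ s, HasDerivWithinAt (h ∘ γ) 0 s t := fun t ht => by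
    have := hγ.hasDerivWithinAt_comp ht (hh t ht)
    rwa [h₀ t ht] at this
  have := hs.norm_image_sub_le_of_norm_hasDerivWithin_le (C := 0) hd (by simp) hb ha
  rw [zero_mul] at this
  exact sub_eq_zero.1 (norm_le_zero_iff.1 this)

theorem exists_mem_eq_of_hasDerivAt_pos {c : ℝ → ℝ} {c' : ℝ} {t : ℝ} (h : HasDerivAt c c' t)
    (hc : 0 < c') (hcont : ∀ᶠ s in 𝓝 t, ContinuousAt c s) {u : Set ℝ} (hu : u ∈ 𝓝 t) :
    ∀ᶠ y in 𝓝 (c t), ∃ s ∈ u, c s = y := by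
  have hsl := (hasDerivAt_iff_tendsto_slope.1 h).eventually (lt_mem_nhds hc)
  obtain ⟨ε, hε, hball⟩ := Metric.mem_nhds_iff.1 (inter_mem hcont hu)
  have hR : ∀ᶠ s in 𝓝[>] t, c t < c s := by
    filter_upwards [hsl.filter_mono (nhdsWithin_mono _ fun s (hs : t < s) => ne_of_gt hs),
      self_mem_nhdsWithin] with s h₁ h₂
    rw [slope_def_field] at h₁
    linarith [(div_pos_iff_of_pos_right (sub_pos.2 h₂)).1 h₁]
  have hL : ∀ᶠ s in 𝓝[<] t, c s < c t := by
    filter_upwards [hsl.filter_mono (nhdsWithin_mono _ fun s (hs : s < t) => ne_of_lt hs),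
      self_mem_nhdsWithin] with s h₁ h₂
    rw [slope_comm, slope_def_field] at h₁
    linarith [(div_pos_iff_of_pos_right (sub_pos.2 h₂)).1 h₁]
  obtain ⟨b, hb, hbt⟩ := (hR.and (Ioo_mem_nhdsGT (show t < t + ε by linarith))).exists
  obtain ⟨a, ha, hat⟩ := (hL.and (Ioo_mem_nhdsLT (show t - ε < t by linarith))).exists
  have hsub : Icc a b ⊆ Metric.ball t ε := by
    rw [Real.ball_eq_Ioo]
    exact fun s hs => ⟨by linarith [hs.1, hat.1], by linarith [hs.2, hbt.2]⟩
  have hab : a ≤ b := by linarith [hat.2, hbt.1]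
  have hivt := intermediate_value_Icc hab
    (fun s hs => (hball (hsub hs)).1.continuousWithinAt : ContinuousOn c (Icc a b))
  filter_upwards [Ioo_mem_nhds ha hb] with y hy
  obtain ⟨s, hs, rfl⟩ := hivt ⟨hy.1.le, hy.2.le⟩
  exact ⟨s, (hball (hsub hs)).2, rfl⟩

/-- A real function with nonzero derivative at `t` takes all values near its value at `t`. -/
theorem exists_mem_eq_of_hasDerivAt {c : ℝ → ℝ} {c' : ℝ} {t : ℝ} (h : HasDerivAt c c' t)
    (hc : c' ≠ 0) (hcont : ∀ᶠ s in 𝓝 t, ContinuousAt c s) {u : Set ℝ} (hu : u ∈ 𝓝 t) :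
    ∀ᶠ y in 𝓝 (c t), ∃ s ∈ u, c s = y := by
  rcases hc.lt_or_gt with hc | hc
  · have h₁ := exists_mem_eq_of_hasDerivAt_pos h.neg (neg_pos.2 hc)
      (hcont.mono fun s hs => hs.neg) hu
    filter_upwards [(continuous_neg.tendsto (c t)).eventually h₁] with y hy
    obtain ⟨s, hs, hsy⟩ := hy
    exact ⟨s, hs, neg_injective hsy⟩
  · exact exists_mem_eq_of_hasDerivAt_pos h hc hcont hu

end CurveDerivative

/-! ### The splitting of the model space into the first coordinate and the others -/

section Coordinates

/-- Forgetting the coordinate of index `0`. -/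
noncomputable def tailL (m : ℕ) : EuclideanSpace ℝ (Fin (m + 1)) →L[ℝ] EuclideanSpace ℝ (Fin m) :=
  LinearMap.toContinuousLinearMap
    { toFun := fun v => WithLp.toLp 2 fun j => v j.succ
      map_add' := fun _ _ => rfl
      map_smul' := fun _ _ => rfl }

/-- Adding a coordinate of index `0` with value `0`. -/
noncomputable def zeroConsL (m : ℕ) :
    EuclideanSpace ℝ (Fin m) →L[ℝ] EuclideanSpace ℝ (Fin (m + 1)) :=
  LinearMap.toContinuousLinearMap
    { toFun := fun v => WithLp.toLp 2 (Fin.cons 0 fun j => v j)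
      map_add' := fun v w => by
        ext i
        refine Fin.cases ?_ (fun j => ?_) i <;> simp
      map_smul' := fun c v => by
        ext i
        refine Fin.cases ?_ (fun j => ?_) i <;> simp }

/-- The coordinate vector of index `0`. -/
noncomputable def headVec (m : ℕ) : EuclideanSpace ℝ (Fin (m + 1)) := EuclideanSpace.single 0 1

variable {m : ℕ}

@[simp] theorem tailL_apply (v : EuclideanSpace ℝ (Fin (m + 1))) (j : Fin m) :
    tailL m v j = v j.succ := rfl

@[simp] theorem zeroConsL_zero (v : EuclideanSpace ℝ (Fin m)) : zeroConsL m v 0 = 0 := rfl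

@[simp] theorem zeroConsL_succ (v : EuclideanSpace ℝ (Fin m)) (j : Fin m) :
    zeroConsL m v j.succ = v j := rfl

@[simp] theorem headVec_zero : headVec m 0 = 1 := by simp [headVec]

@[simp] theorem tailL_zeroConsL (v : EuclideanSpace ℝ (Fin m)) : tailL m (zeroConsL m v) = v := by
  ext j; simp

@[simp] theorem tailL_headVec : tailL m (headVec m) = 0 := by
  ext j; simp [headVec]

theorem eq_headVec_add (v : EuclideanSpace ℝ (Fin (m + 1))) :
    v = v 0 • headVec m + zeroConsL m (tailL m v) := by
  ext i
  refine Fin.cases ?_ (fun j => ?_) i <;> simp [headVec]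

theorem eq_of_zero_of_tailL {v w : EuclideanSpace ℝ (Fin (m + 1))} (h₀ : v 0 = w 0)
    (h : tailL m v = tailL m w) : v = w := by
  rw [eq_headVec_add v, eq_headVec_add w, h₀, h]

theorem norm_zeroConsL (v : EuclideanSpace ℝ (Fin m)) : ‖zeroConsL m v‖ = ‖v‖ := by
  simp [EuclideanSpace.norm_eq, Fin.sum_univ_succ]

theorem norm_tailL_le (v : EuclideanSpace ℝ (Fin (m + 1))) : ‖tailL m v‖ ≤ ‖v‖ := by
  rw [EuclideanSpace.norm_eq, EuclideanSpace.norm_eq]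
  apply Real.sqrt_le_sqrt
  rw [Fin.sum_univ_succ]
  simp only [tailL_apply]
  linarith [sq_nonneg ‖v 0‖]

end Coordinates

/-! ### Charts from the inverse function theorem -/

section InverseFunction

open Set Filter Topology

variable {k : ℕ} {M : Type*} [TopologicalSpace M] [ChartedSpace (EuclideanSpace ℝ (Fin k)) M]
  [IsManifold (𝓡 k) ∞ M]

/-- The inverse function theorem: a smooth map to the model space whose differential at `x` is
injective is a chart near `x`; its image may be taken to be a ball. -/
theorem exists_chart_of_vderiv_injective {G : M → EuclideanSpace ℝ (Fin k)} {x : M}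
    (hG : ∀ᶠ y in 𝓝 x, ContMDiffAt (𝓡 k) (𝓡 k) ∞ G y)
    (hinj : ∀ v : TangentSpace (𝓡 k) x, vderiv G x v = 0 → v = 0) {O : Set M} (hO : O ∈ 𝓝 x) :
    ∃ ψ ∈ IsManifold.maximalAtlas (𝓡 k) ∞ M, ∃ r > 0, x ∈ ψ.source ∧ ψ.source ⊆ O ∧
      EqOn ψ G ψ.source ∧ ψ.target = Metric.ball (G x) r := by
  set c := chartAt (EuclideanSpace ℝ (Fin k)) x with hc
  have hxc : x ∈ c.source := mem_chart_source _ x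
  set Ĝ : EuclideanSpace ℝ (Fin k) → EuclideanSpace ℝ (Fin k) := G ∘ c.symm with hĜ
  have hsymm : ∀ z ∈ c.target, ContMDiffAt (𝓡 k) (𝓡 k) ∞ c.symm z := fun z hz =>
    contMDiffOn_chart_symm.contMDiffAt (c.open_target.mem_nhds hz)
  have hĜd : ∀ z ∈ c.target, ContMDiffAt (𝓡 k) (𝓡 k) ∞ G (c.symm z) → ContDiffAt ℝ ∞ Ĝ z :=
    fun z hz h => (h.comp z (hsymm z hz)).contDiffAt
  have hĜx : ContDiffAt ℝ ∞ Ĝ (c x) :=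
    hĜd _ (c.map_source hxc) (by rw [c.left_inv hxc]; exact hG.self_of_nhds)
  have hinj' : ∀ u, fderiv ℝ Ĝ (c x) u = 0 → u = 0 := by
    intro u hu
    obtain ⟨v, rfl⟩ := (isInvertible_mfderiv_extChartAt (I := 𝓡 k)
      (mem_extChartAt_source (I := 𝓡 k) x)).bijective.surjective u
    have hGx : MDifferentiableAt (𝓡 k) (𝓡 k) G x :=
      hG.self_of_nhds.mdifferentiableAt (by simp)
    have h := vderiv_eq_fderiv (mem_extChartAt_source (I := 𝓡 k) x) hGx v
    rw [hinj v (h.trans hu)]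
    exact map_zero _
  obtain ⟨L, hL⟩ : ∃ L : EuclideanSpace ℝ (Fin k) ≃L[ℝ] EuclideanSpace ℝ (Fin k),
      (L : EuclideanSpace ℝ (Fin k) →L[ℝ] EuclideanSpace ℝ (Fin k)) = fderiv ℝ Ĝ (c x) := by
    refine ⟨(LinearEquiv.ofInjectiveEndo (fderiv ℝ Ĝ (c x) : _ →ₗ[ℝ] _)
      ((injective_iff_map_eq_zero _).2 hinj')).toContinuousLinearEquiv, ?_⟩
    ext1 u
    rfl
  have hĜL : HasFDerivAt Ĝ (L : EuclideanSpace ℝ (Fin k) →L[ℝ] EuclideanSpace ℝ (Fin k)) (c x) := by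
    rw [hL]
    exact (hĜx.differentiableAt (by simp)).hasFDerivAt
  set Φ := hĜx.toOpenPartialHomeomorph Ĝ hĜL (by simp) with hΦ
  have hΦx : c x ∈ Φ.source := hĜx.mem_toOpenPartialHomeomorph_source hĜL (by simp)
  have hinv : ∀ᶠ z in 𝓝 (c x), ∃ L : EuclideanSpace ℝ (Fin k) ≃L[ℝ] EuclideanSpace ℝ (Fin k),
      (L : EuclideanSpace ℝ (Fin k) →L[ℝ] EuclideanSpace ℝ (Fin k)) = fderiv ℝ Ĝ z := by
    have hcont : ContinuousAt (fderiv ℝ Ĝ) (c x) :=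
      (hĜx.fderiv_right (m := 0) (by simp)).continuousAt
    have := hcont.tendsto.eventually (hL ▸ L.nhds)
    exact this.mono fun z hz => hz
  obtain ⟨V, hVsub, hVo, hxV⟩ := mem_nhds_iff.1 (inter_mem hO (inter_mem hG
    ((c.continuousAt hxc).tendsto.eventually hinv)))
  set ψ₁ := (c.trans Φ).restrOpen V hVo with hψ₁
  have hxψ₁ : x ∈ ψ₁.source := ⟨⟨hxc, hΦx⟩, hxV⟩
  have hψ₁G : EqOn ψ₁ G ψ₁.source := fun y hy => congrArg G (c.left_inv hy.1.1)
  obtain ⟨r, hr, hball⟩ := Metric.mem_nhds_iff.1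
    (ψ₁.open_target.mem_nhds (ψ₁.map_source hxψ₁))
  rw [hψ₁G hxψ₁] at hball
  set ψ := (ψ₁.symm.restrOpen (Metric.ball (G x) r) Metric.isOpen_ball).symm with hψ
  have hsrc : ψ.source ⊆ ψ₁.source := by
    intro y hy
    have h : ψ y ∈ ψ₁.target := (ψ.map_source hy).1
    rw [← ψ.left_inv hy]
    exact ψ₁.map_target h
  have htgt : ψ.target = Metric.ball (G x) r := by
    change ψ₁.target ∩ Metric.ball (G x) r = _
    exact inter_eq_right.2 hball
  have hψG : EqOn ψ G ψ.source := fun y hy => hψ₁G (hsrc hy)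
  have hxψ : x ∈ ψ.source := by
    have h : G x ∈ ψ.target := by rw [htgt]; exact Metric.mem_ball_self hr
    have h' := ψ.map_target h
    have : ψ.symm (G x) = x := by
      change ψ₁.symm (G x) = x
      rw [← hψ₁G hxψ₁, ψ₁.left_inv hxψ₁]
    rwa [this] at h'
  refine ⟨ψ, ?_, r, hr, hxψ, fun y hy => (hVsub (hsrc hy).2).1, hψG, htgt⟩
  refine OpenPartialHomeomorph.mem_maximalAtlas_of_contMDiffOn _ ?_ ?_
  · intro y hy
    refine ContMDiffAt.contMDiffWithinAt ?_
    exact (hVsub (hsrc hy).2).2.1.congr_of_eventuallyEq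
      (eventually_of_mem (ψ.open_source.mem_nhds hy) hψG)
  · intro z hz
    refine ContMDiffAt.contMDiffWithinAt ?_
    have hz₁ : z ∈ ψ₁.target := hz.1
    have hy := ψ₁.map_target hz₁
    set y := ψ₁.symm z with hyz
    have hΦz : z ∈ Φ.target := hz₁.1.1
    have hcy : Φ.symm z = c y := by
      have : y = c.symm (Φ.symm z) := rfl
      rw [this, c.right_inv hz₁.1.2]
    obtain ⟨L', hL'⟩ := (hVsub hy.2).2.2
    have hd : ContDiffAt ℝ ∞ Ĝ (Φ.symm z) := by
      rw [hcy]
      refine hĜd _ (c.map_source hy.1.1) ?_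
      rw [c.left_inv hy.1.1]
      exact (hVsub hy.2).2.1
    have h₁ : ContDiffAt ℝ ∞ Φ.symm z := by
      refine Φ.contDiffAt_symm hΦz (f₀' := L') ?_ hd
      rw [hL', ← hcy]
      exact (hd.differentiableAt (by simp)).hasFDerivAt
    exact (hsymm _ hz₁.1.2).comp z h₁.contMDiffAt

end InverseFunction

/-! ### Derivatives in charts -/

section ChartDerivative

variable {k : ℕ} {M : Type*} [TopologicalSpace M] [ChartedSpace (EuclideanSpace ℝ (Fin k)) M]

theorem mdifferentiable_of_mem_maximalAtlas
    {ψ : OpenPartialHomeomorph M (EuclideanSpace ℝ (Fin k))}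
    (hψ : ψ ∈ IsManifold.maximalAtlas (𝓡 k) ∞ M) : ψ.MDifferentiable (𝓡 k) (𝓡 k) :=
  ⟨(contMDiffOn_of_mem_maximalAtlas hψ).mdifferentiableOn (by simp),
    (contMDiffOn_symm_of_mem_maximalAtlas hψ).mdifferentiableOn (by simp)⟩

theorem vderiv_clm_comp {F F' : Type*} [NormedAddCommGroup F] [NormedSpace ℝ F]
    [NormedAddCommGroup F'] [NormedSpace ℝ F'] (L : F →L[ℝ] F') {h : M → F} {x : M}
    (hh : MDifferentiableAt (𝓡 k) 𝓘(ℝ, F) h x) (v : TangentSpace (𝓡 k) x) :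
    vderiv (fun y => L (h y)) x v = L (vderiv h x v) := by
  have h₁ : HasMFDerivAt (𝓡 k) 𝓘(ℝ, F') (L ∘ h) x _ :=
    (L.hasFDerivAt.hasMFDerivAt (x := h x)).comp x hh.hasMFDerivAt
  exact congrArg (fun T : TangentSpace (𝓡 k) x →L[ℝ] F' => T v) h₁.mfderiv

theorem contMDiffAt_tailL {m : ℕ} {S : Type*} [TopologicalSpace S]
    [ChartedSpace (EuclideanSpace ℝ (Fin (m + 1))) S]
    {ψ : OpenPartialHomeomorph S (EuclideanSpace ℝ (Fin (m + 1)))}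
    (hψ : ψ ∈ IsManifold.maximalAtlas (𝓡 (m + 1)) ∞ S) {x : S} (hx : x ∈ ψ.source) :
    ContMDiffAt (𝓡 (m + 1)) 𝓘(ℝ, EuclideanSpace ℝ (Fin m)) ∞ (fun q => tailL m (ψ q)) x :=
  (tailL m).contMDiff.contMDiffAt.comp x (contMDiffAt_of_mem_maximalAtlas hψ hx)

theorem vderiv_eq_zero_of_mem_maximalAtlas
    {ψ : OpenPartialHomeomorph M (EuclideanSpace ℝ (Fin k))}
    (hψ : ψ ∈ IsManifold.maximalAtlas (𝓡 k) ∞ M) {x : M} (hx : x ∈ ψ.source)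
    {v : TangentSpace (𝓡 k) x} (hv : vderiv ψ x v = 0) : v = 0 :=
  (mdifferentiable_of_mem_maximalAtlas hψ).mfderiv_injective hx (hv.trans (map_zero _).symm)

end ChartDerivative

/-! ### Charts in which the leaves are parallel lines -/

section LeafCharts

open Set Filter Topology

variable {n : ℕ} {S : Type*} [TopologicalSpace S]
  [ChartedSpace (EuclideanSpace ℝ (Fin (2 * n + 1))) S] [IsManifold (𝓡 (2 * n + 1)) ∞ S]

namespace SasakianStructure

/-- A chart onto a ball about the origin, foliated for the Reeb foliation, in which the leaves are
exactly the lines parallel to the axis of index `0`. -/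
structure IsLeafChart (σ : SasakianStructure n S)
    (ψ : OpenPartialHomeomorph S (EuclideanSpace ℝ (Fin (2 * n + 1)))) (r : ℝ) : Prop where
  mem_maximalAtlas : ψ ∈ IsManifold.maximalAtlas (𝓡 (2 * n + 1)) ∞ S
  target_eq : ψ.target = Metric.ball 0 r
  vderiv_ξ : ∀ q ∈ ψ.source, vderiv (fun q => tailL (2 * n) (ψ q)) q (σ.ξ q) = 0
  tailL_eq_iff : ∀ p ∈ ψ.source, ∀ q ∈ ψ.source,
    tailL (2 * n) (ψ p) = tailL (2 * n) (ψ q) ↔ σ.SameLeaf p q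

variable {σ : SasakianStructure n S}

/-- A symmetric and transitive relation that holds along the integral curves of the Reeb field
inside a foliated chart with convex image holds between any two points of a plaque. The integral
curve through a point sweeps out a neighbourhood of it in its plaque, because it moves the
coordinate of index `0` with nonzero speed. -/
theorem plaque_induction
    {ψ : OpenPartialHomeomorph S (EuclideanSpace ℝ (Fin (2 * n + 1)))}
    {a : EuclideanSpace ℝ (Fin (2 * n + 1))} {r : ℝ}
    (hψ : ψ ∈ IsManifold.maximalAtlas (𝓡 (2 * n + 1)) ∞ S) (ht : ψ.target = Metric.ball a r)
    (hξ : ∀ q ∈ ψ.source, vderiv (fun q => tailL (2 * n) (ψ q)) q (σ.ξ q) = 0)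
    {P : S → S → Prop} (hsymm : ∀ x y, P x y → P y x) (htrans : ∀ x y z, P x y → P y z → P x z)
    (hP : ∀ (γ : ℝ → S) (s t : ℝ), IsMIntegralCurveOn γ σ.ξ (uIcc s t) →
      (∀ u ∈ uIcc s t, γ u ∈ ψ.source) → P (γ s) (γ t))
    {p q : S} (hp : p ∈ ψ.source) (hq : q ∈ ψ.source)
    (hpq : tailL (2 * n) (ψ p) = tailL (2 * n) (ψ q)) : P p q := by
  -- the line through `ψ p` is connected, so it suffices to relate its points to those near them
  set A : Set (EuclideanSpace ℝ (Fin (2 * n + 1))) :=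
    Metric.ball a r ∩ {z | tailL (2 * n) z = tailL (2 * n) (ψ p)} with hA
  have hAc : Convex ℝ A := by
    refine (convex_ball a r).inter ?_
    intro z hz w hw s t _ _ hst
    change tailL (2 * n) _ = _
    change tailL (2 * n) z = _ at hz
    change tailL (2 * n) w = _ at hw
    rw [map_add, map_smul, map_smul, hz, hw, ← add_smul, hst, one_smul]
  have key := hAc.isPreconnected.induction₂ (fun z w => P (ψ.symm z) (ψ.symm w)) ?_
    (fun _ _ _ _ _ _ => htrans _ _ _) (fun _ _ _ _ => hsymm _ _)
    (x := ψ p) (y := ψ q) ⟨ht ▸ ψ.map_source hp, rfl⟩ ⟨ht ▸ ψ.map_source hq, hpq.symm⟩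
  · rwa [ψ.left_inv hp, ψ.left_inv hq] at key
  intro z hz
  have hz' : z ∈ ψ.target := ht ▸ hz.1
  have hzs := ψ.map_target hz'
  obtain ⟨γ, hγ₀, hγ⟩ := exists_isMIntegralCurveAt_of_contMDiffAt_boundaryless 0
    ((σ.contMDiff_ξ.of_le (m := 1) (by simp)).contMDiffAt (x := ψ.symm z))
  obtain ⟨ε, hε, hγ⟩ := isMIntegralCurveAt_iff'.1 hγ
  have hψd : ∀ y ∈ ψ.source, MDifferentiableAt (𝓡 (2 * n + 1)) (𝓡 (2 * n + 1)) ψ y :=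
    fun y hy => (contMDiffAt_of_mem_maximalAtlas hψ hy).mdifferentiableAt (by simp)
  have h0 : (0 : ℝ) ∈ Metric.ball (0 : ℝ) ε := Metric.mem_ball_self hε
  have hγcont : ∀ t ∈ Metric.ball (0 : ℝ) ε, ContinuousAt γ t := fun t ht =>
    ((hγ t ht).hasMFDerivAt (Metric.isOpen_ball.mem_nhds ht)).continuousAt
  have hev : ∀ᶠ t in 𝓝 (0 : ℝ), γ t ∈ ψ.source :=
    (hγcont 0 h0).eventually (by rw [hγ₀]; exact ψ.open_source.mem_nhds hzs)
  obtain ⟨δ, hδ, hδsub⟩ := Metric.mem_nhds_iff.1 (inter_mem hev (Metric.ball_mem_nhds 0 hε))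
  have hγδ := hγ.mono fun t ht => (hδsub ht).2
  have htail : ∀ t ∈ Metric.ball (0 : ℝ) δ, tailL (2 * n) (ψ (γ t)) = tailL (2 * n) z := by
    intro t ht
    have h₁ : ∀ y ∈ ψ.source, MDifferentiableAt (𝓡 (2 * n + 1))
        𝓘(ℝ, EuclideanSpace ℝ (Fin (2 * n))) (fun q => tailL (2 * n) (ψ q)) y := fun y hy =>
      MDifferentiableAt.comp (I' := 𝓡 (2 * n + 1)) y
        (tailL (2 * n)).differentiableAt.mdifferentiableAt (hψd y hy)
    have := hγδ.comp_eq_of_vderiv_eq_zero (convex_ball 0 δ) (h := fun q => tailL (2 * n) (ψ q))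
      (fun t ht => h₁ _ (hδsub ht).1) (fun t ht => hξ _ (hδsub ht).1) ht (Metric.mem_ball_self hδ)
    rw [this, hγ₀, ψ.right_inv hz']
  set P₀ : EuclideanSpace ℝ (Fin (2 * n + 1)) →L[ℝ] ℝ := EuclideanSpace.proj 0 with hP₀
  have hdψ : HasDerivAt (ψ ∘ γ) (vderiv ψ (γ 0) (σ.ξ (γ 0))) 0 :=
    (hγ.hasDerivWithinAt_comp h0 (hψd _ (by rw [hγ₀]; exact hzs))).hasDerivAt
      (Metric.isOpen_ball.mem_nhds h0)
  have hd : HasDerivAt (fun t => ψ (γ t) 0) (P₀ (vderiv ψ (γ 0) (σ.ξ (γ 0)))) 0 :=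
    P₀.hasFDerivAt.comp_hasDerivAt 0 hdψ
  have hne : P₀ (vderiv ψ (γ 0) (σ.ξ (γ 0))) ≠ 0 := by
    intro h
    have hγ0s : γ 0 ∈ ψ.source := by rw [hγ₀]; exact hzs
    have h₁ := (vderiv_clm_comp (tailL (2 * n)) (hψd _ hγ0s) (σ.ξ (γ 0))).symm.trans (hξ _ hγ0s)
    have h₂ : vderiv ψ (γ 0) (σ.ξ (γ 0)) = 0 :=
      eq_of_zero_of_tailL (m := 2 * n) h (h₁.trans (map_zero _).symm)
    exact σ.ξ_ne_zero _ (vderiv_eq_zero_of_mem_maximalAtlas hψ hγ0s h₂)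
  have hcont : ∀ᶠ t in 𝓝 (0 : ℝ), ContinuousAt (fun t => ψ (γ t) 0) t := by
    filter_upwards [Metric.ball_mem_nhds 0 hδ] with t ht
    exact P₀.continuous.continuousAt.comp
      ((hψd _ (hδsub ht).1).continuousAt.comp (hγcont t (hδsub ht).2))
  have hex := exists_mem_eq_of_hasDerivAt hd hne hcont (Metric.ball_mem_nhds 0 hδ)
  have hz0 : ψ (γ 0) 0 = z 0 := by rw [hγ₀, ψ.right_inv hz']
  simp only [hz0] at hex
  have hex' := (P₀.continuous.tendsto z).eventually hex
  filter_upwards [nhdsWithin_le_nhds hex', self_mem_nhdsWithin] with w hw hwA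
  obtain ⟨s, hs, hsw⟩ := hw
  have hψs : ψ (γ s) = w :=
    eq_of_zero_of_tailL hsw ((htail s hs).trans (hz.2.trans hwA.2.symm))
  have hws : ψ.symm w = γ s := by rw [← hψs, ψ.left_inv (hδsub hs).1]
  have huIcc : uIcc 0 s ⊆ Metric.ball 0 δ := by
    rw [Real.ball_eq_Ioo] at hs ⊢
    exact ordConnected_Ioo.uIcc_subset ⟨by linarith, by linarith⟩ hs
  rw [hws, ← hγ₀]
  exact hP γ 0 s (hγδ.mono huIcc) fun u hu => (hδsub (huIcc hu)).1

/-- Points on a line of a foliated chart with convex image lie on the same leaf. -/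
theorem sameLeaf_of_tailL_eq [T2Space S]
    {ψ : OpenPartialHomeomorph S (EuclideanSpace ℝ (Fin (2 * n + 1)))}
    {a : EuclideanSpace ℝ (Fin (2 * n + 1))} {r : ℝ}
    (hψ : ψ ∈ IsManifold.maximalAtlas (𝓡 (2 * n + 1)) ∞ S) (ht : ψ.target = Metric.ball a r)
    (hξ : ∀ q ∈ ψ.source, vderiv (fun q => tailL (2 * n) (ψ q)) q (σ.ξ q) = 0)
    {p q : S} (hp : p ∈ ψ.source) (hq : q ∈ ψ.source)
    (hpq : tailL (2 * n) (ψ p) = tailL (2 * n) (ψ q)) : σ.SameLeaf p q :=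
  plaque_induction hψ ht hξ (fun _ _ h => h.symm) (fun _ _ _ h h' => h.trans h')
    (fun γ s t hγ _ => ⟨γ, s, t, hγ, rfl, rfl⟩) hp hq hpq

/-- A map transverse to the Reeb foliation near `x` and constant on leaves yields a chart at `x`
in which the leaves are parallel lines. -/
theorem IsTransverseAt.exists_isLeafChart [T2Space S] {d : ℕ}
    {Y : S → EuclideanSpace ℝ (Fin d)} {x : S} (hY : σ.IsTransverseAt Y x) {U : Set S}
    (hU : U ∈ 𝓝 x) (hYU : ∀ p ∈ U, ∀ q ∈ U, σ.SameLeaf p q → Y p = Y q) :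
    ∃ ψ r, σ.IsLeafChart ψ r ∧ x ∈ ψ.source ∧ ψ.source ⊆ U ∧ ψ x = 0 ∧
      ∃ L : EuclideanSpace ℝ (Fin d) →L[ℝ] EuclideanSpace ℝ (Fin (2 * n)),
        (∀ v : TangentSpace (𝓡 (2 * n + 1)) x, L (vderiv Y x v) = 0 → vderiv Y x v = 0) ∧
        ∀ q ∈ ψ.source, tailL (2 * n) (ψ q) = L (Y q - Y x) := by
  have hYd : ∀ᶠ y in 𝓝 x, MDifferentiableAt (𝓡 (2 * n + 1)) 𝓘(ℝ, EuclideanSpace ℝ (Fin d)) Y y :=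
    hY.eventually_contMDiffAt.mono fun y hy => hy.mdifferentiableAt (by simp)
  -- a linear map identifying the image of the differential of `Y` with `ℝ²ⁿ`
  obtain ⟨L, hL⟩ : ∃ L : EuclideanSpace ℝ (Fin d) →L[ℝ] EuclideanSpace ℝ (Fin (2 * n)),
      ∀ v : TangentSpace (𝓡 (2 * n + 1)) x, L (vderiv Y x v) = 0 → vderiv Y x v = 0 := by
    let D' : EuclideanSpace ℝ (Fin (2 * n + 1)) →L[ℝ] EuclideanSpace ℝ (Fin d) := vderiv Y x
    let D : EuclideanSpace ℝ (Fin (2 * n + 1)) →ₗ[ℝ] EuclideanSpace ℝ (Fin d) := D'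
    obtain ⟨w, hw, hw₀⟩ : ∃ w : EuclideanSpace ℝ (Fin (2 * n + 1)), w ≠ 0 ∧
        ∀ v, D v = 0 ↔ ∃ c : ℝ, c • w = v := by
      refine ⟨σ.ξ x, σ.ξ_ne_zero x, fun v => ⟨fun h => ?_, ?_⟩⟩
      · obtain ⟨c, hc⟩ := hY.ker v h
        exact ⟨c, hc.symm⟩
      · rintro ⟨c, rfl⟩
        exact (D'.map_smul c (σ.ξ x)).trans
          ((congrArg (c • ·) hY.vderiv_ξ.self_of_nhds).trans (smul_zero c))
    have hker : LinearMap.ker D = Submodule.span ℝ {w} := by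
      ext v
      rw [LinearMap.mem_ker, Submodule.mem_span_singleton, hw₀]
    have hrank := LinearMap.finrank_range_add_finrank_ker D
    rw [hker, finrank_span_singleton hw, finrank_euclideanSpace_fin] at hrank
    have hfin : Module.finrank ℝ (LinearMap.range D) =
        Module.finrank ℝ (EuclideanSpace ℝ (Fin (2 * n))) := by
      rw [finrank_euclideanSpace_fin]
      omega
    let L₀ : LinearMap.range D ≃ₗ[ℝ] EuclideanSpace ℝ (Fin (2 * n)) :=
      LinearEquiv.ofFinrankEq _ _ hfin
    obtain ⟨L, hL⟩ := LinearMap.exists_extend L₀.toLinearMap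
    refine ⟨LinearMap.toContinuousLinearMap L, fun v hv => ?_⟩
    have h₁ : L (D v) = L₀ ⟨D v, LinearMap.mem_range_self D v⟩ :=
      congrArg (fun T => T ⟨D v, LinearMap.mem_range_self D v⟩) hL
    have h₂ : L₀ ⟨D v, LinearMap.mem_range_self D v⟩ = 0 := h₁.symm.trans hv
    exact congrArg Subtype.val ((LinearEquiv.map_eq_zero_iff L₀).1 h₂)
  set e := extChartAt (𝓡 (2 * n + 1)) x with he
  set w : EuclideanSpace ℝ (Fin (2 * n + 1)) := vderiv e x (σ.ξ x) with hw
  have hes := mem_extChartAt_source (I := 𝓡 (2 * n + 1)) x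
  have hw0 : w ≠ 0 := by
    intro h
    have hinv := isInvertible_mfderiv_extChartAt (I := 𝓡 (2 * n + 1)) hes
    exact σ.ξ_ne_zero x (hinv.bijective.injective (h.trans (map_zero _).symm))
  -- the first coordinate is a linear function that increases along the Reeb field
  set A : EuclideanSpace ℝ (Fin (2 * n + 1)) →L[ℝ] EuclideanSpace ℝ (Fin (2 * n + 1)) :=
    (innerSL ℝ w).smulRight (headVec (2 * n)) with hA
  set B : EuclideanSpace ℝ (Fin d) →L[ℝ] EuclideanSpace ℝ (Fin (2 * n + 1)) :=
    (zeroConsL (2 * n)).comp L with hB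
  -- the kernel of `dY` is `ℝ ξ`, on which the differential of `A ∘ e` is injective
  set G : S → EuclideanSpace ℝ (Fin (2 * n + 1)) := fun q => A (e q - e x) + B (Y q - Y x) with hG
  have hed : ∀ᶠ y in 𝓝 x, ContMDiffAt (𝓡 (2 * n + 1)) (𝓡 (2 * n + 1)) ∞ e y := by
    filter_upwards [extChartAt_source_mem_nhds (I := 𝓡 (2 * n + 1)) x] with y hy
    exact contMDiffAt_extChartAt' (by rwa [extChartAt_source] at hy)
  have hGs : ∀ᶠ y in 𝓝 x, ContMDiffAt (𝓡 (2 * n + 1)) (𝓡 (2 * n + 1)) ∞ G y := by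
    filter_upwards [hed, hY.eventually_contMDiffAt] with y h₁ h₂
    exact (A.contMDiff.contMDiffAt.comp y (h₁.sub contMDiffAt_const)).add
      (B.contMDiff.contMDiffAt.comp y (h₂.sub contMDiffAt_const))
  have hGd : ∀ v : TangentSpace (𝓡 (2 * n + 1)) x,
      vderiv G x v = A (vderiv e x v) + B (vderiv Y x v) := by
    intro v
    have h₁ : HasMFDerivAt (𝓡 (2 * n + 1)) 𝓘(ℝ, EuclideanSpace ℝ (Fin (2 * n + 1)))
        (fun q => A (e q - e x)) x (A.comp (vderiv e x :
          EuclideanSpace ℝ (Fin (2 * n + 1)) →L[ℝ] EuclideanSpace ℝ (Fin (2 * n + 1)))) := by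
      have h := (hed.self_of_nhds.mdifferentiableAt (by simp)).hasMFDerivAt
      have h' := (A.hasFDerivAt (x := e x)).sub_const (A (e x))
      refine (h'.hasMFDerivAt.comp x h).congr_of_eventuallyEq (Eventually.of_forall fun q => ?_)
      exact map_sub A _ _
    have h₂ : HasMFDerivAt (𝓡 (2 * n + 1)) 𝓘(ℝ, EuclideanSpace ℝ (Fin (2 * n + 1)))
        (fun q => B (Y q - Y x)) x (B.comp (vderiv Y x :
          EuclideanSpace ℝ (Fin (2 * n + 1)) →L[ℝ] EuclideanSpace ℝ (Fin d))) := by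
      have h := hYd.self_of_nhds.hasMFDerivAt
      have h' := (B.hasFDerivAt (x := Y x)).sub_const (B (Y x))
      refine (h'.hasMFDerivAt.comp x h).congr_of_eventuallyEq (Eventually.of_forall fun q => ?_)
      exact map_sub B _ _
    exact congrArg (fun T : TangentSpace (𝓡 (2 * n + 1)) x →L[ℝ]
      EuclideanSpace ℝ (Fin (2 * n + 1)) => T v) (h₁.add h₂).mfderiv
  have htA : ∀ u, tailL (2 * n) (A u) = 0 := fun u => by
    simp [hA]
  have hinj : ∀ v : TangentSpace (𝓡 (2 * n + 1)) x, vderiv G x v = 0 → v = 0 := by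
    intro v hv
    rw [hGd] at hv
    have h₁ : L (vderiv Y x v) = 0 := by
      have h := congrArg (tailL (2 * n)) hv
      rw [map_add, htA, zero_add, map_zero, hB, ContinuousLinearMap.comp_apply,
        tailL_zeroConsL] at h
      exact h
    obtain ⟨c, rfl⟩ := hY.ker v (hL v h₁)
    rw [hL _ h₁, map_zero, add_zero] at hv
    have h₂ : A (c • w) = 0 := by
      rw [← hv]
      exact congrArg A (map_smul (vderiv e x) c (σ.ξ x)).symm
    have h₃ := congrArg (fun u => u 0) h₂
    simp [hA, hw0] at h₃
    rw [h₃, zero_smul]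
  obtain ⟨W, hWsub, hWo, hxW⟩ := mem_nhds_iff.1 (inter_mem hU (inter_mem hY.vderiv_ξ hYd))
  obtain ⟨ψ, hψ, r, hr, hxψ, hψW, hψG, hψt⟩ :=
    exists_chart_of_vderiv_injective hGs hinj (hWo.mem_nhds hxW)
  have hGx : G x = 0 := by simp [hG]
  rw [hGx] at hψt
  have htail : ∀ q ∈ ψ.source, tailL (2 * n) (ψ q) = L (Y q - Y x) := by
    intro q hq
    rw [hψG hq, hG]
    simp only
    rw [map_add, htA, zero_add, hB, ContinuousLinearMap.comp_apply, tailL_zeroConsL]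
  have hξ : ∀ q ∈ ψ.source, vderiv (fun q => tailL (2 * n) (ψ q)) q (σ.ξ q) = 0 := by
    intro q hq
    have h₁ : (fun q => tailL (2 * n) (ψ q)) =ᶠ[𝓝 q] fun q => L (Y q - Y x) :=
      eventually_of_mem (ψ.open_source.mem_nhds hq) htail
    have h₂ : (fun q => L (Y q - Y x)) = fun q => L (Y q) - L (Y x) := by
      ext1 q
      exact map_sub L _ _
    have h₃ : HasMFDerivAt (𝓡 (2 * n + 1)) 𝓘(ℝ, EuclideanSpace ℝ (Fin (2 * n)))
        (fun q => L (Y q) - L (Y x)) q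
        (L.comp (vderiv Y q : EuclideanSpace ℝ (Fin (2 * n + 1)) →L[ℝ] EuclideanSpace ℝ (Fin d))) :=
      ((L.hasFDerivAt (x := Y q)).sub_const (L (Y x))).hasMFDerivAt.comp q
        (hWsub (hψW hq)).2.2.hasMFDerivAt
    rw [vderiv_congr (h₁.trans (Eventually.of_forall (congrFun h₂)))]
    refine (congrArg (fun T : TangentSpace (𝓡 (2 * n + 1)) q →L[ℝ] EuclideanSpace ℝ (Fin (2 * n)) =>
      T (σ.ξ q)) h₃.mfderiv).trans ?_
    exact (congrArg L (hWsub (hψW hq)).2.1).trans (map_zero L)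
  refine ⟨ψ, r, ⟨hψ, hψt, hξ, fun p hp q hq => ⟨sameLeaf_of_tailL_eq hψ hψt hξ hp hq, ?_⟩⟩, hxψ,
    fun y hy => (hWsub (hψW hy)).1, (hψG hxψ).trans hGx, L, hL, htail⟩
  intro h
  rw [htail p hp, htail q hq, hYU p (hWsub (hψW hp)).1 q (hWsub (hψW hq)).1 h]

end SasakianStructure

end LeafCharts

/-! ### Regularity and its inheritance under Sasakian immersions -/

section LeafChartExistence

open Set Filter Topology

variable {n : ℕ} {S : Type*} [TopologicalSpace S]
  [ChartedSpace (EuclideanSpace ℝ (Fin (2 * n + 1))) S] [IsManifold (𝓡 (2 * n + 1)) ∞ S]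

namespace SasakianStructure

/-- Every point has arbitrarily small charts in which the leaves are parallel lines. -/
def HasLeafCharts (σ : SasakianStructure n S) : Prop :=
  ∀ (x : S) (O : Set S), O ∈ 𝓝 x → ∃ ψ r, σ.IsLeafChart ψ r ∧ x ∈ ψ.source ∧ ψ.source ⊆ O ∧ ψ x = 0

variable {σ : SasakianStructure n S}

/-- Leaf charts exist if each point has a neighbourhood with a map that is transverse to the Reeb
foliation and takes equal values at points of the same leaf. -/
theorem hasLeafCharts_of_isTransverseAt [T2Space S] {d : ℕ}
    (h : ∀ x, ∃ Y : S → EuclideanSpace ℝ (Fin d), σ.IsTransverseAt Y x ∧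
      ∃ U ∈ 𝓝 x, ∀ p ∈ U, ∀ q ∈ U, σ.SameLeaf p q → Y p = Y q) : σ.HasLeafCharts := by
  intro x O hO
  obtain ⟨Y, hY, U, hU, hYU⟩ := h x
  obtain ⟨ψ, r, hψ, hx, hsub, h0, -⟩ := hY.exists_isLeafChart (inter_mem hU hO)
    fun p hp q hq => hYU p hp.1 q hq.1
  exact ⟨ψ, r, hψ, hx, fun y hy => (hsub hy).2, h0⟩

/-- The last `2n` coordinates of a foliated chart are transverse to the Reeb foliation. -/
theorem isTransverseAt_tailL {ψ : OpenPartialHomeomorph S (EuclideanSpace ℝ (Fin (2 * n + 1)))}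
    (hψ : ψ ∈ IsManifold.maximalAtlas (𝓡 (2 * n + 1)) ∞ S)
    (hξ : ∀ q ∈ ψ.source, vderiv (fun q => tailL (2 * n) (ψ q)) q (σ.ξ q) = 0)
    {x : S} (hx : x ∈ ψ.source) : σ.IsTransverseAt (fun q => tailL (2 * n) (ψ q)) x where
  eventually_contMDiffAt := eventually_of_mem (ψ.open_source.mem_nhds hx)
    fun _ hy => contMDiffAt_tailL hψ hy
  vderiv_ξ := eventually_of_mem (ψ.open_source.mem_nhds hx) hξ
  ker v hv := by
    have hd : MDifferentiableAt (𝓡 (2 * n + 1)) 𝓘(ℝ, EuclideanSpace ℝ (Fin (2 * n + 1))) ψ x :=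
      (contMDiffAt_of_mem_maximalAtlas hψ hx).mdifferentiableAt (by simp)
    have key : ∀ v : TangentSpace (𝓡 (2 * n + 1)) x,
        vderiv (fun q => tailL (2 * n) (ψ q)) x v = 0 →
        ∃ c : ℝ, vderiv ψ x v = c • headVec (2 * n) := by
      intro v hv
      have h : tailL (2 * n) (vderiv ψ x v) = 0 :=
        (vderiv_clm_comp (tailL (2 * n)) hd v).symm.trans hv
      refine ⟨vderiv ψ x v 0, (eq_headVec_add _).trans ?_⟩
      rw [h, map_zero, add_zero]
    obtain ⟨a, ha⟩ := key v hv
    obtain ⟨b, hb⟩ := key (σ.ξ x) (hξ x hx)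
    have hb0 : b ≠ 0 := by
      rintro rfl
      rw [zero_smul] at hb
      exact σ.ξ_ne_zero x (vderiv_eq_zero_of_mem_maximalAtlas hψ hx hb)
    refine ⟨a / b, sub_eq_zero.1 (vderiv_eq_zero_of_mem_maximalAtlas hψ hx ?_)⟩
    rw [map_sub, map_smul, ha, hb, smul_smul, div_mul_cancel₀ a hb0, sub_self]

theorem IsLeafChart.isTransverseAt
    {ψ : OpenPartialHomeomorph S (EuclideanSpace ℝ (Fin (2 * n + 1)))} {r : ℝ}
    (hψ : σ.IsLeafChart ψ r) {x : S} (hx : x ∈ ψ.source) :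
    σ.IsTransverseAt (fun q => tailL (2 * n) (ψ q)) x :=
  isTransverseAt_tailL hψ.mem_maximalAtlas hψ.vderiv_ξ hx

theorem IsFoliatedChart.vderiv_ξ
    {ψ : OpenPartialHomeomorph S (EuclideanSpace ℝ (Fin (2 * n + 1)))} (hψ : σ.IsFoliatedChart ψ)
    {q : S} (hq : q ∈ ψ.source) : vderiv (fun q => tailL (2 * n) (ψ q)) q (σ.ξ q) = 0 := by
  ext j
  have h := vderiv_clm_comp (EuclideanSpace.proj j : EuclideanSpace ℝ (Fin (2 * n)) →L[ℝ] ℝ)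
    ((contMDiffAt_tailL hψ.1 hq).mdifferentiableAt (by simp)) (σ.ξ q)
  exact h.symm.trans (hψ.2 q hq j)

/-- In the charts given by regularity, points of the same leaf lie on the same plaque, hence have
the same last `2n` coordinates. -/
theorem IsRegular.hasLeafCharts [T2Space S] (h : σ.IsRegular) : σ.HasLeafCharts := by
  refine hasLeafCharts_of_isTransverseAt (d := 2 * n) fun x => ?_
  obtain ⟨ψ, hψ, hx, hp⟩ := h x
  refine ⟨_, isTransverseAt_tailL hψ.1 (fun q hq => hψ.vderiv_ξ hq) hx, ψ.source,
    ψ.open_source.mem_nhds hx, fun p hps q hqs hpq => ?_⟩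
  have hmem : q ∈ plaque ψ p := by
    rw [hp p hps q hqs hpq]
    exact mem_connectedComponentIn ⟨hqs, fun _ => rfl⟩
  have := (connectedComponentIn_subset _ _ hmem).2
  ext j
  exact (this j).symm

theorem HasLeafCharts.isRegular (h : σ.HasLeafCharts) : σ.IsRegular := by
  intro x
  obtain ⟨ψ, r, hψ, hx, -, -⟩ := h x univ univ_mem
  refine ⟨ψ, ⟨hψ.mem_maximalAtlas, fun q hq j => ?_⟩, hx, fun p hp q hq hpq => ?_⟩
  · have h := vderiv_clm_comp (EuclideanSpace.proj j : EuclideanSpace ℝ (Fin (2 * n)) →L[ℝ] ℝ)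
      ((contMDiffAt_tailL hψ.mem_maximalAtlas hq).mdifferentiableAt (by simp)) (σ.ξ q)
    exact h.trans (by rw [hψ.vderiv_ξ q hq, map_zero])
  -- the whole line through `p` is connected, so it is the plaque of each of its points
  have hplaque : ∀ p ∈ ψ.source,
      plaque ψ p = {q | q ∈ ψ.source ∧ tailL (2 * n) (ψ q) = tailL (2 * n) (ψ p)} := by
    intro p hp
    have hset : {q | q ∈ ψ.source ∧ ∀ j : Fin (2 * n), ψ q j.succ = ψ p j.succ} =
        {q | q ∈ ψ.source ∧ tailL (2 * n) (ψ q) = tailL (2 * n) (ψ p)} := by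
      ext q
      refine and_congr_right fun _ => ⟨fun h => ?_, fun h j => ?_⟩
      · ext j
        exact h j
      · exact congrArg (fun u : EuclideanSpace ℝ (Fin (2 * n)) => u j) h
    have himage : {q | q ∈ ψ.source ∧ tailL (2 * n) (ψ q) = tailL (2 * n) (ψ p)} =
        ψ.symm '' (Metric.ball 0 r ∩ tailL (2 * n) ⁻¹' {tailL (2 * n) (ψ p)}) := by
      ext q
      constructor
      · rintro ⟨hq, hqt⟩
        exact ⟨ψ q, ⟨hψ.target_eq ▸ ψ.map_source hq, hqt⟩, ψ.left_inv hq⟩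
      · rintro ⟨z, ⟨hz, hzt⟩, rfl⟩
        rw [← hψ.target_eq] at hz
        exact ⟨ψ.map_target hz, by rw [ψ.right_inv hz]; exact hzt⟩
    have hconn : IsPreconnected
        {q | q ∈ ψ.source ∧ tailL (2 * n) (ψ q) = tailL (2 * n) (ψ p)} := by
      rw [himage]
      refine IsPreconnected.image ?_ _ (ψ.continuousOn_symm.mono ?_)
      · exact ((convex_ball 0 r).inter
          ((convex_singleton _).linear_preimage (tailL (2 * n)).toLinearMap)).isPreconnected
      · rw [hψ.target_eq]
        exact inter_subset_left
    rw [plaque, hset, hconn.connectedComponentIn ⟨hp, rfl⟩]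
  rw [hplaque p hp, hplaque q hq, (hψ.tailL_eq_iff p hp q hq).2 hpq]

end SasakianStructure

namespace IsSasakianImmersion

variable {n' : ℕ} {S' : Type*} [TopologicalSpace S']
  [ChartedSpace (EuclideanSpace ℝ (Fin (2 * n' + 1))) S'] [IsManifold (𝓡 (2 * n' + 1)) ∞ S']
  {σ : SasakianStructure n S} {σ' : SasakianStructure n' S'} {f : S → S'}

theorem sameLeaf (hf : IsSasakianImmersion σ σ' f) {x y : S} (h : σ.SameLeaf x y) :
    σ'.SameLeaf (f x) (f y) := by
  obtain ⟨γ, a, b, hγ, rfl, rfl⟩ := h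
  refine ⟨f ∘ γ, a, b, fun t ht => ?_, rfl, rfl⟩
  have hd := (hf.smooth.mdifferentiableAt (x := γ t) (by simp)).hasMFDerivAt
  refine (hd.comp_hasMFDerivWithinAt t (hγ t ht)).congr_mfderiv ?_
  ext1
  change mfderiv (𝓡 (2 * n + 1)) (𝓡 (2 * n' + 1)) f (γ t) ((1 : ℝ) • σ.ξ (γ t)) =
    (1 : ℝ) • σ'.ξ (f (γ t))
  rw [one_smul, hf.map_ξ, one_smul]

/-- A map transverse to the Reeb foliation of `S'` stays transverse after composition with a
Sasakian immersion: if `d(Y ∘ f)` annihilates `v`, then `df(v)` is a multiple of `ξ' = df(ξ)`,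
and `df` is injective. -/
theorem isTransverseAt (hf : IsSasakianImmersion σ σ' f) {F : Type*} [NormedAddCommGroup F]
    [NormedSpace ℝ F] {Y : S' → F} {x : S} (hY : σ'.IsTransverseAt Y (f x)) :
    σ.IsTransverseAt (Y ∘ f) x := by
  have hfd : ∀ y, MDifferentiableAt (𝓡 (2 * n + 1)) (𝓡 (2 * n' + 1)) f y := fun y =>
    hf.smooth.mdifferentiableAt (by simp)
  have hfx : Tendsto f (𝓝 x) (𝓝 (f x)) := hf.smooth.continuous.tendsto x
  have hd : ∀ᶠ y in 𝓝 x, ∀ v : TangentSpace (𝓡 (2 * n + 1)) y, vderiv (Y ∘ f) y v =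
      vderiv Y (f y) (mfderiv (𝓡 (2 * n + 1)) (𝓡 (2 * n' + 1)) f y v) := by
    filter_upwards [hfx.eventually hY.eventually_contMDiffAt] with y hy v
    exact vderiv_comp (hy.mdifferentiableAt (by simp)) (hfd y) v
  refine ⟨?_, ?_, fun v hv => ?_⟩
  · filter_upwards [hfx.eventually hY.eventually_contMDiffAt] with y hy
    exact hy.comp y (hf.smooth y)
  · filter_upwards [hd, hfx.eventually hY.vderiv_ξ] with y h₁ h₂
    rw [h₁, hf.map_ξ, h₂]
  · rw [hd.self_of_nhds] at hv
    obtain ⟨c, hc⟩ := hY.ker _ hv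
    refine ⟨c, hf.immersion x (hc.trans ?_)⟩
    rw [map_smul, hf.map_ξ]

/-- Leaf charts of `S'`, composed with a Sasakian immersion, separate the leaves of `S`. -/
theorem hasLeafCharts [T2Space S] (hf : IsSasakianImmersion σ σ' f) (h : σ'.HasLeafCharts) :
    σ.HasLeafCharts := by
  refine SasakianStructure.hasLeafCharts_of_isTransverseAt (d := 2 * n') fun x => ?_
  obtain ⟨ψ, r, hψ, hx, -, -⟩ := h (f x) univ univ_mem
  exact ⟨_, hf.isTransverseAt (hψ.isTransverseAt hx), f ⁻¹' ψ.source,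
    hf.smooth.continuous.continuousAt.preimage_mem_nhds (ψ.open_source.mem_nhds hx),
    fun p hp q hq hpq => (hψ.tailL_eq_iff _ hp _ hq).2 (hf.sameLeaf hpq)⟩

end IsSasakianImmersion

end LeafChartExistence

/-! ### Moving points along leaves -/

section Holonomy

open Set Filter Topology

variable {n : ℕ} {S : Type*} [TopologicalSpace S]
  [ChartedSpace (EuclideanSpace ℝ (Fin (2 * n + 1))) S] [IsManifold (𝓡 (2 * n + 1)) ∞ S]

namespace SasakianStructure

/-- `x` can be moved to `y` by a smooth map defined near `x` that moves points along their leaves: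
a germ of a map with the properties of a time-`t` map of the Reeb flow. -/
def IsLeafShift (σ : SasakianStructure n S) (x y : S) : Prop :=
  ∃ h : S → S, h x = y ∧
    (∀ᶠ z in 𝓝 x, ContMDiffAt (𝓡 (2 * n + 1)) (𝓡 (2 * n + 1)) ∞ h z) ∧
    ∀ᶠ z in 𝓝 x, σ.SameLeaf z (h z)

variable {σ : SasakianStructure n S}

theorem IsLeafShift.trans [T2Space S] {x y z : S} (h : σ.IsLeafShift x y)
    (h' : σ.IsLeafShift y z) : σ.IsLeafShift x z := by
  obtain ⟨f, rfl, hfs, hf⟩ := h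
  obtain ⟨g, rfl, hgs, hg⟩ := h'
  have hc := hfs.self_of_nhds.continuousAt
  refine ⟨g ∘ f, rfl, ?_, ?_⟩
  · filter_upwards [hfs, hc.eventually hgs] with w h₁ h₂
    exact h₂.comp w h₁
  · filter_upwards [hf, hc.eventually hg] with w h₁ h₂
    exact h₁.trans h₂

/-- Within a leaf chart, a translation parallel to the first axis moves points along leaves. -/
theorem IsLeafChart.isLeafShift
    {ψ : OpenPartialHomeomorph S (EuclideanSpace ℝ (Fin (2 * n + 1)))} {r : ℝ}
    (hψ : σ.IsLeafChart ψ r) {p q : S} (hp : p ∈ ψ.source) (hq : q ∈ ψ.source)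
    (hpq : σ.SameLeaf p q) : σ.IsLeafShift p q := by
  -- `ψ q - ψ p` is parallel to the first axis, as `p` and `q` lie on the same leaf
  have hpt : ψ p + (ψ q - ψ p) = ψ q := add_sub_cancel _ _
  have hcont : ContinuousAt (fun z => ψ z + (ψ q - ψ p)) p :=
    (ψ.continuousAt hp).add continuousAt_const
  have hev : ∀ᶠ z in 𝓝 p, z ∈ ψ.source ∧ ψ z + (ψ q - ψ p) ∈ ψ.target :=
    (show ∀ᶠ z in 𝓝 p, z ∈ ψ.source from ψ.open_source.mem_nhds hp).and
      (hcont.preimage_mem_nhds (by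
        rw [hpt]; exact ψ.open_target.mem_nhds (ψ.map_source hq)))
  refine ⟨fun z => ψ.symm (ψ z + (ψ q - ψ p)), by simp only [hpt, ψ.left_inv hq], ?_, ?_⟩
  · filter_upwards [hev] with z hz
    have h₁ : ContMDiffAt (𝓡 (2 * n + 1)) (𝓡 (2 * n + 1)) ∞ (fun z => ψ z + (ψ q - ψ p)) z :=
      (contMDiffAt_of_mem_maximalAtlas hψ.mem_maximalAtlas hz.1).add contMDiffAt_const
    exact (contMDiffAt_symm_of_mem_maximalAtlas hψ.mem_maximalAtlas hz.2).comp z h₁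
  · filter_upwards [hev] with z hz
    rw [← hψ.tailL_eq_iff z hz.1 _ (ψ.map_target hz.2), ψ.right_inv hz.2, map_add, map_sub,
      (hψ.tailL_eq_iff p hp q hq).2 hpq, sub_self, add_zero]

theorem SameLeaf.of_curve {γ : ℝ → S} {a b s t : ℝ} (h : IsMIntegralCurveOn γ σ.ξ (uIcc a b))
    (hs : s ∈ uIcc a b) (ht : t ∈ uIcc a b) : σ.SameLeaf (γ s) (γ t) :=
  ⟨γ, s, t, h.mono (uIcc_subset_uIcc hs ht), rfl, rfl⟩

/-- A property of pairs of points on a leaf holds for all pairs once it holds within leaf charts. -/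
theorem HasLeafCharts.leaf_induction (hσ : σ.HasLeafCharts) {P : S → S → Prop}
    (htrans : ∀ x y z, P x y → P y z → P x z)
    (h : ∀ ψ r, σ.IsLeafChart ψ r → ∀ p ∈ ψ.source, ∀ q ∈ ψ.source, σ.SameLeaf p q → P p q)
    {x y : S} (hxy : σ.SameLeaf x y) : P x y := by
  obtain ⟨γ, a, b, hγ, rfl, rfl⟩ := hxy
  refine isPreconnected_uIcc.induction₂' (s := uIcc a b) (fun s t => P (γ s) (γ t)) ?_
    (fun _ _ _ _ _ _ => htrans _ _ _) left_mem_uIcc right_mem_uIcc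
  intro s hs
  obtain ⟨ψ, r, hψ, hx, -, -⟩ := hσ (γ s) univ univ_mem
  have hc : ContinuousWithinAt γ (uIcc a b) s := (hγ s hs).continuousWithinAt
  filter_upwards [hc.preimage_mem_nhdsWithin (ψ.open_source.mem_nhds hx), self_mem_nhdsWithin]
    with t ht htu
  exact ⟨h ψ r hψ _ hx _ ht (SameLeaf.of_curve hγ hs htu),
    h ψ r hψ _ ht _ hx (SameLeaf.of_curve hγ htu hs)⟩

theorem HasLeafCharts.isLeafShift [T2Space S] (hσ : σ.HasLeafCharts) {x y : S}
    (h : σ.SameLeaf x y) : σ.IsLeafShift x y :=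
  hσ.leaf_induction (fun _ _ _ => IsLeafShift.trans)
    (fun _ _ hψ _ hp _ hq hpq => hψ.isLeafShift hp hq hpq) h

end SasakianStructure

end Holonomy

/-! ### The transverse structure is constant along plaques -/

section TransverseInvariance

open Set Filter Topology

variable {n : ℕ} {S : Type*} [TopologicalSpace S]
  [ChartedSpace (EuclideanSpace ℝ (Fin (2 * n + 1))) S] [IsManifold (𝓡 (2 * n + 1)) ∞ S]

section CoordinateField

variable {k : ℕ} {M : Type*} [TopologicalSpace M] [ChartedSpace (EuclideanSpace ℝ (Fin k)) M]

/-- The vector field whose components in the chart `ψ` are the constants `c`. -/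
noncomputable def coordField (ψ : OpenPartialHomeomorph M (EuclideanSpace ℝ (Fin k)))
    (c : EuclideanSpace ℝ (Fin k)) (y : M) : TangentSpace (𝓡 k) y :=
  mfderiv (𝓡 k) (𝓡 k) ψ.symm (ψ y) c

variable {ψ : OpenPartialHomeomorph M (EuclideanSpace ℝ (Fin k))}

theorem vderiv_coordField (hψ : ψ ∈ IsManifold.maximalAtlas (𝓡 k) ∞ M)
    (c : EuclideanSpace ℝ (Fin k)) {y : M} (hy : y ∈ ψ.source) :
    vderiv ψ y (coordField ψ c y) = c := by
  have h := mdifferentiable_of_mem_maximalAtlas hψ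
  have h₁ := h.comp_symm_deriv (ψ.map_source hy)
  have h₂ : ∀ z, z = y → (mfderiv (𝓡 k) (𝓡 k) ψ z :
      EuclideanSpace ℝ (Fin k) →L[ℝ] EuclideanSpace ℝ (Fin k)) = mfderiv (𝓡 k) (𝓡 k) ψ y := by
    rintro z rfl
    rfl
  have h₃ := congrArg (fun T : EuclideanSpace ℝ (Fin k) →L[ℝ] EuclideanSpace ℝ (Fin k) => T c) h₁
  exact (congrArg (fun T : EuclideanSpace ℝ (Fin k) →L[ℝ] EuclideanSpace ℝ (Fin k) =>
    T (mfderiv (𝓡 k) (𝓡 k) ψ.symm (ψ y) c)) (h₂ _ (ψ.left_inv hy)).symm).trans h₃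

variable [IsManifold (𝓡 k) ∞ M]

theorem smoothFieldAt_coordField (hψ : ψ ∈ IsManifold.maximalAtlas (𝓡 k) ∞ M)
    (c : EuclideanSpace ℝ (Fin k)) {y : M} (hy : y ∈ ψ.source) :
    SmoothFieldAt (coordField ψ c) y := by
  have hsec : ContMDiff (𝓡 k) (𝓡 k).tangent ∞
      (fun z : EuclideanSpace ℝ (Fin k) =>
        (⟨z, c⟩ : TangentBundle (𝓡 k) (EuclideanSpace ℝ (Fin k)))) :=
    contMDiff_vectorSpace_iff_contDiff.2 contDiff_const
  have h := contMDiffAt_mfderiv_apply (I₁ := 𝓡 k) (I₂ := 𝓡 k) (I₃ := 𝓡 k) (n := ∞) (m := ∞) le_rfl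
    (fun _ : M => (ψ.symm : EuclideanSpace ℝ (Fin k) → M)) (g := ψ) (v := fun _ => c) (x := y)
    ((contMDiffAt_symm_of_mem_maximalAtlas hψ (ψ.map_source hy)).comp (y, ψ y) contMDiffAt_snd)
    (hsec.contMDiffAt.comp y (contMDiffAt_of_mem_maximalAtlas hψ hy)) (by simp)
  refine h.congr_of_eventuallyEq ?_
  filter_upwards [ψ.open_source.mem_nhds hy] with z hz
  have h₂ : ∀ w (v : EuclideanSpace ℝ (Fin k)), w = z →
      (⟨z, v⟩ : TangentBundle (𝓡 k) M) = ⟨w, v⟩ := by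
    rintro w v rfl
    rfl
  exact h₂ _ _ (ψ.left_inv hz)

end CoordinateField

/-- The values of a metric on two vector fields. -/
theorem contMDiffAt_metric_apply {k : ℕ} {M : Type*} [TopologicalSpace M]
    [ChartedSpace (EuclideanSpace ℝ (Fin k)) M] [IsManifold (𝓡 k) ∞ M]
    (g : Bundle.ContMDiffRiemannianMetric (𝓡 k) ∞ (EuclideanSpace ℝ (Fin k))
      (fun x : M => TangentSpace (𝓡 k) x)) {m : WithTop ℕ∞} [ENat.LEInfty m]
    {X Y : ∀ y : M, TangentSpace (𝓡 k) y} {x : M} (hX : FieldAt m X x) (hY : FieldAt m Y x) :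
    ContMDiffAt (𝓡 k) 𝓘(ℝ, ℝ) m (fun y => g.inner y (X y) (Y y)) x := by
  have hg := (g.contMDiff x).of_le (ENat.LEInfty.out : m ≤ ∞)
  have h := ContMDiffAt.clm_bundle_apply₂ (E₁ := fun x : M => TangentSpace (𝓡 k) x)
    (E₂ := fun x : M => TangentSpace (𝓡 k) x) (E₃ := Bundle.Trivial M ℝ) (b := fun x : M => x)
    (F₁ := EuclideanSpace ℝ (Fin k)) (F₂ := EuclideanSpace ℝ (Fin k)) (F₃ := ℝ)
    (ψ := fun y => g.inner y) (v := X) (w := Y) hg hX hY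
  exact (Bundle.contMDiffAt_totalSpace.1 h).2

namespace SasakianStructure

variable {σ : SasakianStructure n S}
  {ψ : OpenPartialHomeomorph S (EuclideanSpace ℝ (Fin (2 * n + 1)))} {r : ℝ}

/-- A function annihilated by the Reeb field is constant on the plaques of a leaf chart. -/
theorem IsLeafChart.eq_of_vderiv_ξ_eq_zero (hψ : σ.IsLeafChart ψ r) {F : Type*}
    [NormedAddCommGroup F] [NormedSpace ℝ F] {h : S → F}
    (hh : ∀ q ∈ ψ.source, MDifferentiableAt (𝓡 (2 * n + 1)) 𝓘(ℝ, F) h q)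
    (hξ : ∀ q ∈ ψ.source, vderiv h q (σ.ξ q) = 0) {p q : S} (hp : p ∈ ψ.source)
    (hq : q ∈ ψ.source) (hpq : σ.SameLeaf p q) : h p = h q :=
  plaque_induction hψ.mem_maximalAtlas hψ.target_eq hψ.vderiv_ξ (P := fun p q => h p = h q)
    (fun _ _ => Eq.symm) (fun _ _ _ => Eq.trans)
    (fun _ _ _ hγ hu => hγ.comp_eq_of_vderiv_eq_zero (convex_uIcc _ _) (fun t ht => hh _ (hu t ht))
      (fun t ht => hξ _ (hu t ht)) left_mem_uIcc right_mem_uIcc)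
    hp hq ((hψ.tailL_eq_iff p hp q hq).2 hpq)

/-- `φ` and the metric on the image of `φ` are constant along the plaques of a leaf chart, when
tangent vectors at different points of a plaque are compared through their projections to `ℝ²ⁿ`. -/
theorem IsLeafChart.transverse_invariance (hψ : σ.IsLeafChart ψ r) {p q : S} (hp : p ∈ ψ.source)
    (hq : q ∈ ψ.source) (hpq : σ.SameLeaf p q)
    {v w : TangentSpace (𝓡 (2 * n + 1)) p} {v' w' : TangentSpace (𝓡 (2 * n + 1)) q}
    (hv : vderiv (fun q => tailL (2 * n) (ψ q)) p v = vderiv (fun q => tailL (2 * n) (ψ q)) q v')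
    (hw : vderiv (fun q => tailL (2 * n) (ψ q)) p w = vderiv (fun q => tailL (2 * n) (ψ q)) q w') :
    vderiv (fun q => tailL (2 * n) (ψ q)) p (σ.φ p v) =
      vderiv (fun q => tailL (2 * n) (ψ q)) q (σ.φ q v') ∧
    σ.g.inner p (σ.φ p v) (σ.φ p w) = σ.g.inner q (σ.φ q v') (σ.φ q w') := by
  set Y : S → EuclideanSpace ℝ (Fin (2 * n)) := fun q => tailL (2 * n) (ψ q) with hYdef
  have hY : ∀ y ∈ ψ.source, σ.IsTransverseAt Y y := fun y hy => hψ.isTransverseAt hy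
  have hat := hψ.mem_maximalAtlas
  have hψd : ∀ y ∈ ψ.source, MDifferentiableAt (𝓡 (2 * n + 1))
      𝓘(ℝ, EuclideanSpace ℝ (Fin (2 * n + 1))) ψ y := fun y hy =>
    (contMDiffAt_of_mem_maximalAtlas hat hy).mdifferentiableAt (by simp)
  have hdY : ∀ c, ∀ y ∈ ψ.source, vderiv Y y (coordField ψ c y) = tailL (2 * n) c := by
    intro c y hy
    exact (vderiv_clm_comp (tailL (2 * n)) (hψd y hy) _).trans
      (congrArg (tailL (2 * n)) (vderiv_coordField hat c hy))
  have hsm : ∀ c, ∀ y ∈ ψ.source, SmoothFieldAt (coordField ψ c) y := fun c y hy =>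
    smoothFieldAt_coordField hat c hy
  have hφ : ∀ c, ∀ y ∈ ψ.source, SmoothFieldAt (fun y => σ.φ y (coordField ψ c y)) y :=
    fun c y hy => contMDiffAt_endo_apply (σ.φ_smooth y) (hsm c y hy)
  have hconst : ∀ c, ∀ y ∈ ψ.source, ∀ᶠ z in 𝓝 y, vderiv Y z (coordField ψ c z) = tailL (2 * n) c :=
    fun c y hy => eventually_of_mem (ψ.open_source.mem_nhds hy) (hdY c)
  -- the coordinate fields that extend `v` and `w`
  have hp₀ : ∀ v : TangentSpace (𝓡 (2 * n + 1)) p, coordField ψ (vderiv ψ p v) p = v := by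
    intro v
    refine sub_eq_zero.1 (vderiv_eq_zero_of_mem_maximalAtlas hat hp ?_)
    rw [map_sub, vderiv_coordField hat _ hp, sub_self]
  have hq₀ : ∀ (v : TangentSpace (𝓡 (2 * n + 1)) p) (v' : TangentSpace (𝓡 (2 * n + 1)) q),
      vderiv Y p v = vderiv Y q v' →
      σ.φ q (coordField ψ (vderiv ψ p v) q) = σ.φ q v' := by
    intro v v' h
    have h₁ : vderiv Y q (coordField ψ (vderiv ψ p v) q - v') = 0 := by
      rw [map_sub, hdY _ q hq, ← h]
      exact sub_eq_zero.2 (vderiv_clm_comp (tailL (2 * n)) (hψd p hp) v).symm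
    obtain ⟨c, hc⟩ := (hY q hq).ker _ h₁
    exact σ.φ_eq_of_sub_eq_smul hc
  have h₁ : ∀ c, vderiv Y p (σ.φ p (coordField ψ c p)) = vderiv Y q (σ.φ q (coordField ψ c q)) := by
    intro c
    refine hψ.eq_of_vderiv_ξ_eq_zero (h := fun y => vderiv Y y (σ.φ y (coordField ψ c y)))
      (fun y hy => ?_) (fun y hy => (hY y hy).vderiv_φ (hsm c y hy) (hconst c y hy)) hp hq hpq
    exact (contMDiffAt_vderiv_apply (n := 2) (m := 1) ENat.LEInfty.out
      ((contMDiffAt_tailL hat hy).of_le ENat.LEInfty.out) ((hφ c y hy).fieldAt 1)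
      (by norm_num)).mdifferentiableAt one_ne_zero
  have h₂ : ∀ c d, 2 * σ.g.inner p (σ.φ p (coordField ψ c p)) (σ.φ p (coordField ψ d p)) =
      2 * σ.g.inner q (σ.φ q (coordField ψ c q)) (σ.φ q (coordField ψ d q)) := by
    intro c d
    refine hψ.eq_of_vderiv_ξ_eq_zero
      (h := fun y => 2 * σ.g.inner y (σ.φ y (coordField ψ c y)) (σ.φ y (coordField ψ d y)))
      (fun y hy => ?_) (fun y hy => (hY y hy).fieldDeriv_g (hsm c y hy) (hsm d y hy)
        (hconst c y hy) (hconst d y hy)) hp hq hpq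
    have hg := contMDiffAt_metric_apply σ.g (hφ c y hy) (hφ d y hy)
    exact (contMDiffAt_const.mul hg).mdifferentiableAt (n := ∞) (by simp)
  have e₁ := h₁ (vderiv ψ p v)
  have e₂ := h₂ (vderiv ψ p v) (vderiv ψ p w)
  rw [hp₀, hq₀ v v' hv] at e₁
  rw [hp₀, hp₀, hq₀ v v' hv, hq₀ w w' hw] at e₂
  exact ⟨e₁, by linarith⟩

end SasakianStructure

end TransverseInvariance

/-! ### Submersions along the leaves -/

section LeafSubmersion

open Set Filter Topology

variable {n : ℕ} {S : Type*} [TopologicalSpace S]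
  [ChartedSpace (EuclideanSpace ℝ (Fin (2 * n + 1))) S] [IsManifold (𝓡 (2 * n + 1)) ∞ S]
  {M : Type*} [TopologicalSpace M] [ChartedSpace (EuclideanSpace ℝ (Fin (2 * n))) M]

variable (n) in
/-- The differential of `p`, with values in the model space. As tangent spaces are identified with
the model space, this makes it possible to compare the values at two points of a fibre of `p`. -/
noncomputable def baseDeriv (p : S → M) (x : S) :
    TangentSpace (𝓡 (2 * n + 1)) x →L[ℝ] EuclideanSpace ℝ (Fin (2 * n)) :=
  mfderiv (𝓡 (2 * n + 1)) (𝓡 (2 * n)) p x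

/-- A smooth submersion onto a `2n`-manifold whose fibres are the leaves of the Reeb foliation. -/
structure IsLeafSubmersion (σ : SasakianStructure n S) (p : S → M) : Prop where
  smooth : ContMDiff (𝓡 (2 * n + 1)) (𝓡 (2 * n)) ∞ p
  surjective : Function.Surjective p
  submersion : ∀ x, Function.Surjective (mfderiv (𝓡 (2 * n + 1)) (𝓡 (2 * n)) p x)
  fibre : ∀ x y, p x = p y ↔ σ.SameLeaf x y

namespace IsLeafSubmersion

variable {σ : SasakianStructure n S} {p : S → M}

theorem mdifferentiableAt (hp : IsLeafSubmersion σ p) (x : S) :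
    MDifferentiableAt (𝓡 (2 * n + 1)) (𝓡 (2 * n)) p x :=
  hp.smooth.mdifferentiableAt (by simp)

theorem exists_baseDeriv_eq (hp : IsLeafSubmersion σ p) (x : S)
    (u : EuclideanSpace ℝ (Fin (2 * n))) :
    ∃ v : TangentSpace (𝓡 (2 * n + 1)) x, baseDeriv n p x v = u :=
  hp.submersion x u

/-- The Reeb field is tangent to the fibres. -/
theorem mfderiv_ξ (hp : IsLeafSubmersion σ p) (x : S) :
    mfderiv (𝓡 (2 * n + 1)) (𝓡 (2 * n)) p x (σ.ξ x) = 0 := by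
  obtain ⟨γ, hγ₀, hγ⟩ := exists_isMIntegralCurveAt_of_contMDiffAt_boundaryless 0
    ((σ.contMDiff_ξ.of_le (m := 1) (by simp)).contMDiffAt (x := x))
  obtain ⟨ε, hε, hγ⟩ := isMIntegralCurveAt_iff'.1 hγ
  subst hγ₀
  have h0 : (0 : ℝ) ∈ Metric.ball (0 : ℝ) ε := Metric.mem_ball_self hε
  have h₁ := (hp.mdifferentiableAt (γ 0)).hasMFDerivAt.comp 0
    ((hγ 0 h0).hasMFDerivAt (Metric.ball_mem_nhds 0 hε))
  have hconst : p ∘ γ =ᶠ[𝓝 0] fun _ => p (γ 0) := by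
    filter_upwards [Metric.ball_mem_nhds 0 hε] with t ht
    refine (hp.fibre _ _).2 ⟨γ, t, 0, hγ.mono ?_, rfl, rfl⟩
    rw [Real.ball_eq_Ioo] at h0 ht ⊢
    exact ordConnected_Ioo.uIcc_subset ht h0
  have h₂ := (hasMFDerivAt_const (p (γ 0)) (0 : ℝ)).congr_of_eventuallyEq (I := 𝓘(ℝ, ℝ))
    (I' := 𝓡 (2 * n)) hconst
  have h₃ := congrArg (fun T : ℝ →L[ℝ] EuclideanSpace ℝ (Fin (2 * n)) => T 1)
    (hasMFDerivAt_unique h₁ h₂)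
  refine Eq.trans ?_ h₃
  exact congrArg (mfderiv (𝓡 (2 * n + 1)) (𝓡 (2 * n)) p (γ 0)) (one_smul ℝ (σ.ξ (γ 0))).symm

/-- The kernel of the differential is one-dimensional, hence spanned by the Reeb field. -/
theorem ker (hp : IsLeafSubmersion σ p) {x : S} {v : TangentSpace (𝓡 (2 * n + 1)) x}
    (hv : mfderiv (𝓡 (2 * n + 1)) (𝓡 (2 * n)) p x v = 0) : ∃ c : ℝ, v = c • σ.ξ x := by
  let D : EuclideanSpace ℝ (Fin (2 * n + 1)) →L[ℝ] EuclideanSpace ℝ (Fin (2 * n)) :=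
    mfderiv (𝓡 (2 * n + 1)) (𝓡 (2 * n)) p x
  have hD : Function.Surjective D := hp.submersion x
  obtain ⟨w, hw, hw₀⟩ : ∃ w : LinearMap.ker D.toLinearMap, w ≠ 0 ∧
      (w : EuclideanSpace ℝ (Fin (2 * n + 1))) = σ.ξ x :=
    ⟨⟨σ.ξ x, hp.mfderiv_ξ x⟩, fun h => σ.ξ_ne_zero x (congrArg Subtype.val h), rfl⟩
  have hrank := LinearMap.finrank_range_add_finrank_ker D.toLinearMap
  rw [LinearMap.range_eq_top.2 hD, finrank_top, finrank_euclideanSpace_fin,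
    finrank_euclideanSpace_fin] at hrank
  have h1 : Module.finrank ℝ (LinearMap.ker D.toLinearMap) = 1 := by omega
  obtain ⟨c, hc⟩ := (finrank_eq_one_iff_of_nonzero' w hw).1 h1 ⟨v, hv⟩
  refine ⟨c, ?_⟩
  have h := congrArg Subtype.val hc
  exact h.symm.trans (congrArg (c • ·) hw₀)

variable [IsManifold (𝓡 (2 * n)) ∞ M]

theorem _root_.IsBoothbyWang.isLeafSubmersion {σ : SasakianStructure n S} {κ : KahlerStructure n M}
    {p : S → M} (h : IsBoothbyWang σ κ p) : IsLeafSubmersion σ p :=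
  ⟨h.smooth, h.surjective, h.submersion, h.fibre⟩

/-- A chart of the base, composed with the submersion, is transverse to the Reeb foliation. -/
theorem isTransverseAt_comp (hp : IsLeafSubmersion σ p) (x : S) :
    σ.IsTransverseAt (extChartAt (𝓡 (2 * n)) (p x) ∘ p) x := by
  have hev : ∀ᶠ y in 𝓝 x, p y ∈ (extChartAt (𝓡 (2 * n)) (p x)).source :=
    hp.smooth.continuous.continuousAt.eventually (extChartAt_source_mem_nhds (I := 𝓡 (2 * n)) (p x))
  have hsm : ∀ y, p y ∈ (extChartAt (𝓡 (2 * n)) (p x)).source →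
      ContMDiffAt (𝓡 (2 * n)) (𝓡 (2 * n)) ∞ (extChartAt (𝓡 (2 * n)) (p x)) (p y) := fun y hy =>
    contMDiffAt_extChartAt' (by rwa [extChartAt_source] at hy)
  have hd : ∀ y, p y ∈ (extChartAt (𝓡 (2 * n)) (p x)).source →
      ∀ v : TangentSpace (𝓡 (2 * n + 1)) y, vderiv (extChartAt (𝓡 (2 * n)) (p x) ∘ p) y v =
        vderiv (extChartAt (𝓡 (2 * n)) (p x)) (p y)
          (mfderiv (𝓡 (2 * n + 1)) (𝓡 (2 * n)) p y v) := fun y hy v =>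
    vderiv_comp ((hsm y hy).mdifferentiableAt (by simp)) (hp.mdifferentiableAt y) v
  refine ⟨hev.mono fun y hy => (hsm y hy).comp y (hp.smooth y), hev.mono fun y hy => ?_,
    fun v hv => hp.ker ?_⟩
  · rw [hd y hy, hp.mfderiv_ξ, map_zero]
  · have hx := mem_extChartAt_source (I := 𝓡 (2 * n)) (p x)
    rw [hd x hx] at hv
    exact (isInvertible_mfderiv_extChartAt hx).bijective.injective (hv.trans (map_zero _).symm)

theorem hasLeafCharts [T2Space S] (hp : IsLeafSubmersion σ p) : σ.HasLeafCharts :=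
  SasakianStructure.hasLeafCharts_of_isTransverseAt (d := 2 * n) fun x =>
    ⟨_, hp.isTransverseAt_comp x, univ, univ_mem, fun a _ b _ hab =>
      congrArg (extChartAt (𝓡 (2 * n)) (p x)) ((hp.fibre a b).2 hab)⟩

/-- Near `x`, points of the base lift to points of `S`, in a way that depends smoothly on a point
`q` of `S` near `x` and reproduces `q` as the lift of `p q`. -/
theorem exists_local_lift [T2Space S] (hp : IsLeafSubmersion σ p) (x : S) : ∃ F : S → M → S,
    ContMDiffAt ((𝓡 (2 * n + 1)).prod (𝓡 (2 * n))) (𝓡 (2 * n + 1)) ∞ (Function.uncurry F) (x, p x) ∧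
    (∀ᶠ q in 𝓝 x, F q (p q) = q) ∧ ∀ᶠ z : S × M in 𝓝 (x, p x), p (F z.1 z.2) = z.2 := by
  set e := extChartAt (𝓡 (2 * n)) (p x) with he
  have hes : p ⁻¹' e.source ∈ 𝓝 x :=
    hp.smooth.continuous.continuousAt.preimage_mem_nhds
      (extChartAt_source_mem_nhds (I := 𝓡 (2 * n)) (p x))
  obtain ⟨ψ, r, hψ, hx, hsub, hψx, L, hL, htail⟩ :=
    (hp.isTransverseAt_comp x).exists_isLeafChart hes
      fun a _ b _ hab => congrArg e ((hp.fibre a b).2 hab)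
  have hLinj : ∀ u, L u = 0 → u = 0 := by
    intro u hu
    have hxs := mem_extChartAt_source (I := 𝓡 (2 * n)) (p x)
    obtain ⟨w, hw⟩ := (isInvertible_mfderiv_extChartAt hxs).bijective.surjective u
    obtain ⟨v, hv⟩ := hp.submersion x w
    have h : vderiv (e ∘ p) x v = u := by
      refine (vderiv_comp ((contMDiffAt_extChartAt (n := ∞)).mdifferentiableAt (by simp))
        (hp.mdifferentiableAt x) v).trans ?_
      rw [hv]
      exact hw
    rw [← h]
    exact hL v (by rw [h, hu])
  -- in the chart `ψ`, lift points of the base to points with the same first coordinate as `q`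
  set G : S × M → EuclideanSpace ℝ (Fin (2 * n + 1)) := fun z =>
    ψ z.1 0 • headVec (2 * n) + zeroConsL (2 * n) (L (e z.2 - e (p x))) with hG
  have hψs := contMDiffAt_of_mem_maximalAtlas hψ.mem_maximalAtlas hx
  have hGs : ContMDiffAt ((𝓡 (2 * n + 1)).prod (𝓡 (2 * n))) (𝓡 (2 * n + 1)) ∞ G (x, p x) := by
    have h₁ : ContMDiffAt ((𝓡 (2 * n + 1)).prod (𝓡 (2 * n))) 𝓘(ℝ, ℝ) ∞
        (fun z : S × M => ψ z.1 0) (x, p x) :=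
      ((EuclideanSpace.proj 0 :
        EuclideanSpace ℝ (Fin (2 * n + 1)) →L[ℝ] ℝ).contMDiff.contMDiffAt.comp x hψs).comp (x, p x)
          contMDiffAt_fst
    have h₂ : ContMDiffAt ((𝓡 (2 * n + 1)).prod (𝓡 (2 * n))) (𝓡 (2 * n)) ∞
        (fun z : S × M => e z.2 - e (p x)) (x, p x) :=
      ((contMDiffAt_extChartAt (x := p x)).comp (x, p x) contMDiffAt_snd).sub contMDiffAt_const
    exact (h₁.smul contMDiffAt_const).add
      (((zeroConsL (2 * n)).comp L).contMDiff.contMDiffAt.comp (x, p x) h₂)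
  have hG0 : G (x, p x) = 0 := by simp [hG, hψx]
  have hG0t : G (x, p x) ∈ ψ.target := by
    rw [hG0, ← hψx]
    exact ψ.map_source hx
  refine ⟨fun q m => ψ.symm (G (q, m)), ?_, ?_, ?_⟩
  · exact (contMDiffAt_symm_of_mem_maximalAtlas hψ.mem_maximalAtlas hG0t).comp (x, p x) hGs
  · filter_upwards [ψ.open_source.mem_nhds hx] with q hq
    have : G (q, p q) = ψ q := by
      refine Eq.trans ?_ (eq_headVec_add (ψ q)).symm
      rw [htail q hq]
      rfl
    rw [this, ψ.left_inv hq]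
  · have h₁ : ∀ᶠ z in 𝓝 (x, p x), G z ∈ ψ.target :=
      hGs.continuousAt.eventually (ψ.open_target.mem_nhds hG0t)
    have h₂ : ∀ᶠ z : S × M in 𝓝 (x, p x), z.2 ∈ e.source :=
      continuousAt_snd.eventually (extChartAt_source_mem_nhds (I := 𝓡 (2 * n)) (p x))
    filter_upwards [h₁, h₂] with z hz hz₂
    have hy := ψ.map_target hz
    have h₃ := htail _ hy
    rw [ψ.right_inv hz, hG] at h₃
    simp only [map_add, map_smul, tailL_headVec, smul_zero, zero_add, tailL_zeroConsL] at h₃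
    rw [← sub_eq_zero, ← map_sub] at h₃
    have h₄ := hLinj _ h₃
    have h₅ : e z.2 = e (p (ψ.symm (G z))) := sub_left_injective (sub_eq_zero.1 h₄)
    exact e.injOn (hsub hy) hz₂ h₅.symm

/-- Local sections through every point. -/
theorem exists_local_section [T2Space S] (hp : IsLeafSubmersion σ p) (x : S) : ∃ s : M → S,
    ContMDiffAt (𝓡 (2 * n)) (𝓡 (2 * n + 1)) ∞ s (p x) ∧ s (p x) = x ∧
    ∀ᶠ m in 𝓝 (p x), p (s m) = m := by
  obtain ⟨F, hF, h₁, h₂⟩ := hp.exists_local_lift x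
  refine ⟨F x, hF.comp (p x) (contMDiffAt_const.prodMk contMDiffAt_id), h₁.self_of_nhds, ?_⟩
  exact (Continuous.prodMk_right x).continuousAt.eventually h₂

/-- Vector fields on the base lift to vector fields on `S`. -/
theorem exists_lift_field [T2Space S] (hp : IsLeafSubmersion σ p) {x : S}
    {X : ∀ m : M, TangentSpace (𝓡 (2 * n)) m} (hX : SmoothFieldAt X (p x)) :
    ∃ X' : ∀ q : S, TangentSpace (𝓡 (2 * n + 1)) q, SmoothFieldAt X' x ∧
      ∀ᶠ q in 𝓝 x, mfderiv (𝓡 (2 * n + 1)) (𝓡 (2 * n)) p q (X' q) = X (p q) := by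
  obtain ⟨F, hF, h₁, h₂⟩ := hp.exists_local_lift x
  let X' : ∀ q : S, TangentSpace (𝓡 (2 * n + 1)) q := fun q =>
    mfderiv (𝓡 (2 * n)) (𝓡 (2 * n + 1)) (F q) (p q) (X (p q))
  have hcast : ∀ (y z : S) (v : EuclideanSpace ℝ (Fin (2 * n + 1))), y = z →
      (⟨y, v⟩ : TangentBundle (𝓡 (2 * n + 1)) S) = ⟨z, v⟩ := by
    rintro y z v rfl
    rfl
  refine ⟨X', ?_, ?_⟩
  · have h := contMDiffAt_mfderiv_apply (I₁ := 𝓡 (2 * n + 1)) (I₂ := 𝓡 (2 * n))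
      (I₃ := 𝓡 (2 * n + 1)) (n := ∞) (m := ∞) le_rfl F (g := p) (v := fun q => X (p q)) (x := x) hF
      (ContMDiffAt.comp x (g := fun m => (⟨m, X m⟩ : TangentBundle (𝓡 (2 * n)) M)) hX (hp.smooth x))
      (by simp)
    exact h.congr_of_eventuallyEq (h₁.mono fun q hq => hcast _ _ _ hq.symm)
  · have hpc : ContinuousAt (fun q => (q, p q)) x :=
      continuousAt_id.prodMk hp.smooth.continuous.continuousAt
    have hF1 : ∀ᶠ z in 𝓝 (x, p x), ContMDiffAt ((𝓡 (2 * n + 1)).prod (𝓡 (2 * n)))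
        (𝓡 (2 * n + 1)) 1 (Function.uncurry F) z := by
      have : IsManifold (𝓡 (2 * n + 1)) 1 S := IsManifold.of_le (n := ∞) (by simp)
      have : IsManifold (𝓡 (2 * n)) 1 M := IsManifold.of_le (n := ∞) (by simp)
      exact (contMDiffAt_iff_contMDiffAt_nhds (by simp)).1 (hF.of_le (by simp))
    filter_upwards [h₁, hpc.eventually (eventually_eventually_nhds.2 h₂), hpc.eventually hF1]
      with q hq hq₂ hqF
    have hFd : MDifferentiableAt (𝓡 (2 * n)) (𝓡 (2 * n + 1)) (F q) (p q) :=
      (hqF.comp (p q) (contMDiffAt_const.prodMk contMDiffAt_id)).mdifferentiableAt one_ne_zero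
    have hid : p ∘ F q =ᶠ[𝓝 (p q)] id :=
      (Continuous.prodMk_right q).continuousAt.eventually hq₂
    have hder : HasMFDerivAt (𝓡 (2 * n)) (𝓡 (2 * n)) (p ∘ F q) (p q)
        ((mfderiv (𝓡 (2 * n + 1)) (𝓡 (2 * n)) p (F q (p q))).comp
          (mfderiv (𝓡 (2 * n)) (𝓡 (2 * n + 1)) (F q) (p q))) :=
      (hp.mdifferentiableAt (F q (p q))).hasMFDerivAt.comp (p q) hFd.hasMFDerivAt
    have hder' := (hasMFDerivAt_id (I := 𝓡 (2 * n)) (p q)).congr_of_eventuallyEq hid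
    have h₃ := congrArg (fun T : EuclideanSpace ℝ (Fin (2 * n)) →L[ℝ]
      EuclideanSpace ℝ (Fin (2 * n)) => T (X (p q))) (hasMFDerivAt_unique hder hder')
    have h₄ : ∀ z (v : EuclideanSpace ℝ (Fin (2 * n + 1))), z = q →
        baseDeriv n p q v = baseDeriv n p z v := by
      rintro z v rfl
      rfl
    exact (h₄ _ _ hq).trans h₃

/-- Tangent vectors at points of one leaf that have the same image in the base have images under
`φ` with the same property, and the metric agrees on these images. -/
theorem transverse_invariance [T2Space S] (hp : IsLeafSubmersion σ p) {x y : S} (hxy : p x = p y)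
    {v w : TangentSpace (𝓡 (2 * n + 1)) x} {v' w' : TangentSpace (𝓡 (2 * n + 1)) y}
    (hv : baseDeriv n p x v = baseDeriv n p y v') (hw : baseDeriv n p x w = baseDeriv n p y w') :
    baseDeriv n p x (σ.φ x v) = baseDeriv n p y (σ.φ y v') ∧
      σ.g.inner x (σ.φ x v) (σ.φ x w) = σ.g.inner y (σ.φ y v') (σ.φ y w') := by
  have key := hp.hasLeafCharts.leaf_induction (P := fun x y =>
    ∀ (v w : TangentSpace (𝓡 (2 * n + 1)) x) (v' w' : TangentSpace (𝓡 (2 * n + 1)) y),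
      baseDeriv n p x v = baseDeriv n p y v' → baseDeriv n p x w = baseDeriv n p y w' →
      baseDeriv n p x (σ.φ x v) = baseDeriv n p y (σ.φ y v') ∧
      σ.g.inner x (σ.φ x v) (σ.φ x w) = σ.g.inner y (σ.φ y v') (σ.φ y w')) ?_ ?_
      ((hp.fibre x y).1 hxy)
  · exact key v w v' w' hv hw
  · intro x y z hxy hyz v w v' w' hv hw
    obtain ⟨a, ha⟩ := hp.exists_baseDeriv_eq y (baseDeriv n p x v)
    obtain ⟨b, hb⟩ := hp.exists_baseDeriv_eq y (baseDeriv n p x w)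
    obtain ⟨h₁, h₂⟩ := hxy v w a b ha.symm hb.symm
    obtain ⟨h₃, h₄⟩ := hyz a b v' w' (ha.trans hv) (hb.trans hw)
    exact ⟨h₁.trans h₃, h₂.trans h₄⟩
  · intro ψ r hψ x hx y hy hxy v w v' w' hv hw
    have hat := hψ.mem_maximalAtlas
    set Y : S → EuclideanSpace ℝ (Fin (2 * n)) := fun q => tailL (2 * n) (ψ q) with hY
    obtain ⟨s, hs, hsx, hps⟩ := hp.exists_local_section x
    have hpxy : p y = p x := ((hp.fibre x y).2 hxy).symm
    have hev : ∀ᶠ m in 𝓝 (p x), s m ∈ ψ.source ∧ p (s m) = m :=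
      (hs.continuousAt.eventually (by rw [hsx]; exact ψ.open_source.mem_nhds hx)).and hps
    -- the map induced by `Y` on the base
    have hχ : MDifferentiableAt (𝓡 (2 * n)) 𝓘(ℝ, EuclideanSpace ℝ (Fin (2 * n))) (Y ∘ s) (p x) := by
      refine ContMDiffAt.mdifferentiableAt (n := ∞) ?_ (by simp)
      refine ContMDiffAt.comp (p x) ?_ hs
      rw [hsx]
      exact contMDiffAt_tailL hat hx
    obtain ⟨D, hD⟩ : ∃ D : EuclideanSpace ℝ (Fin (2 * n)) →L[ℝ] EuclideanSpace ℝ (Fin (2 * n)),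
        ∀ z ∈ ψ.source, p z = p x → ∀ v : TangentSpace (𝓡 (2 * n + 1)) z,
          vderiv Y z v = D (baseDeriv n p z v) := by
      refine ⟨vderiv (Y ∘ s) (p x), fun z hz hzx v => ?_⟩
      have h₁ : Y =ᶠ[𝓝 z] (Y ∘ s) ∘ p := by
        have hc : Tendsto p (𝓝 z) (𝓝 (p x)) := hzx ▸ hp.smooth.continuous.tendsto z
        filter_upwards [hc.eventually hev, ψ.open_source.mem_nhds hz] with q hq hqs
        exact (hψ.tailL_eq_iff q hqs _ hq.1).2 ((hp.fibre _ _).1 hq.2.symm)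
      have h₂ : ∀ m, p z = m →
          MDifferentiableAt (𝓡 (2 * n)) 𝓘(ℝ, EuclideanSpace ℝ (Fin (2 * n))) (Y ∘ s) m →
          vderiv ((Y ∘ s) ∘ p) z v = (vderiv (Y ∘ s) m :
            EuclideanSpace ℝ (Fin (2 * n)) →L[ℝ] EuclideanSpace ℝ (Fin (2 * n)))
              (baseDeriv n p z v) := by
        rintro m rfl hm
        exact vderiv_comp hm (hp.mdifferentiableAt z) v
      rw [vderiv_congr h₁]
      exact h₂ _ hzx hχ
    have hDinj : ∀ u, D u = 0 → u = 0 := by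
      intro u hu
      obtain ⟨a, rfl⟩ := hp.exists_baseDeriv_eq x u
      rw [← hD x hx rfl] at hu
      obtain ⟨c, rfl⟩ := (hψ.isTransverseAt hx).ker a hu
      rw [map_smul, show baseDeriv n p x (σ.ξ x) = 0 from hp.mfderiv_ξ x, smul_zero]
    obtain ⟨h₁, h₂⟩ := hψ.transverse_invariance hx hy hxy (v := v) (w := w) (v' := v') (w' := w')
      (((hD x hx rfl v).trans (congrArg D hv)).trans (hD y hy hpxy v').symm)
      (((hD x hx rfl w).trans (congrArg D hw)).trans (hD y hy hpxy w').symm)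
    refine ⟨sub_eq_zero.1 (hDinj _ ?_), h₂⟩
    rw [map_sub, ← hD x hx rfl, ← hD y hy hpxy]
    exact sub_eq_zero.2 h₁

end IsLeafSubmersion

end LeafSubmersion

/-! ### The leaf space of a compact manifold is Hausdorff -/

section LeafSpace

open Set Filter Topology

variable {n : ℕ} {S : Type*} [TopologicalSpace S]
  [ChartedSpace (EuclideanSpace ℝ (Fin (2 * n + 1))) S] [IsManifold (𝓡 (2 * n + 1)) ∞ S]

namespace SasakianStructure

variable {σ : SasakianStructure n S}

/-- Leaves are closed: a leaf chart meets a leaf in at most one plaque. -/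
theorem HasLeafCharts.isClosed_leaf [T2Space S] (hσ : σ.HasLeafCharts) (x : S) :
    IsClosed {y | σ.SameLeaf x y} := by
  rw [← isOpen_compl_iff, isOpen_iff_mem_nhds]
  intro y hy
  obtain ⟨ψ, r, hψ, hys, -, -⟩ := hσ y univ univ_mem
  by_cases hex : ∃ z ∈ ψ.source, σ.SameLeaf x z
  · obtain ⟨z, hz, hxz⟩ := hex
    have hne : tailL (2 * n) (ψ y) ≠ tailL (2 * n) (ψ z) := fun h =>
      hy (hxz.trans ((hψ.tailL_eq_iff _ hys _ hz).1 h).symm)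
    have hc : ContinuousAt (fun y => tailL (2 * n) (ψ y)) y :=
      (tailL (2 * n)).continuous.continuousAt.comp (ψ.continuousAt hys)
    filter_upwards [hc.eventually_ne hne, ψ.open_source.mem_nhds hys] with w hw hws hxw
    exact hw ((hψ.tailL_eq_iff _ hws _ hz).2 (SameLeaf.trans (SameLeaf.symm hxw) hxz))
  · filter_upwards [ψ.open_source.mem_nhds hys] with w hws hxw
    exact hex ⟨w, hws, hxw⟩

/-- On a compact manifold, the relation of lying on the same leaf is closed. Otherwise some leaves
through points near `x` would leave a neighbourhood of the leaf of `x`; in the limit they would meet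
its boundary in a point `z` outside the leaf of `x`, although the leaf chart around a point of the
leaf of `x` that contains `z` separates the leaf of `z` from the leaves near that of `x`. -/
theorem HasLeafCharts.eventually_not_sameLeaf [T2Space S] [CompactSpace S] (hσ : σ.HasLeafCharts)
    {x y : S} (hxy : ¬ σ.SameLeaf x y) : ∀ᶠ z : S × S in 𝓝 (x, y), ¬ σ.SameLeaf z.1 z.2 := by
  have hL := hσ.isClosed_leaf x
  have hLy : {z | σ.SameLeaf x z} ⊆ {y}ᶜ := by
    rintro z hz rfl
    exact hxy hz
  -- the union of the leaf charts around the leaf of `x`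
  set W : Set S := ⋃₀ {U | ∃ ψ r, σ.IsLeafChart ψ r ∧ U = ψ.source ∧
    ∃ q ∈ ψ.source, σ.SameLeaf x q} with hW
  have hWo : IsOpen W := by
    refine isOpen_sUnion ?_
    rintro U ⟨ψ, r, -, rfl, -⟩
    exact ψ.open_source
  have hLW : {z | σ.SameLeaf x z} ⊆ W := by
    intro z hz
    obtain ⟨ψ, r, hψ, hzs, -, -⟩ := hσ z univ univ_mem
    exact ⟨_, ⟨ψ, r, hψ, rfl, z, hzs, hz⟩, hzs⟩
  obtain ⟨O, hO, hLO, hOsub⟩ := normal_exists_closure_subset hL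
    (hWo.inter (isOpen_compl_singleton (x := y))) (subset_inter hLW hLy)
  -- the leaves near that of `x` miss the boundary of `O`, by compactness of the boundary
  have hfr : ∀ᶠ a in 𝓝 x, ∀ z ∈ frontier O, ¬ σ.SameLeaf a z := by
    refine isClosed_frontier.isCompact.eventually_forall_of_forall_eventually ?_
    intro z hz
    obtain ⟨-, ⟨ψ, r, hψ, rfl, q, hq, hxq⟩, hzs⟩ := (hOsub (frontier_subset_closure hz)).1
    have hxz : ¬ σ.SameLeaf x z := fun h =>
      (hO.frontier_eq ▸ hz : z ∈ closure O \ O).2 (hLO h)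
    obtain ⟨h, rfl, hh, hleaf⟩ := hσ.isLeafShift hxq
    have hc := hh.self_of_nhds.continuousAt
    have hne : tailL (2 * n) (ψ (h x)) ≠ tailL (2 * n) (ψ z) := fun he =>
      hxz (hxq.trans ((hψ.tailL_eq_iff _ hq _ hzs).1 he))
    have h₀ : ContinuousAt (fun w : S => tailL (2 * n) (ψ (h w))) x :=
      (tailL (2 * n)).continuous.continuousAt.comp (ContinuousAt.comp (ψ.continuousAt hq) hc)
    have h₁ : ContinuousAt (fun w : S × S => tailL (2 * n) (ψ (h w.1))) (x, z) :=
      ContinuousAt.comp (x := (x, z)) (f := Prod.fst) (g := fun w => tailL (2 * n) (ψ (h w))) h₀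
        continuousAt_fst
    have h₂ : ContinuousAt (fun w : S × S => tailL (2 * n) (ψ w.2)) (x, z) :=
      ContinuousAt.comp (x := (x, z)) (f := Prod.snd) (g := fun w => tailL (2 * n) (ψ w))
        ((tailL (2 * n)).continuous.continuousAt.comp (ψ.continuousAt hzs)) continuousAt_snd
    have h₃ : ∀ᶠ w : S × S in 𝓝 (x, z), tailL (2 * n) (ψ (h w.1)) ≠ tailL (2 * n) (ψ w.2) :=
      (h₁.ne_iff_eventually_ne h₂).1 hne
    have h₄ : ∀ᶠ w : S × S in 𝓝 (x, z), σ.SameLeaf w.1 (h w.1) ∧ h w.1 ∈ ψ.source :=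
      (continuousAt_fst (p := (x, z))).eventually
        (hleaf.and (hc.eventually (ψ.open_source.mem_nhds hq)))
    have h₅ : ∀ᶠ w : S × S in 𝓝 (x, z), w.2 ∈ ψ.source :=
      (continuousAt_snd (p := (x, z))).eventually (ψ.open_source.mem_nhds hzs)
    filter_upwards [h₃, h₄, h₅] with w h₃ h₄ h₅ hw
    exact h₃ ((hψ.tailL_eq_iff _ h₄.2 _ h₅).2 (SameLeaf.trans (SameLeaf.symm h₄.1) hw))
  have hxO : ∀ᶠ a in 𝓝 x, a ∈ O := hO.mem_nhds (hLO (SameLeaf.refl σ x))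
  have hyO : ∀ᶠ b in 𝓝 y, b ∈ (closure O)ᶜ :=
    isClosed_closure.isOpen_compl.mem_nhds fun h => (hOsub h).2 rfl
  filter_upwards [(continuousAt_fst (p := (x, y))).eventually (hfr.and hxO),
    (continuousAt_snd (p := (x, y))).eventually hyO] with w h₁ h₂ hw
  -- a leaf that enters and leaves `O` meets the boundary of `O`
  obtain ⟨γ, a, b, hγ, ha, hb⟩ := hw
  have hconn : IsPreconnected (γ '' uIcc a b) :=
    isPreconnected_uIcc.image _ fun t ht => (hγ t ht).continuousWithinAt
  obtain ⟨z, -, hzO, hz⟩ := hconn O (closure O)ᶜ hO isClosed_closure.isOpen_compl (by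
    rintro _ ⟨t, ht, rfl⟩
    by_contra hz
    rw [mem_union, not_or, mem_compl_iff, not_not] at hz
    refine h₁.1 _ ?_ (ha ▸ SameLeaf.of_curve hγ left_mem_uIcc ht)
    rw [hO.frontier_eq]
    exact ⟨hz.2, hz.1⟩)
    ⟨γ a, ⟨a, left_mem_uIcc, rfl⟩, ha ▸ h₁.2⟩ ⟨γ b, ⟨b, right_mem_uIcc, rfl⟩, hb ▸ h₂⟩
  exact hz (subset_closure hzO)

end SasakianStructure

end LeafSpace

/-! ### The leaf space as a manifold -/

section LeafSpaceCharts

open Set Filter Topology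

variable {n : ℕ} {S : Type*} [TopologicalSpace S]
  [ChartedSpace (EuclideanSpace ℝ (Fin (2 * n + 1))) S] [IsManifold (𝓡 (2 * n + 1)) ∞ S]
  {M : Type*} [TopologicalSpace M]

/-- `p` exhibits the topological space `M` as the space of leaves. -/
structure IsLeafQuotient (σ : SasakianStructure n S) (p : S → M) : Prop where
  isOpenQuotientMap : IsOpenQuotientMap p
  fibre : ∀ x y, p x = p y ↔ σ.SameLeaf x y

namespace IsLeafQuotient

variable {σ : SasakianStructure n S} {p : S → M}
  {ψ ψ' : OpenPartialHomeomorph S (EuclideanSpace ℝ (Fin (2 * n + 1)))} {r r' : ℝ}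

theorem zeroConsL_mem_target (hψ : σ.IsLeafChart ψ r) {u : EuclideanSpace ℝ (Fin (2 * n))}
    (hu : u ∈ Metric.ball 0 r) : zeroConsL (2 * n) u ∈ ψ.target := by
  rw [hψ.target_eq, mem_ball_zero_iff, norm_zeroConsL]
  exact mem_ball_zero_iff.1 hu

theorem tailL_mem_ball (hψ : σ.IsLeafChart ψ r) {q : S} (hq : q ∈ ψ.source) :
    tailL (2 * n) (ψ q) ∈ Metric.ball 0 r := by
  have h := ψ.map_source hq
  rw [hψ.target_eq, mem_ball_zero_iff] at h
  exact mem_ball_zero_iff.2 ((norm_tailL_le _).trans_lt h)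

theorem contMDiffAt_symm_zeroConsL (hψ : σ.IsLeafChart ψ r) {u : EuclideanSpace ℝ (Fin (2 * n))}
    (hu : u ∈ Metric.ball 0 r) : ContMDiffAt (𝓡 (2 * n)) (𝓡 (2 * n + 1)) ∞
      (fun u => ψ.symm (zeroConsL (2 * n) u)) u :=
  (contMDiffAt_symm_of_mem_maximalAtlas hψ.mem_maximalAtlas (zeroConsL_mem_target hψ hu)).comp u
    (zeroConsL (2 * n)).contMDiff.contMDiffAt

theorem symm_zeroConsL (hp : IsLeafQuotient σ p) (hψ : σ.IsLeafChart ψ r) {q : S}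
    (hq : q ∈ ψ.source) : p (ψ.symm (zeroConsL (2 * n) (tailL (2 * n) (ψ q)))) = p q := by
  have h := zeroConsL_mem_target hψ (tailL_mem_ball hψ hq)
  rw [hp.fibre, ← hψ.tailL_eq_iff _ (ψ.map_target h) _ hq, ψ.right_inv h, tailL_zeroConsL]

variable [Nonempty S]

theorem tailL_invFunOn (hp : IsLeafQuotient σ p) (hψ : σ.IsLeafChart ψ r) {q : S}
    (hq : q ∈ ψ.source) :
    tailL (2 * n) (ψ (Function.invFunOn p ψ.source (p q))) = tailL (2 * n) (ψ q) := by
  have hex : ∃ a ∈ ψ.source, p a = p q := ⟨q, hq, rfl⟩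
  exact (hψ.tailL_eq_iff _ (Function.invFunOn_mem hex) _ hq).2
    ((hp.fibre _ _).1 (Function.invFunOn_eq hex))

/-- The chart of the leaf space induced by a leaf chart: the leaf of a point is sent to the last
`2n` coordinates of the point. -/
noncomputable def baseChart (hp : IsLeafQuotient σ p) (hψ : σ.IsLeafChart ψ r) :
    OpenPartialHomeomorph M (EuclideanSpace ℝ (Fin (2 * n))) where
  toFun m := tailL (2 * n) (ψ (Function.invFunOn p ψ.source m))
  invFun u := p (ψ.symm (zeroConsL (2 * n) u))
  source := p '' ψ.source
  target := Metric.ball 0 r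
  map_source' := by
    rintro _ ⟨q, hq, rfl⟩
    rw [hp.tailL_invFunOn hψ hq]
    exact tailL_mem_ball hψ hq
  map_target' u hu := ⟨_, ψ.map_target (zeroConsL_mem_target hψ hu), rfl⟩
  left_inv' := by
    rintro _ ⟨q, hq, rfl⟩
    rw [hp.tailL_invFunOn hψ hq, hp.symm_zeroConsL hψ hq]
  right_inv' u hu := by
    have h := zeroConsL_mem_target hψ hu
    rw [hp.tailL_invFunOn hψ (ψ.map_target h), ψ.right_inv h, tailL_zeroConsL]
  open_source := hp.isOpenQuotientMap.isOpenMap _ ψ.open_source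
  open_target := Metric.isOpen_ball
  continuousOn_toFun := by
    rintro _ ⟨q, hq, rfl⟩
    refine ContinuousAt.continuousWithinAt ?_
    have hc : ContinuousAt (fun q => tailL (2 * n) (ψ q)) q :=
      (tailL (2 * n)).continuous.continuousAt.comp (ψ.continuousAt hq)
    refine (Filter.Tendsto.mono_left ?_ (hp.isOpenQuotientMap.isOpenMap.nhds_le q))
    rw [tendsto_map'_iff]
    refine Tendsto.congr' ?_
      (hc.tendsto.trans (le_of_eq (congrArg 𝓝 (hp.tailL_invFunOn hψ hq).symm)))
    filter_upwards [ψ.open_source.mem_nhds hq] with y hy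
    exact (hp.tailL_invFunOn hψ hy).symm
  continuousOn_invFun := by
    refine hp.isOpenQuotientMap.continuous.comp_continuousOn (ψ.continuousOn_symm.comp
      (zeroConsL (2 * n)).continuous.continuousOn fun u hu => zeroConsL_mem_target hψ hu)

theorem baseChart_apply (hp : IsLeafQuotient σ p) (hψ : σ.IsLeafChart ψ r) {q : S}
    (hq : q ∈ ψ.source) : hp.baseChart hψ (p q) = tailL (2 * n) (ψ q) :=
  hp.tailL_invFunOn hψ hq

/-- In terms of a chart of the leaf space, the projection of a smooth map to `S` is smooth, since
the map can be shifted along the leaves into the leaf chart. -/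
theorem contMDiffAt_baseChart_comp [T2Space S] (hσ : σ.HasLeafCharts) (hp : IsLeafQuotient σ p)
    (hψ : σ.IsLeafChart ψ r) {k : ℕ} {N : Type*} [TopologicalSpace N]
    [ChartedSpace (EuclideanSpace ℝ (Fin k)) N] {h : N → S} {z : N}
    (hh : ContMDiffAt (𝓡 k) (𝓡 (2 * n + 1)) ∞ h z) (hz : p (h z) ∈ (hp.baseChart hψ).source) :
    ContMDiffAt (𝓡 k) (𝓡 (2 * n)) ∞ (fun y => hp.baseChart hψ (p (h y))) z := by
  obtain ⟨b, hb, hbz⟩ := hz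
  obtain ⟨f, hf, hfs, hleaf⟩ := hσ.isLeafShift ((hp.fibre _ _).1 hbz.symm)
  subst hf
  have h₁ : ContMDiffAt (𝓡 k) (𝓡 (2 * n)) ∞ (fun y => tailL (2 * n) (ψ (f (h y)))) z :=
    (ContMDiffAt.comp (h z) (contMDiffAt_tailL hψ.mem_maximalAtlas hb)
      hfs.self_of_nhds).comp z hh
  refine h₁.congr_of_eventuallyEq ?_
  have hc := hh.continuousAt
  have hev : ∀ᶠ w in 𝓝 (h z), f w ∈ ψ.source :=
    hfs.self_of_nhds.continuousAt.eventually (ψ.open_source.mem_nhds hb)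
  filter_upwards [hc.eventually hev, hc.eventually hleaf] with y h₁ h₂
  rw [(hp.fibre _ _).2 h₂, hp.baseChart_apply hψ h₁]

/-- The smooth atlas of the leaf space. -/
noncomputable abbrev chartedSpace (hσ : σ.HasLeafCharts) (hp : IsLeafQuotient σ p) :
    ChartedSpace (EuclideanSpace ℝ (Fin (2 * n))) M where
  atlas := {e | ∃ ψ r, ∃ hψ : σ.IsLeafChart ψ r, e = hp.baseChart hψ}
  chartAt m := hp.baseChart
    (hσ (Function.invFun p m) univ univ_mem).choose_spec.choose_spec.1
  mem_chart_source m := ⟨_, (hσ (Function.invFun p m) univ univ_mem).choose_spec.choose_spec.2.1,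
    Function.rightInverse_invFun hp.isOpenQuotientMap.surjective m⟩
  chart_mem_atlas _ := ⟨_, _, _, rfl⟩

/-- The coordinate changes of the leaf space are smooth: they are projections of local sections. -/
theorem isManifold [T2Space S] (hσ : σ.HasLeafCharts) (hp : IsLeafQuotient σ p) :
    letI := hp.chartedSpace hσ
    IsManifold (𝓡 (2 * n)) ∞ M := by
  let := hp.chartedSpace hσ
  refine isManifold_of_contDiffOn _ _ _ ?_
  rintro _ _ ⟨ψ, r, hψ, rfl⟩ ⟨ψ', r', hψ', rfl⟩ u hu
  refine ContDiffAt.contDiffWithinAt ?_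
  have hu₁ : u ∈ Metric.ball 0 r := hu.1.1
  have hu₂ : p (ψ.symm (zeroConsL (2 * n) u)) ∈ (hp.baseChart hψ').source := hu.1.2
  exact (hp.contMDiffAt_baseChart_comp hσ hψ' (contMDiffAt_symm_zeroConsL hψ hu₁) hu₂).contDiffAt

theorem isLeafSubmersion [T2Space S] (hσ : σ.HasLeafCharts) (hp : IsLeafQuotient σ p) :
    letI := hp.chartedSpace hσ
    IsLeafSubmersion σ p := by
  let := hp.chartedSpace hσ
  have := hp.isManifold hσ
  have hsmooth : ContMDiff (𝓡 (2 * n + 1)) (𝓡 (2 * n)) ∞ p := by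
    intro x
    obtain ⟨ψ, r, hψ, he⟩ := chart_mem_atlas (EuclideanSpace ℝ (Fin (2 * n))) (p x)
    refine contMDiffAt_iff_target.2 ⟨hp.isOpenQuotientMap.continuous.continuousAt, ?_⟩
    have hx : p x ∈ (hp.baseChart hψ).source := he ▸ mem_chart_source _ (p x)
    have h := hp.contMDiffAt_baseChart_comp hσ hψ (contMDiffAt_id (I := 𝓡 (2 * n + 1))) hx
    refine h.congr_of_eventuallyEq (Eventually.of_forall fun y => ?_)
    simp only [Function.comp_apply, extChartAt, he]
    rfl
  refine ⟨hsmooth, hp.isOpenQuotientMap.surjective, fun x => ?_, hp.fibre⟩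
  -- the differential has a right inverse, the differential of a local section
  obtain ⟨ψ, r, hψ, he⟩ := chart_mem_atlas (EuclideanSpace ℝ (Fin (2 * n))) (p x)
  have hx : p x ∈ (hp.baseChart hψ).source := he ▸ mem_chart_source _ (p x)
  have hball := (hp.baseChart hψ).map_source hx
  have hχ : ContMDiffAt (𝓡 (2 * n)) (𝓡 (2 * n)) ∞ (hp.baseChart hψ) (p x) :=
    he ▸ contMDiffAt_of_mem_maximalAtlas (IsManifold.chart_mem_maximalAtlas (p x))
      (mem_chart_source _ (p x))
  set c : M → S := fun m => ψ.symm (zeroConsL (2 * n) (hp.baseChart hψ m)) with hc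
  have hcs : ContMDiffAt (𝓡 (2 * n)) (𝓡 (2 * n + 1)) ∞ c (p x) :=
    (contMDiffAt_symm_zeroConsL hψ hball).comp (p x) hχ
  have hpc : ∀ m ∈ (hp.baseChart hψ).source, p (c m) = m := fun m hm =>
    (hp.baseChart hψ).left_inv hm
  obtain ⟨f, hf, hfs, hleaf⟩ := hσ.isLeafShift ((hp.fibre _ _).1 (hpc _ hx))
  have hs : ContMDiffAt (𝓡 (2 * n)) (𝓡 (2 * n + 1)) ∞ (f ∘ c) (p x) :=
    hfs.self_of_nhds.comp (p x) hcs
  have hid : p ∘ (f ∘ c) =ᶠ[𝓝 (p x)] id := by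
    filter_upwards [hcs.continuousAt.eventually hleaf,
      (hp.baseChart hψ).open_source.mem_nhds hx] with m h₁ h₂
    exact ((hp.fibre _ _).2 h₁).symm.trans (hpc m h₂)
  have hsx : f (c (p x)) = x := hf
  have hpd : MDifferentiableAt (𝓡 (2 * n + 1)) (𝓡 (2 * n)) p ((f ∘ c) (p x)) :=
    hsmooth.mdifferentiableAt (by simp)
  have h₁ := hpd.hasMFDerivAt.comp (p x) (hs.mdifferentiableAt (by simp)).hasMFDerivAt
  have h₂ := (hasMFDerivAt_id (I := 𝓡 (2 * n)) (p x)).congr_of_eventuallyEq hid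
  have h₃ := hasMFDerivAt_unique h₁ h₂
  have key : ∀ y, y = x → ∀ v : EuclideanSpace ℝ (Fin (2 * n + 1)),
      baseDeriv n p y v = baseDeriv n p x v := by
    rintro y rfl v
    rfl
  intro u
  refine ⟨mfderiv (𝓡 (2 * n)) (𝓡 (2 * n + 1)) (f ∘ c) (p x) u, ?_⟩
  refine (key _ hsx _).symm.trans ?_
  exact congrArg (fun T : EuclideanSpace ℝ (Fin (2 * n)) →L[ℝ]
    EuclideanSpace ℝ (Fin (2 * n)) => T u) h₃

end IsLeafQuotient

namespace SasakianStructure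

variable {σ : SasakianStructure n S}

/-- The equivalence relation of lying on the same leaf. -/
def leafSetoid [T2Space S] (σ : SasakianStructure n S) : Setoid S where
  r := σ.SameLeaf
  iseqv := ⟨SameLeaf.refl σ, SameLeaf.symm, SameLeaf.trans⟩

/-- The projection to the quotient by the leaves is open, because points can be moved along leaves
continuously. -/
theorem HasLeafCharts.isLeafQuotient [T2Space S] (hσ : σ.HasLeafCharts) :
    IsLeafQuotient σ (Quotient.mk σ.leafSetoid) where
  isOpenQuotientMap := by
    refine ⟨Quotient.mk_surjective, continuous_quotient_mk', fun U hU => ?_⟩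
    rw [← isQuotientMap_quotient_mk'.isOpen_preimage, isOpen_iff_mem_nhds]
    rintro y ⟨x, hx, hxy⟩
    obtain ⟨h, rfl, hh, hleaf⟩ := hσ.isLeafShift (SameLeaf.symm (Quotient.exact hxy))
    filter_upwards [hleaf, hh.self_of_nhds.continuousAt.eventually (hU.mem_nhds hx)] with z h₁ h₂
    exact ⟨h z, h₂, Quotient.sound h₁.symm⟩
  fibre x y := Quotient.eq (r := σ.leafSetoid)

/-- The leaves of a compact manifold with leaf charts are the fibres of a submersion. -/
theorem HasLeafCharts.exists_isLeafSubmersion.{u} {n : ℕ} {S : Type u} [TopologicalSpace S]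
    [T2Space S] [CompactSpace S] [Nonempty S]
    [ChartedSpace (EuclideanSpace ℝ (Fin (2 * n + 1))) S] [IsManifold (𝓡 (2 * n + 1)) ∞ S]
    {σ : SasakianStructure n S} (hσ : σ.HasLeafCharts) :
    ∃ (M : Type u) (_ : TopologicalSpace M) (_ : T2Space M)
      (_ : ChartedSpace (EuclideanSpace ℝ (Fin (2 * n))) M) (_ : IsManifold (𝓡 (2 * n)) ∞ M)
      (p : S → M), IsLeafSubmersion σ p := by
  have hp := hσ.isLeafQuotient
  refine ⟨Quotient σ.leafSetoid, inferInstance, ?_, hp.chartedSpace hσ, hp.isManifold hσ,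
    Quotient.mk σ.leafSetoid, hp.isLeafSubmersion hσ⟩
  rw [t2Space_iff_of_isOpenQuotientMap hp.isOpenQuotientMap, ← isOpen_compl_iff,
    isOpen_iff_mem_nhds]
  rintro ⟨x, y⟩ hxy
  filter_upwards [hσ.eventually_not_sameLeaf fun h => hxy ((hp.fibre x y).2 h)] with z hz h
  exact hz ((hp.fibre _ _).1 h)

end SasakianStructure

end LeafSpaceCharts

/-! ### Smoothness of fields of linear maps -/

section HomBundle

open Set Filter Topology Bundle

variable {k : ℕ} {M : Type*} [TopologicalSpace M] [ChartedSpace (EuclideanSpace ℝ (Fin k)) M]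
  [IsManifold (𝓡 k) ∞ M]
  {F : Type*} [NormedAddCommGroup F] [NormedSpace ℝ F] {E : M → Type*}
  [∀ x, AddCommGroup (E x)] [∀ x, Module ℝ (E x)] [TopologicalSpace (TotalSpace F E)]
  [∀ x, TopologicalSpace (E x)] [FiberBundle F E] [VectorBundle ℝ F E]
  [∀ x, IsTopologicalAddGroup (E x)] [∀ x, ContinuousSMul ℝ (E x)]

/-- A family of linear maps on a finite-dimensional space is smooth if its values on each vector
are. -/
theorem contMDiffAt_clm_of_apply {F' : Type*} [NormedAddCommGroup F'] [NormedSpace ℝ F']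
    {N : Type*} [TopologicalSpace N] [ChartedSpace (EuclideanSpace ℝ (Fin k)) N]
    {A : N → EuclideanSpace ℝ (Fin k) →L[ℝ] F'} {x : N}
    (h : ∀ c, ContMDiffAt (𝓡 k) 𝓘(ℝ, F') ∞ (fun y => A y c) x) :
    ContMDiffAt (𝓡 k) 𝓘(ℝ, EuclideanSpace ℝ (Fin k) →L[ℝ] F') ∞ A x := by
  have hA : A = fun y => ∑ i : Fin k, ContinuousLinearMap.smulRightL ℝ (EuclideanSpace ℝ (Fin k)) F'
      (EuclideanSpace.proj i) (A y (EuclideanSpace.single i 1)) := by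
    ext1 y
    ext1 c
    rw [sum_apply]
    simp only [ContinuousLinearMap.smulRightL_apply_apply]
    conv_lhs => rw [← (EuclideanSpace.basisFun (Fin k) ℝ).sum_repr c]
    simp
  rw [hA]
  refine ContMDiffAt.sum fun i _ => ?_
  exact (ContinuousLinearMap.smulRightL ℝ (EuclideanSpace ℝ (Fin k)) F'
    (EuclideanSpace.proj i)).contMDiff.contMDiffAt.comp x (h _)

/-- A field of linear maps on the tangent spaces is smooth if it maps smooth vector fields to
smooth sections. -/
theorem contMDiffAt_hom_of_apply {A : ∀ y : M, TangentSpace (𝓡 k) y →L[ℝ] E y} {x : M}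
    (h : ∀ X : ∀ y : M, TangentSpace (𝓡 k) y, SmoothFieldAt X x →
      ContMDiffAt (𝓡 k) ((𝓡 k).prod 𝓘(ℝ, F)) ∞ (fun y => TotalSpace.mk' F y (A y (X y))) x) :
    ContMDiffAt (𝓡 k) ((𝓡 k).prod 𝓘(ℝ, EuclideanSpace ℝ (Fin k) →L[ℝ] F)) ∞
      (fun y => TotalSpace.mk' (EuclideanSpace ℝ (Fin k) →L[ℝ] F)
        (E := fun y : M => TangentSpace (𝓡 k) y →L[ℝ] E y) y (A y)) x := by
  refine (contMDiffAt_hom_bundle _).2 ⟨contMDiffAt_id, contMDiffAt_clm_of_apply fun c => ?_⟩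
  set e := trivializationAt (EuclideanSpace ℝ (Fin k)) (fun y : M => TangentSpace (𝓡 k) y) x with he
  have hxe : x ∈ e.baseSet := mem_baseSet_trivializationAt _ _ x
  have hX : SmoothFieldAt (fun y => e.symmL ℝ y c) x := by
    have h₁ := e.contMDiffOn_symm (IB := 𝓡 k) (n := ∞)
    have h₂ : ContMDiffAt (𝓡 k) ((𝓡 k).prod 𝓘(ℝ, EuclideanSpace ℝ (Fin k))) ∞
        (fun y : M => (y, c)) x := contMDiffAt_id.prodMk contMDiffAt_const
    have h₃ := (h₁.contMDiffAt (e.open_target.mem_nhds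
      (show (x, c) ∈ e.target from e.mem_target.2 hxe))).comp x h₂
    refine h₃.congr_of_eventuallyEq ?_
    filter_upwards [e.open_baseSet.mem_nhds hxe] with y hy
    refine Eq.trans ?_ (e.mk_symm hy c)
    exact congrArg (TotalSpace.mk' _ y) (e.symmL_apply (R := ℝ) hy c)
  have h₄ := (contMDiffAt_totalSpace.1 (h _ hX)).2
  refine h₄.congr_of_eventuallyEq ?_
  filter_upwards [(trivializationAt F E x).open_baseSet.mem_nhds
    (mem_baseSet_trivializationAt F E x)] with y hy
  exact Bundle.Trivialization.continuousLinearMapAt_apply_of_mem (R := ℝ) _ hy _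

end HomBundle

/-! ### Positive definite forms -/

section PositiveDefinite

open Bornology

/-- The unit ball of a positive definite form on a finite-dimensional space is bounded. -/
theorem isVonNBounded_of_posDef {k : ℕ}
    {B : EuclideanSpace ℝ (Fin k) →L[ℝ] EuclideanSpace ℝ (Fin k) →L[ℝ] ℝ}
    (hB : ∀ v, v ≠ 0 → 0 < B v v) : IsVonNBounded ℝ {v | B v v < 1} := by
  rw [NormedSpace.isVonNBounded_iff]
  have hc : Continuous fun v => B v v := B.continuous.clm_apply continuous_id
  rcases (Metric.sphere (0 : EuclideanSpace ℝ (Fin k)) 1).eq_empty_or_nonempty with h | h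
  · refine (Metric.isBounded_closedBall (x := 0) (r := 0)).subset fun v _ => ?_
    by_contra hv
    have hv : v ≠ 0 := by simpa using hv
    have : (‖v‖⁻¹ • v) ∈ Metric.sphere (0 : EuclideanSpace ℝ (Fin k)) 1 := by
      rw [mem_sphere_zero_iff_norm, norm_smul, norm_inv, norm_norm,
        inv_mul_cancel₀ (norm_ne_zero_iff.2 hv)]
    rw [h] at this
    exact this
  · obtain ⟨w, hw, hmin⟩ := (isCompact_sphere 0 1).exists_isMinOn h hc.continuousOn
    have hw0 : w ≠ 0 := by
      rintro rfl
      simp at hw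
    set m := B w w with hm
    have hm0 : 0 < m := hB w hw0
    have hle : ∀ v, m * ‖v‖ ^ 2 ≤ B v v := by
      intro v
      rcases eq_or_ne v 0 with rfl | hv
      · simp
      have hn := norm_ne_zero_iff.2 hv
      have hmem : (‖v‖⁻¹ • v) ∈ Metric.sphere (0 : EuclideanSpace ℝ (Fin k)) 1 := by
        rw [mem_sphere_zero_iff_norm, norm_smul, norm_inv, norm_norm, inv_mul_cancel₀ hn]
      have h₁ : m ≤ B (‖v‖⁻¹ • v) (‖v‖⁻¹ • v) := hmin hmem
      simp only [map_smul, smul_apply, smul_eq_mul] at h₁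
      have h₂ : 0 < ‖v‖ ^ 2 := by positivity
      calc m * ‖v‖ ^ 2 ≤ (‖v‖⁻¹ * (‖v‖⁻¹ * B v v)) * ‖v‖ ^ 2 := by gcongr
        _ = B v v := by field_simp
    refine (Metric.isBounded_closedBall (x := 0) (r := 1 / m + 1)).subset fun v hv => ?_
    rw [mem_closedBall_zero_iff]
    have h₁ : m * ‖v‖ ^ 2 < 1 := (hle v).trans_lt hv
    have h₂ : ‖v‖ ^ 2 < 1 / m := by rwa [lt_div_iff₀' hm0]
    nlinarith [norm_nonneg v, sq_nonneg (‖v‖ - 1)]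

end PositiveDefinite

/-! ### The Kähler structure on the base -/

section KahlerBase

open Set Filter Topology VectorField

variable {n : ℕ} {S : Type*} [TopologicalSpace S] [T2Space S]
  [ChartedSpace (EuclideanSpace ℝ (Fin (2 * n + 1))) S] [IsManifold (𝓡 (2 * n + 1)) ∞ S]
  {M : Type*} [TopologicalSpace M] [ChartedSpace (EuclideanSpace ℝ (Fin (2 * n))) M]
  [IsManifold (𝓡 (2 * n)) ∞ M] {σ : SasakianStructure n S} {p : S → M}

namespace IsLeafSubmersion

/-- The complex structure on the base induced by `φ`. -/
theorem exists_complexStructure (hp : IsLeafSubmersion σ p) :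
    ∃ J : ∀ m : M, TangentSpace (𝓡 (2 * n)) m →L[ℝ] TangentSpace (𝓡 (2 * n)) m,
      ∀ (x : S) (v : TangentSpace (𝓡 (2 * n + 1)) x),
        J (p x) (mfderiv (𝓡 (2 * n + 1)) (𝓡 (2 * n)) p x v) =
          mfderiv (𝓡 (2 * n + 1)) (𝓡 (2 * n)) p x (σ.φ x v) := by
  have hpt : ∀ m : M, ∃ A : EuclideanSpace ℝ (Fin (2 * n)) →L[ℝ] EuclideanSpace ℝ (Fin (2 * n)),
      ∀ x, p x = m → ∀ v : TangentSpace (𝓡 (2 * n + 1)) x,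
        A (baseDeriv n p x v) = baseDeriv n p x (σ.φ x v) := by
    intro m
    obtain ⟨y, rfl⟩ := hp.surjective m
    let D : EuclideanSpace ℝ (Fin (2 * n + 1)) →L[ℝ] EuclideanSpace ℝ (Fin (2 * n)) :=
      baseDeriv n p y
    let Φ : EuclideanSpace ℝ (Fin (2 * n + 1)) →L[ℝ] EuclideanSpace ℝ (Fin (2 * n + 1)) := σ.φ y
    obtain ⟨R, hR⟩ := D.toLinearMap.exists_rightInverse_of_surjective
      (LinearMap.range_eq_top.2 (hp.submersion y))
    refine ⟨(D.comp Φ).comp (LinearMap.toContinuousLinearMap R), fun x hx v => ?_⟩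
    have h : baseDeriv n p y (R (baseDeriv n p x v)) = baseDeriv n p x v :=
      congrArg (fun T => T (baseDeriv n p x v)) hR
    exact (hp.transverse_invariance hx.symm h h).1
  choose A hA using hpt
  exact ⟨fun m => A m, fun x v => hA (p x) x rfl v⟩

/-- The metric on the base induced by the restriction of the metric to the image of `φ`. -/
theorem exists_metric (hp : IsLeafSubmersion σ p) :
    ∃ B : ∀ m : M, TangentSpace (𝓡 (2 * n)) m →L[ℝ] TangentSpace (𝓡 (2 * n)) m →L[ℝ] ℝ,
      ∀ (x : S) (v w : TangentSpace (𝓡 (2 * n + 1)) x),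
        B (p x) (mfderiv (𝓡 (2 * n + 1)) (𝓡 (2 * n)) p x v)
          (mfderiv (𝓡 (2 * n + 1)) (𝓡 (2 * n)) p x w) =
          σ.g.inner x (σ.φ x v) (σ.φ x w) := by
  have hpt : ∀ m : M, ∃ B : EuclideanSpace ℝ (Fin (2 * n)) →L[ℝ]
      EuclideanSpace ℝ (Fin (2 * n)) →L[ℝ] ℝ,
      ∀ x, p x = m → ∀ v w : TangentSpace (𝓡 (2 * n + 1)) x,
        B (baseDeriv n p x v) (baseDeriv n p x w) = σ.g.inner x (σ.φ x v) (σ.φ x w) := by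
    intro m
    obtain ⟨y, rfl⟩ := hp.surjective m
    let D : EuclideanSpace ℝ (Fin (2 * n + 1)) →L[ℝ] EuclideanSpace ℝ (Fin (2 * n)) :=
      baseDeriv n p y
    let Φ : EuclideanSpace ℝ (Fin (2 * n + 1)) →L[ℝ] EuclideanSpace ℝ (Fin (2 * n + 1)) := σ.φ y
    let G : EuclideanSpace ℝ (Fin (2 * n + 1)) →L[ℝ] EuclideanSpace ℝ (Fin (2 * n + 1)) →L[ℝ] ℝ :=
      σ.g.inner y
    obtain ⟨R, hR⟩ := D.toLinearMap.exists_rightInverse_of_surjective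
      (LinearMap.range_eq_top.2 (hp.submersion y))
    refine ⟨G.bilinearComp (Φ.comp (LinearMap.toContinuousLinearMap R))
      (Φ.comp (LinearMap.toContinuousLinearMap R)), fun x hx v w => ?_⟩
    have h : ∀ v, baseDeriv n p y (R (baseDeriv n p x v)) = baseDeriv n p x v := fun v =>
      congrArg (fun T => T (baseDeriv n p x v)) hR
    exact (hp.transverse_invariance hx.symm (h v) (h w)).2
  choose B hB using hpt
  exact ⟨fun m => B m, fun x v w => hB (p x) x rfl v w⟩

/-- Functions on the base are smooth if their lifts are. -/
theorem contMDiffAt_of_comp (hp : IsLeafSubmersion σ p) {E H N : Type*} [NormedAddCommGroup E]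
    [NormedSpace ℝ E] [TopologicalSpace H] {I : ModelWithCorners ℝ E H} [TopologicalSpace N]
    [ChartedSpace H N] {h : M → N} {x : S}
    (hh : ContMDiffAt (𝓡 (2 * n + 1)) I ∞ (h ∘ p) x) : ContMDiffAt (𝓡 (2 * n)) I ∞ h (p x) := by
  obtain ⟨s, hs, hsx, hps⟩ := hp.exists_local_section x
  rw [← hsx] at hh
  have h₁ := ContMDiffAt.comp (p x) hh hs
  exact h₁.congr_of_eventuallyEq (hps.mono fun m hm => (congrArg h hm).symm)

/-- The projection of a smooth vector field, if it is well defined, is smooth. -/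
theorem smoothFieldAt_of_related (hp : IsLeafSubmersion σ p) {x : S}
    {X : ∀ q : S, TangentSpace (𝓡 (2 * n + 1)) q} {Y : ∀ m : M, TangentSpace (𝓡 (2 * n)) m}
    (hX : SmoothFieldAt X x)
    (h : ∀ᶠ q in 𝓝 x, mfderiv (𝓡 (2 * n + 1)) (𝓡 (2 * n)) p q (X q) = Y (p q)) :
    SmoothFieldAt Y (p x) := by
  refine hp.contMDiffAt_of_comp (h := fun m => (⟨m, Y m⟩ : TangentBundle (𝓡 (2 * n)) M)) ?_
  have h₁ := contMDiffAt_mfderiv_apply (I₁ := 𝓡 (2 * n + 1)) (I₂ := 𝓡 (2 * n + 1))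
    (I₃ := 𝓡 (2 * n)) (n := ∞) (m := ∞) le_rfl (fun _ : S => p) (g := id) (v := X) (x := x)
    (ContMDiffAt.comp (x, x) (hp.smooth x) contMDiffAt_snd) hX (by simp)
  refine h₁.congr_of_eventuallyEq (h.mono fun q hq => ?_)
  exact congrArg (fun v => (⟨p q, v⟩ : TangentBundle (𝓡 (2 * n)) M)) hq.symm

/-- The base of a submersion along the leaves is a Kähler manifold: its structure is that of the
transverse geometry of the Reeb foliation. -/
theorem exists_isBoothbyWang (hp : IsLeafSubmersion σ p) :
    ∃ κ : KahlerStructure n M, IsBoothbyWang σ κ p := by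
  obtain ⟨J, hJ⟩ := hp.exists_complexStructure
  obtain ⟨B, hB⟩ := hp.exists_metric
  have hBg : ∀ (x : S) (v w : TangentSpace (𝓡 (2 * n + 1)) x),
      B (p x) (mfderiv (𝓡 (2 * n + 1)) (𝓡 (2 * n)) p x v)
        (mfderiv (𝓡 (2 * n + 1)) (𝓡 (2 * n)) p x w) =
        σ.g.inner x v w - σ.η x v * σ.η x w := fun x v w => (hB x v w).trans (σ.g_φ x v w)
  have hJs : ∀ {m : M} {X : ∀ m : M, TangentSpace (𝓡 (2 * n)) m}, SmoothFieldAt X m →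
      SmoothFieldAt (fun m => J m (X m)) m := by
    intro m X hX
    obtain ⟨x, rfl⟩ := hp.surjective m
    obtain ⟨X', hX', hrel⟩ := hp.exists_lift_field hX
    refine hp.smoothFieldAt_of_related (contMDiffAt_endo_apply (σ.φ_smooth x) hX')
      (hrel.mono fun q hq => ?_)
    rw [← hJ, hq]
  have hBs : ∀ {m : M} {X Y : ∀ m : M, TangentSpace (𝓡 (2 * n)) m}, SmoothFieldAt X m →
      SmoothFieldAt Y m → ContMDiffAt (𝓡 (2 * n)) 𝓘(ℝ, ℝ) ∞ (fun m => B m (X m) (Y m)) m := by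
    intro m X Y hX hY
    obtain ⟨x, rfl⟩ := hp.surjective m
    obtain ⟨X', hX', hXrel⟩ := hp.exists_lift_field hX
    obtain ⟨Y', hY', hYrel⟩ := hp.exists_lift_field hY
    refine hp.contMDiffAt_of_comp ?_
    refine (contMDiffAt_metric_apply σ.g (contMDiffAt_endo_apply (σ.φ_smooth x) hX')
      (contMDiffAt_endo_apply (σ.φ_smooth x) hY')).congr_of_eventuallyEq ?_
    filter_upwards [hXrel, hYrel] with q h₁ h₂
    rw [← hB, h₁, h₂]
    rfl
  have hpos : ∀ (m : M) (u : TangentSpace (𝓡 (2 * n)) m), u ≠ 0 → 0 < B m u u := by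
    intro m u hu
    obtain ⟨x, rfl⟩ := hp.surjective m
    obtain ⟨v, rfl⟩ := hp.submersion x u
    rw [hB]
    refine σ.g.pos x _ fun h => hu ?_
    rw [σ.eq_smul_ξ_of_φ_eq_zero h, map_smul, hp.mfderiv_ξ, smul_zero]
  let g : Bundle.ContMDiffRiemannianMetric (𝓡 (2 * n)) ∞ (EuclideanSpace ℝ (Fin (2 * n)))
      (fun m : M => TangentSpace (𝓡 (2 * n)) m) :=
    { inner := B
      symm := by
        intro m u w
        obtain ⟨x, rfl⟩ := hp.surjective m
        obtain ⟨u, rfl⟩ := hp.submersion x u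
        obtain ⟨w, rfl⟩ := hp.submersion x w
        rw [hB, hB, σ.g.symm]
      pos := hpos
      isVonNBounded := fun m => isVonNBounded_of_posDef (B := B m) (hpos m)
      contMDiff := fun m => contMDiffAt_hom_of_apply
        (E := fun y : M => TangentSpace (𝓡 (2 * n)) y →L[ℝ] Bundle.Trivial M ℝ y) fun X hX =>
          contMDiffAt_hom_of_apply (E := Bundle.Trivial M ℝ) (A := fun m => B m (X m)) fun Y hY =>
            (Bundle.contMDiffAt_section _).2 (hBs hX hY) }
  have hJφ : ∀ {x : S} {X : ∀ m : M, TangentSpace (𝓡 (2 * n)) m}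
      {X' : ∀ q : S, TangentSpace (𝓡 (2 * n + 1)) q},
      (∀ᶠ q in 𝓝 x, mfderiv (𝓡 (2 * n + 1)) (𝓡 (2 * n)) p q (X' q) = X (p q)) →
      ∀ᶠ q in 𝓝 x, mfderiv (𝓡 (2 * n + 1)) (𝓡 (2 * n)) p q (σ.φ q (X' q)) = J (p q) (X (p q)) := by
    intro x X X' h
    filter_upwards [h] with q hq
    rw [← hJ, hq]
  have hbr : ∀ {x : S} {X Y : ∀ m : M, TangentSpace (𝓡 (2 * n)) m}
      {X' Y' : ∀ q : S, TangentSpace (𝓡 (2 * n + 1)) q}, SmoothFieldAt X (p x) →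
      SmoothFieldAt Y (p x) → SmoothFieldAt X' x → SmoothFieldAt Y' x →
      (∀ᶠ q in 𝓝 x, mfderiv (𝓡 (2 * n + 1)) (𝓡 (2 * n)) p q (X' q) = X (p q)) →
      (∀ᶠ q in 𝓝 x, mfderiv (𝓡 (2 * n + 1)) (𝓡 (2 * n)) p q (Y' q) = Y (p q)) →
      mfderiv (𝓡 (2 * n + 1)) (𝓡 (2 * n)) p x (mlieBracket (𝓡 (2 * n + 1)) X' Y' x) =
        mlieBracket (𝓡 (2 * n)) X Y (p x) := by
    intro x X Y X' Y' hX hY hX' hY' hXr hYr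
    exact mfderiv_mlieBracket_of_related ((hp.smooth x).of_le ENat.LEInfty.out)
      (hX'.fieldAt 1).mdifferentiableAt (hY'.fieldAt 1).mdifferentiableAt (hX.fieldAt 1)
      (hY.fieldAt 1) hXr hYr
  -- the fundamental form of the base pulls back to `(v, w) ↦ g(v, φ w)`
  have hΩ : ∀ (x : S) (v w : TangentSpace (𝓡 (2 * n + 1)) x),
      B (p x) (mfderiv (𝓡 (2 * n + 1)) (𝓡 (2 * n)) p x v)
        (J (p x) (mfderiv (𝓡 (2 * n + 1)) (𝓡 (2 * n)) p x w)) = σ.g.inner x v (σ.φ x w) := by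
    intro x v w
    rw [hJ, hBg, σ.η_φ, mul_zero, sub_zero]
  have hdΩ : ∀ {x : S} {X Y Z : ∀ m : M, TangentSpace (𝓡 (2 * n)) m}
      {X' Y' Z' : ∀ q : S, TangentSpace (𝓡 (2 * n + 1)) q}, SmoothFieldAt Y (p x) →
      SmoothFieldAt Z (p x) →
      (∀ᶠ q in 𝓝 x, mfderiv (𝓡 (2 * n + 1)) (𝓡 (2 * n)) p q (X' q) = X (p q)) →
      (∀ᶠ q in 𝓝 x, mfderiv (𝓡 (2 * n + 1)) (𝓡 (2 * n)) p q (Y' q) = Y (p q)) →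
      (∀ᶠ q in 𝓝 x, mfderiv (𝓡 (2 * n + 1)) (𝓡 (2 * n)) p q (Z' q) = Z (p q)) →
      fieldDeriv X' (fun q => 2 * σ.g.inner q (Y' q) (σ.φ q (Z' q))) x =
        2 * fieldDeriv X (fun m => B m (Y m) (J m (Z m))) (p x) := by
    intro x X Y Z X' Y' Z' hY hZ hXr hYr hZr
    set h : M → ℝ := fun m => B m (Y m) (J m (Z m)) with hh
    have hd : MDifferentiableAt (𝓡 (2 * n)) 𝓘(ℝ, ℝ) h (p x) :=
      (hBs hY (hJs hZ)).mdifferentiableAt (by simp)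
    have h₁ : (fun q => 2 * σ.g.inner q (Y' q) (σ.φ q (Z' q))) =ᶠ[𝓝 x]
        fun q => ((2 : ℝ) • ContinuousLinearMap.id ℝ ℝ) ((h ∘ p) q) := by
      filter_upwards [hYr, hZr] with q h₁ h₂
      rw [← hΩ, h₁, h₂]
      rfl
    rw [fieldDeriv_congr h₁, fieldDeriv_eq_vderiv,
      vderiv_clm_comp _ (hd.comp x (hp.mdifferentiableAt x)),
      vderiv_comp hd (hp.mdifferentiableAt x), hXr.self_of_nhds]
    rfl
  -- each identity on the base is the projection of the corresponding identity on `S`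
  let κ : KahlerStructure n M :=
    { J := J
      g := g
      J_smooth := fun m => contMDiffAt_hom_of_apply fun X hX => hJs hX
      J_sq := by
        intro m u
        obtain ⟨x, rfl⟩ := hp.surjective m
        obtain ⟨v, rfl⟩ := hp.submersion x u
        rw [hJ, hJ, σ.φ_sq, map_add, map_smul, hp.mfderiv_ξ, smul_zero, add_zero, map_neg]
      g_J := by
        intro m u w
        obtain ⟨x, rfl⟩ := hp.surjective m
        obtain ⟨u, rfl⟩ := hp.submersion x u
        obtain ⟨w, rfl⟩ := hp.submersion x w
        change B (p x) _ _ = B (p x) _ _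
        rw [hJ, hJ, hBg, σ.η_φ, zero_mul, sub_zero, hB]
      integrable := by
        intro m X Y hX hY
        obtain ⟨x, rfl⟩ := hp.surjective m
        obtain ⟨X', hX', hXr⟩ := hp.exists_lift_field hX
        obtain ⟨Y', hY', hYr⟩ := hp.exists_lift_field hY
        have hφX : SmoothFieldAt (fun q => σ.φ q (X' q)) x :=
          contMDiffAt_endo_apply (σ.φ_smooth x) hX'
        have hφY : SmoothFieldAt (fun q => σ.φ q (Y' q)) x :=
          contMDiffAt_endo_apply (σ.φ_smooth x) hY'
        have h := congrArg (mfderiv (𝓡 (2 * n + 1)) (𝓡 (2 * n)) p x) (σ.normal x X' Y' hX' hY')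
        rw [map_neg, map_smul, hp.mfderiv_ξ, smul_zero, neg_zero, nijenhuis, map_sub, map_sub,
          map_add, ← hJ, ← hJ, ← hJ, ← hJ, hbr hX hY hX' hY' hXr hYr,
          hbr (hJs hX) (hJs hY) hφX hφY (hJφ hXr) (hJφ hYr),
          hbr (hJs hX) hY hφX hY' (hJφ hXr) hYr, hbr hX (hJs hY) hX' hφY hXr (hJφ hYr)] at h
        exact h
      closed := by
        intro m X Y Z hX hY hZ
        obtain ⟨x, rfl⟩ := hp.surjective m
        obtain ⟨X', hX', hXr⟩ := hp.exists_lift_field hX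
        obtain ⟨Y', hY', hYr⟩ := hp.exists_lift_field hY
        obtain ⟨Z', hZ', hZr⟩ := hp.exists_lift_field hZ
        have h := σ.extDerivTwo_eq_zero (hX'.fieldAt 2) (hY'.fieldAt 2) (hZ'.fieldAt 2)
        rw [extDerivTwo, hdΩ hY hZ hXr hYr hZr, hdΩ hZ hX hYr hZr hXr, hdΩ hX hY hZr hXr hYr,
          ← hΩ, ← hΩ, ← hΩ, hbr hX hY hX' hY' hXr hYr, hbr hY hZ hY' hZ' hYr hZr,
          hbr hZ hX hZ' hX' hZr hXr, hXr.self_of_nhds, hYr.self_of_nhds, hZr.self_of_nhds] at h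
        have h₂ : 2 * extDerivTwo (fun y v w => B y v (J y w)) X Y Z (p x) = 0 := by
          rw [extDerivTwo, ← h]
          ring
        exact (mul_eq_zero.1 h₂).resolve_left two_ne_zero }
  refine ⟨κ, hp.smooth, hp.surjective, hp.submersion, hp.fibre, fun x v w hv hw => ?_,
    fun x v => (hJ x v).symm⟩
  refine (hBg x v w).trans ?_
  have h := hv _ (hp.mfderiv_ξ x)
  rw [σ.g_ξ] at h
  rw [h, zero_mul, sub_zero]

end IsLeafSubmersion

theorem SasakianStructure.HasLeafCharts.hasBoothbyWangBase.{u} {n : ℕ} {S : Type u}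
    [TopologicalSpace S] [T2Space S] [CompactSpace S] [Nonempty S]
    [ChartedSpace (EuclideanSpace ℝ (Fin (2 * n + 1))) S] [IsManifold (𝓡 (2 * n + 1)) ∞ S]
    {σ : SasakianStructure n S} (hσ : σ.HasLeafCharts) : σ.HasBoothbyWangBase := by
  obtain ⟨M, _, _, _, _, p, hp⟩ := hσ.exists_isLeafSubmersion
  obtain ⟨κ, hκ⟩ := hp.exists_isBoothbyWang
  exact ⟨M, inferInstance, inferInstance, inferInstance, inferInstance, κ, p, hκ⟩

end KahlerBase

/-! ### The induced map of the bases -/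

section InducedMap

open Set Filter Topology

variable {n n' : ℕ} {S S' : Type*} [TopologicalSpace S]
  [ChartedSpace (EuclideanSpace ℝ (Fin (2 * n + 1))) S] [IsManifold (𝓡 (2 * n + 1)) ∞ S]
  [TopologicalSpace S'] [ChartedSpace (EuclideanSpace ℝ (Fin (2 * n' + 1))) S']
  [IsManifold (𝓡 (2 * n' + 1)) ∞ S']
  {M M' : Type*} [TopologicalSpace M] [ChartedSpace (EuclideanSpace ℝ (Fin (2 * n))) M]
  [IsManifold (𝓡 (2 * n)) ∞ M] [TopologicalSpace M']
  [ChartedSpace (EuclideanSpace ℝ (Fin (2 * n'))) M'] [IsManifold (𝓡 (2 * n')) ∞ M']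
  {σ : SasakianStructure n S} {σ' : SasakianStructure n' S'}
  {κ : KahlerStructure n M} {κ' : KahlerStructure n' M'} {p : S → M} {p' : S' → M'} {f : S → S'}

/-- The metric of the base, evaluated on the projections of arbitrary tangent vectors. -/
theorem IsBoothbyWang.inner_mfderiv (hp : IsBoothbyWang σ κ p) (x : S)
    (v w : TangentSpace (𝓡 (2 * n + 1)) x) :
    κ.g.inner (p x) (mfderiv (𝓡 (2 * n + 1)) (𝓡 (2 * n)) p x v)
      (mfderiv (𝓡 (2 * n + 1)) (𝓡 (2 * n)) p x w) = σ.g.inner x (σ.φ x v) (σ.φ x w) := by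
  -- the image of `φ` is horizontal, and `φ` induces the orthogonal map `J` on the base
  have hor : ∀ v u : TangentSpace (𝓡 (2 * n + 1)) x,
      mfderiv (𝓡 (2 * n + 1)) (𝓡 (2 * n)) p x u = 0 → σ.g.inner x (σ.φ x v) u = 0 := by
    intro v u hu
    obtain ⟨c, rfl⟩ := hp.isLeafSubmersion.ker hu
    rw [map_smul, σ.g_ξ, σ.η_φ, smul_zero]
  rw [← κ.g_J, ← hp.map_φ, ← hp.map_φ]
  exact hp.riemannian x _ _ (hor v) (hor w)

/-- A Sasakian immersion induces a Kähler immersion of the bases. -/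
theorem IsSasakianImmersion.exists_isKahlerImmersion [T2Space S] (hf : IsSasakianImmersion σ σ' f)
    (hp : IsBoothbyWang σ κ p) (hp' : IsBoothbyWang σ' κ' p') :
    ∃ i : M → M', IsKahlerImmersion κ κ' i ∧ i ∘ p = p' ∘ f := by
  have hps := hp.isLeafSubmersion
  choose s hs using hp.surjective
  -- any section `s` will do, as `f` maps leaves to leaves
  set i : M → M' := fun m => p' (f (s m)) with hi
  have hcomp : i ∘ p = p' ∘ f := by
    ext1 x
    exact (hp'.fibre _ _).2 (hf.sameLeaf ((hp.fibre _ _).1 (hs (p x))))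
  have hsmooth : ContMDiff (𝓡 (2 * n)) (𝓡 (2 * n')) ∞ i := by
    intro m
    obtain ⟨x, rfl⟩ := hp.surjective m
    refine hps.contMDiffAt_of_comp ?_
    rw [hcomp]
    exact (hp'.smooth (f x)).comp x (hf.smooth x)
  have hd : ∀ (x : S) (v : TangentSpace (𝓡 (2 * n + 1)) x),
      (mfderiv (𝓡 (2 * n)) (𝓡 (2 * n')) i (p x)
        (mfderiv (𝓡 (2 * n + 1)) (𝓡 (2 * n)) p x v) : EuclideanSpace ℝ (Fin (2 * n'))) =
      mfderiv (𝓡 (2 * n' + 1)) (𝓡 (2 * n')) p' (f x)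
        (mfderiv (𝓡 (2 * n + 1)) (𝓡 (2 * n' + 1)) f x v) := by
    intro x v
    have h₁ := (hsmooth.mdifferentiableAt (x := p x) (by simp)).hasMFDerivAt.comp x
      (hps.mdifferentiableAt x).hasMFDerivAt
    have h₂ := (hp'.isLeafSubmersion.mdifferentiableAt (f x)).hasMFDerivAt.comp x
      (hf.smooth.mdifferentiableAt (x := x) (by simp)).hasMFDerivAt
    rw [hcomp] at h₁
    exact congrArg (fun T : EuclideanSpace ℝ (Fin (2 * n + 1)) →L[ℝ]
      EuclideanSpace ℝ (Fin (2 * n')) => T v) (hasMFDerivAt_unique h₁ h₂)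
  have hix : ∀ x, i (p x) = p' (f x) := congrFun hcomp
  -- the tangent space of `M'` at `i (p x)`, rewritten as that at `p' (f x)`
  have hg : ∀ (x : S) (m : M') (_ : m = p' (f x)) (u w : EuclideanSpace ℝ (Fin (2 * n'))),
      κ'.g.inner m u w = κ'.g.inner (p' (f x)) u w := by
    rintro x m rfl u w
    rfl
  have hJ : ∀ (x : S) (m : M') (_ : m = p' (f x)) (u : EuclideanSpace ℝ (Fin (2 * n'))),
      (κ'.J m u : EuclideanSpace ℝ (Fin (2 * n'))) = κ'.J (p' (f x)) u := by
    rintro x m rfl u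
    rfl
  have hiso : ∀ (m : M) (v w : TangentSpace (𝓡 (2 * n)) m),
      κ'.g.inner (i m) (mfderiv (𝓡 (2 * n)) (𝓡 (2 * n')) i m v)
        (mfderiv (𝓡 (2 * n)) (𝓡 (2 * n')) i m w) = κ.g.inner m v w := by
    intro m v w
    obtain ⟨x, rfl⟩ := hp.surjective m
    obtain ⟨v, rfl⟩ := hp.submersion x v
    obtain ⟨w, rfl⟩ := hp.submersion x w
    refine (hg x _ (hix x) _ _).trans ?_
    refine (congrArg₂ (fun u w : EuclideanSpace ℝ (Fin (2 * n')) =>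
      κ'.g.inner (p' (f x)) u w) (hd x v) (hd x w)).trans ?_
    refine (hp'.inner_mfderiv (f x) _ _).trans ?_
    rw [← hf.map_φ, ← hf.map_φ, hf.isometric, hp.inner_mfderiv]
  refine ⟨i, ⟨hsmooth, fun m => ?_, hiso, fun m u => ?_⟩, hcomp⟩
  · refine (injective_iff_map_eq_zero _).2 fun u hu => ?_
    by_contra hne
    have h := κ.g.pos m u hne
    rw [← hiso, hu, map_zero] at h
    exact lt_irrefl _ h
  · obtain ⟨x, rfl⟩ := hp.surjective m
    obtain ⟨v, rfl⟩ := hp.submersion x u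
    rw [← hp.map_φ]
    refine (hd x _).trans ?_
    rw [hf.map_φ, hp'.map_φ]
    refine Eq.trans ?_ (hJ x _ (hix x) _).symm
    exact congrArg (fun u : EuclideanSpace ℝ (Fin (2 * n')) =>
      (κ'.J (p' (f x)) u : EuclideanSpace ℝ (Fin (2 * n')))) (hd x v).symm

end InducedMap

theorem proposition2p3 {n n' : ℕ} {S : Type*} {S' : Type*}
    [TopologicalSpace S] [T2Space S] [CompactSpace S] [ConnectedSpace S]
    [ChartedSpace (EuclideanSpace ℝ (Fin (2 * n + 1))) S] [IsManifold (𝓡 (2 * n + 1)) ∞ S]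
    [TopologicalSpace S'] [T2Space S'] [CompactSpace S'] [ConnectedSpace S']
    [ChartedSpace (EuclideanSpace ℝ (Fin (2 * n' + 1))) S'] [IsManifold (𝓡 (2 * n' + 1)) ∞ S']
    (σ : SasakianStructure n S) (σ' : SasakianStructure n' S')
    (hreg : σ'.IsRegular) (f : S → S') (hf : IsSasakianImmersion σ σ' f) :
    σ.IsRegular ∧ σ.HasBoothbyWangBase ∧ σ'.HasBoothbyWangBase ∧
    ∀ (M : Type*) [TopologicalSpace M] [T2Space M]
      [ChartedSpace (EuclideanSpace ℝ (Fin (2 * n))) M] [IsManifold (𝓡 (2 * n)) ∞ M]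
      (κ : KahlerStructure n M) (p : S → M),
    ∀ (M' : Type*) [TopologicalSpace M'] [T2Space M']
      [ChartedSpace (EuclideanSpace ℝ (Fin (2 * n'))) M'] [IsManifold (𝓡 (2 * n')) ∞ M']
      (κ' : KahlerStructure n' M') (p' : S' → M'),
    IsBoothbyWang σ κ p → IsBoothbyWang σ' κ' p' →
    ∃ i : M → M', IsKahlerImmersion κ κ' i ∧ i ∘ p = p' ∘ f := by
  have hσ' : σ'.HasLeafCharts := hreg.hasLeafCharts
  have hσ : σ.HasLeafCharts := hf.hasLeafCharts hσ'
  refine ⟨hσ.isRegular, hσ.hasBoothbyWangBase, hσ'.hasBoothbyWangBase, ?_⟩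
  intro M _ _ _ _ κ p M' _ _ _ _ κ' p' hp hp'
  exact hf.exists_isKahlerImmersion hp hp'
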